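/- **Slowly growing functions.** For integers $k,n\ge 0$ let $A_0(n)=2n$, $B_0(n)=n^2$, and for $k\ge1$ let $A_k(0)=1$, $B_k(0)=2$, $A_k(n)=A_{k-1}(A_k(n-1))$ and $B_k(n)=B_{k-1}(B_k(n-1))$ for $n\ge 1$. Put $\alpha_{2k}(n)=\min\{s\ge0: A_k(s)\ge n\}$ and $\alpha_{2k+1}(n)=\min\{s\ge 0: B_k(s)\ge n\}$. Put $\alpha'_0=\alpha_0$, $\alpha'_1=\alpha_1$, and for $k\ge2$ put $\alpha'_k(n)=\alpha_k(n)$ if $n\le k+1$ and $\alpha'_k(n)=2+\alpha'_k(\alpha'_{k-2}(n))$ if $n\ge k+2$. **Trees.** A Steiner rooted tree $(T,rt)$ is a finite (possibly empty) rooted tree with a set $R(T)\subseteq V(T)$ of required vertices; the other vertices are its Steiner vertices, and $|R(T)|$ is its required-size. It is *pruned* if every Steiner vertex is the least common ancestor of two required vertices. $Prune$ turns any Steiner rooted tree bottom-up into a pruned one: after the subtrees of the children of a vertex $x$ have been pruned, $x$ is kept, with the non-empty results as its subtrees, if it is required or if at least two results are non-empty; otherwise $x$ is deleted and replaced by the non-empty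 result, if there is one. $Decomp(T,\ell)$ visits the vertices in post-order and makes a vertex $v$ a cut vertex, removing its subtree, as soon as the part of its subtree that is still present contains more than $\ell$ required vertices; the set of cut vertices is $CV_\ell$. **Spanners.** For a graph $H$ on $V(T)$, a path in $H$ between $u$ and $v$ is *$T$-monotone* if its vertex sequence is a subsequence of that of the path in $T$ between $u$ and $v$. The *$T$-monotone diameter* of $H$ is the maximum over all pairs of required vertices of the minimum number of edges of a $T$-monotone path in $H$ between them. $H$ is a *1-spanner* for $T$ if for all non-negative edge weights of $T$, when each edge $xy$ of $H$ gets as its weight the distance of $x$ and $y$ in $T$, the distance in $H$ of any two required vertices is equal to their distance in $T$. **Algorithm** $Tree1Spanner((T,rt),n,k)$, for a pruned tree of required-size $n$ and $k\ge2$. If $n\le k$, return $E(T)$. If $n=k+1$, return $E(T)$, together with the edge $c_1c_2$ in case $rt$ has exactly two children $c_1,c_2$. If $n\ge k+2$: (1) let $\ell=\alpha'_{k-2}(n)$ and compute $CV_\ell$ by $Decomp(T,\ell)$. (2) Let $E'=\emptyset$ if $k=2$; let $E'$ be the edge set of the complete graph on $CV_\ell$ if $k=3$; if $k\ge4$, let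 $\tau'$ be the result of $Prune$ on the copy of $T$ whose set of required vertices is $CV_\ell$, and let $E'$ be the result of $Tree1Spanner(\tau',|CV_\ell|,k-2)$. (3) Let $T_1,\dots,T_g$ be the subtrees in $T\setminus CV_\ell$. (4) Let $E''$ consist of all edges $uv$ with $v\in R(T)\setminus CV_\ell$ and $u\in CV_\ell$ such that $u$ is adjacent in $T$ to some vertex of the subtree $T_i$ that contains $v$. (5) Let $E_i$ be the result of $Tree1Spanner(Prune(T_i),|R(T)\cap V(T_i)|,k)$ for each $i$. (6) Return $E'\cup E''\cup\bigcup_i E_i$. **Theorem.** There is an absolute constant $C$ such that the following holds. Let $k\ge2$ and $n\ge0$ be integers, and let $(T,rt)$ be a pruned Steiner rooted tree with required-size $n$. Then Algorithm $Tree1Spanner((T,rt),n,k)$ terminates and returns the edge set $E$ of a graph $G_T=(V(T),E)$ that is a 1-spanner for $T$ and whose $T$-monotone diameter is at most $k$. Moreover $|E|\le 2n\alpha'_k(n)$ if $k$ is even, $|E|\le 3n\alpha'_k(n)+2$ if $k$ is odd, and $|E|\le C\,(n\alpha_k(n)+1)$; and the algorithm takes at most $C\,(n\alpha_k(n)+1)$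 steps (the number of procedure calls in an implementation on linked lists and trees in which each call performs $O(1)$ elementary operations). -/

import Mathlib

namespace TreeSpanner

/-! ### The slowly growing functions -/

/-- The rapidly growing functions `A_k`. -/
def ackA : ℕ → ℕ → ℕ
  | 0, n => 2 * n
  | _ + 1, 0 => 1
  | k + 1, n + 1 => ackA k (ackA (k + 1) n)

/-- The rapidly growing functions `B_k`. -/
def ackB : ℕ → ℕ → ℕ
  | 0, n => n ^ 2
  | _ + 1, 0 => 2
  | k + 1, n + 1 => ackB k (ackB (k + 1) n)

/-- `α_{2j}(n) = min {s : A_j(s) ≥ n}` and `α_{2j+1}(n) = min {s : B_j(s) ≥ n}`. -/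
noncomputable def alpha (k n : ℕ) : ℕ :=
  if k % 2 = 0 then sInf {s | n ≤ ackA (k / 2) s} else sInf {s | n ≤ ackB (k / 2) s}

/-- The variant `α'_k`: it agrees with `α_k` for `k ≤ 1` and for `n ≤ k + 1`, and satisfies
`α'_k(n) = 2 + α'_k(α'_{k-2}(n))` for `k ≥ 2` and `n ≥ k + 2`. The cap at `n - 1` only makes
the termination evident; it is never active, see `alphaPrime_rec`. -/
noncomputable def alphaPrime : ℕ → ℕ → ℕ
  | 0, n => alpha 0 n
  | 1, n => alpha 1 n
  | k + 2, n =>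
    if k + 4 ≤ n then 2 + alphaPrime (k + 2) (min (alphaPrime k n) (n - 1))
    else alpha (k + 2) n
termination_by k n => (k, n)
decreasing_by
  · exact Prod.Lex.left _ _ (by omega)
  · exact Prod.Lex.right _ (by omega)

theorem ackA_succ (k n : ℕ) : ackA (k + 1) (n + 1) = ackA k (ackA (k + 1) n) := by
  rw [ackA]

theorem ackB_succ (k n : ℕ) : ackB (k + 1) (n + 1) = ackB k (ackB (k + 1) n) := by
  rw [ackB]

theorem two_mul_le_ackA (k n : ℕ) : 2 * n ≤ ackA k n ∧ n + 1 ≤ ackA (k + 1) n := by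
  induction k generalizing n with
  | zero =>
    refine ⟨by simp [ackA], ?_⟩
    induction n with
    | zero => simp [ackA]
    | succ n ih => simp only [ackA] at *; omega
  | succ k ih =>
    have h1 : ∀ m, m + 1 ≤ ackA (k + 1) m := fun m => (ih m).2
    have h2 : ∀ m, 2 * m ≤ ackA (k + 1) m := by
      intro m
      cases m with
      | zero => omega
      | succ m =>
        have := (ih (ackA (k + 1) m)).1
        have := h1 m
        simp only [ackA] at *; omega
    refine ⟨h2 n, ?_⟩
    induction n with
    | zero => simp [ackA]
    | succ n ihn =>
      have := h2 (ackA (k + 1 + 1) n)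
      rw [ackA_succ]; omega

theorem sq_le_ackB (k n : ℕ) : n ^ 2 ≤ ackB k n ∧ n + 2 ≤ ackB (k + 1) n := by
  induction k generalizing n with
  | zero =>
    refine ⟨by simp [ackB], ?_⟩
    induction n with
    | zero => simp [ackB]
    | succ n ih => simp only [ackB] at *; nlinarith
  | succ k ih =>
    have h1 : ∀ m, m + 2 ≤ ackB (k + 1) m := fun m => (ih m).2
    have h2 : ∀ m, m ^ 2 ≤ ackB (k + 1) m := by
      intro m
      cases m with
      | zero => simp
      | succ m =>
        have := (ih (ackB (k + 1) m)).1
        have := h1 m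
        simp only [ackB] at *; nlinarith
    refine ⟨h2 n, ?_⟩
    induction n with
    | zero => simp [ackB]
    | succ n ihn =>
      have := h2 (ackB (k + 1 + 1) n)
      rw [ackB_succ]; nlinarith

theorem ackA_three (k : ℕ) : 2 * k + 3 ≤ ackA (k + 1) 3 := by
  induction k with
  | zero => simp [ackA]
  | succ k ih =>
    have hm : Monotone (ackA (k + 1)) := monotone_nat_of_le_succ fun m => by
      have := (two_mul_le_ackA k (ackA (k + 1) m)).1
      simp only [ackA] at *; omega
    have h1 : ackA (k + 1) 4 ≤ ackA (k + 1 + 1) 3 := by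
      rw [ackA_succ (k + 1) 2]; exact hm (two_mul_le_ackA (k + 2) 2).1
    have h2 : 2 * ackA (k + 1) 3 ≤ ackA (k + 1) 4 := by
      rw [ackA_succ k 3]; exact (two_mul_le_ackA k (ackA (k + 1) 3)).1
    omega

theorem ackB_three (k : ℕ) : 2 * k + 4 ≤ ackB (k + 1) 3 := by
  induction k with
  | zero => simp [ackB]
  | succ k ih =>
    have hm : Monotone (ackB (k + 1)) := monotone_nat_of_le_succ fun m => by
      have := (sq_le_ackB k (ackB (k + 1) m)).1
      simp only [ackB] at *; nlinarith
    have h1 : ackB (k + 1) 4 ≤ ackB (k + 1 + 1) 3 := by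
      rw [ackB_succ (k + 1) 2]; exact hm (sq_le_ackB (k + 1) 2).2
    have h2 : (ackB (k + 1) 3) ^ 2 ≤ ackB (k + 1) 4 := by
      rw [ackB_succ k 3]; exact (sq_le_ackB k (ackB (k + 1) 3)).1
    nlinarith

theorem alpha_le_pred (k n : ℕ) : alpha (k + 2) n ≤ n - 1 := by
  have hk : (k + 2) / 2 = k / 2 + 1 := by omega
  unfold alpha
  rw [hk]
  split
  · refine Nat.sInf_le ?_
    have := (two_mul_le_ackA (k / 2) (n - 1)).2
    simp only [Set.mem_ofPred_eq]; omega
  · refine Nat.sInf_le ?_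
    have := (sq_le_ackB (k / 2) (n - 1)).2
    simp only [Set.mem_ofPred_eq]; omega

theorem alpha_le_three (k n : ℕ) (h : n ≤ k + 3) : alpha (k + 2) n ≤ 3 := by
  have hk : (k + 2) / 2 = k / 2 + 1 := by omega
  unfold alpha
  rw [hk]
  split
  · refine Nat.sInf_le ?_
    have := ackA_three (k / 2)
    simp only [Set.mem_ofPred_eq]; omega
  · refine Nat.sInf_le ?_
    have := ackB_three (k / 2)
    simp only [Set.mem_ofPred_eq]; omega

theorem alpha_zero_le (n s : ℕ) (h : n ≤ 2 * s) : alpha 0 n ≤ s := by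
  simp only [alpha]
  exact Nat.sInf_le (by simpa [ackA] using h)

theorem alpha_one_le (n s : ℕ) (h : n ≤ s ^ 2) : alpha 1 n ≤ s := by
  simp only [alpha]
  exact Nat.sInf_le (by simpa [ackB] using h)

theorem alphaPrime_zero (n : ℕ) : alphaPrime 0 n = alpha 0 n := by
  rw [alphaPrime]

theorem alphaPrime_one (n : ℕ) : alphaPrime 1 n = alpha 1 n := by
  rw [alphaPrime]

theorem alphaPrime_small (k n : ℕ) (h : n ≤ k + 3) :
    alphaPrime (k + 2) n = alpha (k + 2) n := by
  rw [alphaPrime, if_neg (by omega)]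

theorem alphaPrime_rec_of_lt (k n : ℕ) (h : k + 4 ≤ n) (hlt : alphaPrime k n < n) :
    alphaPrime (k + 2) n = 2 + alphaPrime (k + 2) (alphaPrime k n) := by
  rw [alphaPrime, if_pos h, min_eq_left (by omega)]

theorem alphaPrime_le_sub_two (k : ℕ) : ∀ n, k + 4 ≤ n → alphaPrime k n ≤ n - 2 := by
  induction k using Nat.twoStepInduction with
  | zero =>
      intro n hn
      rw [alphaPrime_zero]; exact alpha_zero_le _ _ (by omega)
  | one =>
      intro n hn
      rw [alphaPrime_one]
      obtain ⟨m, rfl⟩ := Nat.exists_eq_add_of_le hn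
      exact alpha_one_le _ _ (by
        have : 1 + 4 + m - 2 = m + 3 := by omega
        rw [this]; nlinarith)
  | more k ihk _ =>
    have hrec : ∀ n, k + 4 ≤ n →
        alphaPrime (k + 2) n = 2 + alphaPrime (k + 2) (alphaPrime k n) := fun n hn =>
      alphaPrime_rec_of_lt k n hn (by have := ihk n hn; omega)
    intro n
    induction n using Nat.strong_induction_on with
    | _ n ih =>
      intro hn
      have hm := ihk n (by omega)
      rw [hrec n (by omega)]
      by_cases h1 : k + 6 ≤ alphaPrime k n
      · have := ih (alphaPrime k n) (by omega) (by omega)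
        omega
      by_cases h2 : k + 4 ≤ alphaPrime k n
      · have h3 := ihk _ h2
        rw [hrec _ h2, alphaPrime_small k _ (by omega)]
        have h4 := alpha_le_three k (alphaPrime k (alphaPrime k n)) (by omega)
        have h5 := alpha_le_pred k (alphaPrime k (alphaPrime k n))
        by_cases h6 : 9 ≤ n
        · omega
        have h7 : alphaPrime k n ≤ n - 3 := by
          have : k = 0 ∨ k = 1 ∨ k = 2 := by omega
          rcases this with rfl | rfl | rfl
          · rw [alphaPrime_zero]; exact alpha_zero_le _ _ (by omega)
          · rw [alphaPrime_one]
            exact (alpha_one_le _ 3 (by omega)).trans (by omega)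
          · have h8 : alphaPrime 0 n ≤ 4 := by
              rw [alphaPrime_zero]; exact alpha_zero_le _ _ (by omega)
            obtain rfl : n = 8 := by omega
            have h9 : alphaPrime 2 8 = 2 + alphaPrime 2 (alphaPrime 0 8) :=
              alphaPrime_rec_of_lt 0 8 (by omega) (by omega)
            by_cases h10 : 4 ≤ alphaPrime 0 8
            · have h11 : alphaPrime 0 8 = 4 := by omega
              have h12 : alphaPrime 0 4 ≤ 2 := by
                rw [alphaPrime_zero]; exact alpha_zero_le _ _ (by omega)
              have h13 : alphaPrime 2 4 = 2 + alphaPrime 2 (alphaPrime 0 4) :=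
                alphaPrime_rec_of_lt 0 4 (by omega) (by omega)
              have h14 := alphaPrime_small 0 (alphaPrime 0 4) (by omega)
              have := alpha_le_pred 0 (alphaPrime 0 4)
              norm_num at *
              rw [h11] at h9
              omega
            · have h14 := alphaPrime_small 0 (alphaPrime 0 8) (by omega)
              have := alpha_le_pred 0 (alphaPrime 0 8)
              norm_num at *
              omega
        omega
      · rw [alphaPrime_small k _ (by omega)]
        have h4 := alpha_le_three k (alphaPrime k n) (by omega)
        have h5 := alpha_le_pred k (alphaPrime k n)
        by_cases h6 : 7 ≤ n
        · omega
        obtain rfl : k = 0 := by omega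
        have : alphaPrime 0 n ≤ 3 := by
          rw [alphaPrime_zero]; exact alpha_zero_le _ _ (by omega)
        omega

/-- The recursion that defines `α'`. -/
theorem alphaPrime_rec (k n : ℕ) (h : k + 4 ≤ n) :
    alphaPrime (k + 2) n = 2 + alphaPrime (k + 2) (alphaPrime k n) := by
  exact alphaPrime_rec_of_lt k n h (by have := alphaPrime_le_sub_two k n h; omega)

/-! ### Rooted trees -/

/-- Finite ordered rooted forests in the first-child / next-sibling representation: `node a c s`
is a tree whose root carries the label `a` and whose root's subtrees form the forest `c`, followed
by the further trees `s`. -/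
inductive Forest (A : Type) : Type where
  | nil : Forest A
  | node (a : A) (children next : Forest A) : Forest A

namespace Forest

variable {A V : Type}

/-- The labels of all vertices. -/
def labels : Forest A → List A
  | nil => []
  | node a c s => a :: (c.labels ++ s.labels)

/-- The labels of the roots of the trees of a forest. -/
def roots : Forest A → List A
  | nil => []
  | node a _ s => a :: s.roots

/-- In a Steiner forest a vertex is labelled by its name and by a flag that says whether it is
required (`true`) or a Steiner vertex (`false`). This is the list of all vertex names. -/
def verts (T : Forest (V × Bool)) : List V := T.labels.map Prod.fst

/-- A Steiner rooted tree: distinct vertices have distinct names, and there is at most one root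
(the empty tree is allowed). -/
def IsSteinerTree (T : Forest (V × Bool)) : Prop := T.verts.Nodup ∧ T.roots.length ≤ 1

/-- `R(T)`. -/
def required (T : Forest (V × Bool)) : Set V := {v | (v, true) ∈ T.labels}

/-- `S(T)`. -/
def steiner (T : Forest (V × Bool)) : Set V := {v | (v, false) ∈ T.labels}

/-- `T.IsChild x y`: the vertex `y` is a child of the vertex `x`. -/
def IsChild : Forest (V × Bool) → V → V → Prop
  | nil, _, _ => False
  | node a c s, x, y => (x = a.1 ∧ y ∈ c.roots.map Prod.fst) ∨ c.IsChild x y ∨ s.IsChild x y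

/-- The underlying undirected graph of `T` (names that do not occur in `T` are isolated). -/
def graph (T : Forest (V × Bool)) : SimpleGraph V := SimpleGraph.fromRel T.IsChild

/-- `x` is an ancestor of `y`; every vertex is an ancestor of itself. -/
def IsAncestor (T : Forest (V × Bool)) : V → V → Prop := Relation.ReflTransGen T.IsChild

/-- `x` is the least common ancestor of `u` and `v`. -/
def IsLCA (T : Forest (V × Bool)) (x u v : V) : Prop :=
  T.IsAncestor x u ∧ T.IsAncestor x v ∧
    ∀ y, T.IsAncestor y u → T.IsAncestor y v → T.IsAncestor y x

/-- Every Steiner vertex is useful, i.e. the LCA of some pair of required vertices. -/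
def IsPruned (T : Forest (V × Bool)) : Prop :=
  ∀ x ∈ T.steiner, ∃ u ∈ T.required, ∃ v ∈ T.required, T.IsLCA x u v

end Forest

/-! ### Spanners -/

section Spanners

open scoped ENNReal NNReal

variable {V : Type}

/-- A path in `H` from `u` to `v` is `T`-monotone if its sequence of vertices is a subsequence
of that of the path in `T` from `u` to `v`. -/
def IsMonotone (T : SimpleGraph V) {H : SimpleGraph V} {u v : V} (q : H.Walk u v) : Prop :=
  ∃ p : T.Walk u v, p.IsPath ∧ q.support.Sublist p.support

/-- The `T`-monotone distance in `H`, `∞` if there is no `T`-monotone path. -/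
noncomputable def monotoneDist (T H : SimpleGraph V) (u v : V) : ℕ∞ :=
  ⨅ (q : H.Walk u v) (_ : IsMonotone T q), (q.length : ℕ∞)

/-- The largest `T`-monotone distance in `H` between two vertices of `R`. -/
noncomputable def monotoneDiam (T H : SimpleGraph V) (R : Set V) : ℕ∞ :=
  ⨆ (u ∈ R) (v ∈ R), monotoneDist T H u v

/-- The shortest-path distance in `G` where the edge `xy` has the weight `w x y`. -/
noncomputable def weightedDist (G : SimpleGraph V) (w : V → V → ℝ≥0∞) (u v : V) : ℝ≥0∞ :=
  ⨅ p : G.Walk u v, (p.darts.map fun d => w d.fst d.snd).sum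

/-- The tree metric `M_T` for the edge weights `w`. -/
noncomputable def treeMetric (T : SimpleGraph V) (w : Sym2 V → ℝ≥0) : V → V → ℝ≥0∞ :=
  weightedDist T fun x y => (w s(x, y) : ℝ≥0∞)

/-- `H`, with every edge weighted by the tree metric, is a 1-spanner for `T` with respect to the
set `R` of required vertices, whatever the edge weights of `T` are. -/
def IsOneSpanner (T H : SimpleGraph V) (R : Set V) : Prop :=
  ∀ w : Sym2 V → ℝ≥0, ∀ u ∈ R, ∀ v ∈ R,
    weightedDist H (treeMetric T w) u v = treeMetric T w u v

/-- The graph with a given list of edges. -/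
def graphOf (E : List (V × V)) : SimpleGraph V :=
  SimpleGraph.fromEdgeSet {e | ∃ p ∈ E, e = s(p.1, p.2)}

end Spanners

/-! ### The algorithm

The computation is carried out by procedures in the monad `Alg`, which maintain a step counter.
Every call of every procedure, recursive calls included, increments the counter by one. Apart from
procedure calls the body of each procedure performs only a bounded number of elementary operations
on machine words and pointers: case distinctions on a forest, list or flag, creation of one node,
list cell or record, comparisons, additions, multiplications, parity and halving of numbers. So the
counter is the running time on a unit-cost machine up to an absolute constant factor. Lists of
results are built up in an accumulator argument, so that no concatenation of lists is ever needed.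

The procedures that recurse on something other than the structure of their input have an additional
argument `d`, a bound on the depth of the recursion; if it is exceeded, then there is no result
(`none`). It is no part of the computation: an execution terminates with a certain result after
a certain number of steps if this is what comes out for all large enough `d`. -/

/-- Computations with a step counter; `none` means that the depth bound was exceeded. -/
abbrev Alg (X : Type) : Type := StateT ℕ Option X

/-- Count one step. -/
def tick : Alg Unit := modify (· + 1)

section Procedures

variable {V : Type}

/-- Search for the least `r ≥ s` with `n ≤ r * r`. -/
def sqrtSearch : ℕ → ℕ → ℕ → Alg ℕ
  | 0, _, _ => failure
  | d + 1, n, s => do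
    tick
    if n ≤ s * s then return s else sqrtSearch d n (s + 1)

/-- The computation of `α'_k(n)`. For `k ≥ 2` and `n ≤ k + 1` it uses that `α_k` takes on these
arguments the values given in the two lists of cases, for even and for odd `k`. -/
def computeAlpha : ℕ → ℕ → ℕ → Alg ℕ
  | 0, _, _ => failure
  | d + 1, k, n => do
    tick
    if k = 0 then return (n + 1) / 2
    else if k = 1 then sqrtSearch d n 0
    else if n ≤ k + 1 then
      if k % 2 = 0 then
        if n ≤ 1 then return 0
        else if n ≤ 2 then return 1
        else if n ≤ 4 then return 2
        else return 3
      else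
        if n ≤ 2 then return 0 else return 1
    else
      let m ← computeAlpha d (k - 2) n
      let r ← computeAlpha d k m
      return 2 + r

/-- Procedure `Prune`, applied to each tree of a forest; trees that become empty disappear. -/
def prune : Forest (V × Bool) → Alg (Forest (V × Bool))
  | .nil => do
    tick
    return .nil
  | .node (v, b) c s => do
    tick
    let c' ← prune c
    let s' ← prune s
    if b then return .node (v, b) c' s'
    else match c' with
      | .nil => return s'
      | .node a d .nil => return .node a d s'
      | .node a d (.node a₂ d₂ s₂) => return .node (v, b) (.node a d (.node a₂ d₂ s₂)) s'

/-- Procedure `Decomp` with parameter `ℓ`. It returns the forest in which each label `(v, b)` is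
extended by a flag that says whether `v` is a cut vertex, together with the sum of the values
`size` of those roots that are not cut vertices (the subtrees of the others are removed). -/
def decomp (ℓ : ℕ) : Forest (V × Bool) → Alg (Forest (V × Bool × Bool) × ℕ)
  | .nil => do
    tick
    return (.nil, 0)
  | .node (v, b) c s => do
    tick
    let (c', x) ← decomp ℓ c
    let (s', y) ← decomp ℓ s
    let size := if b then x + 1 else x
    if ℓ < size then return (.node (v, b, true) c' s', y)
    else return (.node (v, b, false) c' s', size + y)

/-- The cut vertices of a forest as returned by `decomp`, put in front of `acc`. -/
def cutVertices : Forest (V × Bool × Bool) → List V → Alg (List V)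
  | .nil, acc => do
    tick
    return acc
  | .node (v, _, cut) c s, acc => do
    tick
    let acc ← cutVertices c acc
    let acc ← cutVertices s acc
    if cut then return v :: acc else return acc

/-- The copy of the tree in which exactly the cut vertices are required. -/
def recolor : Forest (V × Bool × Bool) → Alg (Forest (V × Bool))
  | .nil => do
    tick
    return .nil
  | .node (v, _, cut) c s => do
    tick
    let c' ← recolor c
    let s' ← recolor s
    return .node (v, cut) c' s'

/-- The length of a list. -/
def count {X : Type} : List X → Alg ℕ
  | [] => do
    tick
    return 0
  | _ :: l => do
    tick
    let m ← count l
    return m + 1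

/-- Put all pairs `(u, v)`, `u` in the list, in front of `acc`. -/
def pairsWith (v : V) : List V → List (V × V) → Alg (List (V × V))
  | [], acc => do
    tick
    return acc
  | u :: l, acc => do
    tick
    pairsWith v l ((u, v) :: acc)

/-- The edges of the complete graph on a list of distinct vertices, put in front of `acc`. -/
def completeEdges : List V → List (V × V) → Alg (List (V × V))
  | [], acc => do
    tick
    return acc
  | v :: l, acc => do
    tick
    let acc ← pairsWith v l acc
    completeEdges l acc

/-- The edges of a forest, put in front of `acc`; if a parent is given, then the edges from it to
the roots are included. -/
def treeEdges : Option V → Forest (V × Bool) → List (V × V) → Alg (List (V × V))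
  | _, .nil, acc => do
    tick
    return acc
  | parent, .node (v, _) c s, acc => do
    tick
    let acc ← treeEdges (some v) c acc
    let acc ← treeEdges parent s acc
    match parent with
      | none => return acc
      | some p => return (p, v) :: acc

/-- The required vertices of a forest, put in front of `acc`. -/
def requiredList : Forest (V × Bool) → List V → Alg (List V)
  | .nil, acc => do
    tick
    return acc
  | .node (v, b) c s, acc => do
    tick
    let acc ← requiredList c acc
    let acc ← requiredList s acc
    if b then return v :: acc else return acc

/-- A subtree `T_i` of `T \ CV`, with its border. -/
structure Component (V : Type) where
  tree : Forest (V × Bool)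
  border : List V

/-- The position of a forest during the removal of the cut vertices: its trees hang below a vertex
that is not a cut vertex (`inside`), or they hang below the cut vertex `u` (`below (some u)`), or
they are not below any vertex (`below none`). -/
inductive Position (V : Type) where
  | inside
  | below (u : Option V)

/-- Removal of the cut vertices from a forest. The result consists of
* the part of the forest that is attached to the current subtree (relevant for `inside`),
* the cut vertices that are adjacent to it from below, put in front of `border`,
* the subtrees completed on the way, put in front of `done`. -/
def split : Position V → Forest (V × Bool × Bool) → List V → List (Component V) →
    Alg (Forest (V × Bool) × List V × List (Component V))
  | _, .nil, border, done => do
    tick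
    return (.nil, border, done)
  | pos, .node (v, _, true) c s, border, done => do
    tick
    let (_, _, done) ← split (.below (some v)) c [] done
    split pos s (v :: border) done
  | .inside, .node (v, b, false) c s, border, done => do
    tick
    let (c', border, done) ← split .inside c border done
    let (s', border, done) ← split .inside s border done
    return (.node (v, b) c' s', border, done)
  | .below u, .node (v, b, false) c s, border, done => do
    tick
    let (c', down, done) ← split .inside c [] done
    let bd := match u with
      | none => down
      | some u => u :: down
    split (.below u) s border (⟨.node (v, b) c' .nil, bd⟩ :: done)

/-- All pairs of a vertex of `border` and a vertex of the second list, put in front of `acc`. -/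
def connectAll (border : List V) : List V → List (V × V) → Alg (List (V × V))
  | [], acc => do
    tick
    return acc
  | v :: l, acc => do
    tick
    let acc ← pairsWith v border acc
    connectAll border l acc

/-- The edges between the required vertices of the subtrees and the border vertices of these
subtrees, put in front of `acc`. -/
def borderEdges : List (Component V) → List (V × V) → Alg (List (V × V))
  | [], acc => do
    tick
    return acc
  | t :: l, acc => do
    tick
    let r ← requiredList t.tree []
    let acc ← connectAll t.border r acc
    borderEdges l acc

/-- The recursive calls for the prunings of the subtrees; `call T m acc` stands for the recursive
call of the algorithm on the tree `T` of required-size `m`. -/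
def spanComponents (call : Forest (V × Bool) → ℕ → List (V × V) → Alg (List (V × V))) :
    List (Component V) → List (V × V) → Alg (List (V × V))
  | [], acc => do
    tick
    return acc
  | t :: l, acc => do
    tick
    let T' ← prune t.tree
    let r ← requiredList t.tree []
    let m ← count r
    let acc ← call T' m acc
    spanComponents call l acc

/-- Algorithm `Tree1Spanner((T, rt), n, k)` with depth bound `d`; the edges found are put in front
of `acc`. -/
def tree1Spanner : ℕ → Forest (V × Bool) → ℕ → ℕ → List (V × V) → Alg (List (V × V))
  | 0, _, _, _, _ => failure
  | d + 1, T, n, k, acc => do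
    tick
    if n ≤ k then treeEdges none T acc
    else if n = k + 1 then
      match T with
      | .node _ (.node c₁ _ (.node c₂ _ .nil)) .nil => treeEdges none T ((c₁.1, c₂.1) :: acc)
      | _ => treeEdges none T acc
    else
      let ℓ ← computeAlpha d (k - 2) n
      let (M, _) ← decomp ℓ T
      let acc ←
        if k = 2 then pure acc
        else if k = 3 then do
          let cv ← cutVertices M []
          completeEdges cv acc
        else do
          let τ ← recolor M
          let τ' ← prune τ
          let cv ← cutVertices M []
          let m ← count cv
          tree1Spanner d τ' m (k - 2) acc
      let (_, _, comps) ← split (.below none) M [] []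
      let acc ← borderEdges comps acc
      spanComponents (fun T' m acc => tree1Spanner d T' m k acc) comps acc

end Procedures

end TreeSpanner

/-! The threshold `ℓ = α'_{k-2}(n)` balances two recursions. Each cut removes more than `ℓ` required
vertices, so `(ℓ + 1) * |CV| ≤ n` (`mul_length_cuts_add_le`). Since `α'_{k-2}` is monotone, the
inner call with `k - 2` on `CV` costs about `|CV| * α'_{k-2}(|CV|) ≤ |CV| * ℓ ≤ n`, which is linear
and carries no `α'` factor (`exists_innerEdges`). For `k = 2` there is at most one cut vertex, and
for `k = 3` at most `√n` of them. The remaining subtrees have required-size at most `ℓ`, so the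
recursion with the same `k` replaces `α'_k(n)` by `α'_k(ℓ) = α'_k(n) - 2`. These two units of `n`
pay for the inner edges and for the border edges.

There are linearly many border edges, although a subtree may touch many cut vertices: apart from the
one above its root, a cut vertex is charged only to the subtree that contains its parent. Hence the
border sizes minus one add up to at most `|CV|` (`sum_border_le`), and each such unit is multiplied
by at most `ℓ` (`sum_border_components_le`).

For the diameter, a tree path between required vertices is split at its first and last cut vertex.
One border edge leads to the first, the inner spanner joins the two in `k - 2` steps, and one border
edge leads away; a path without cut vertices stays inside one subtree (`HasShortcuts.combine`).
Pruning does no harm because a path, restricted to the surviving vertices, is a path of the pruned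
tree (`IsPathList.exists_pruned`). In the base cases the tree path itself is short enough: in a
reduced tree with `n` required vertices a path has at most `n + 1` vertices, and when it has that
many it bends at a root with exactly two children, where the extra edge skips the root
(`IsBend.exists_of_length`).

Everything is carried by the list predicate `HasShortcuts`. It gives the monotone diameter directly,
and the 1-spanner property because skipping vertices of a tree path never increases its length in
the tree metric.

Two estimates on `α'` are uniform in `k`: `α'_k ≤ 2 α_k + 10` (`alphaPrime_le_two_mul_alpha`), which
converts the bounds into bounds by `α_k`, and a linear bound on the time for computing `α'_k(n)`
(`exists_alphaCost_le`). -/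

namespace TreeSpanner

/-! ### Properties of the slowly growing functions -/

/-- `A_{k/2}` or `B_{k/2}`, depending on the parity of `k`. -/
def growth (k : ℕ) : ℕ → ℕ := if k % 2 = 0 then ackA (k / 2) else ackB (k / 2)

theorem alpha_eq_sInf (k n : ℕ) : alpha k n = sInf {s | n ≤ growth k s} := by
  unfold alpha growth
  split <;> rfl

theorem growth_succ (k s : ℕ) : growth (k + 2) (s + 1) = growth k (growth (k + 2) s) := by
  have h1 : (k + 2) % 2 = k % 2 := by omega
  have h2 : (k + 2) / 2 = k / 2 + 1 := by omega
  unfold growth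
  rw [h1, h2]
  split
  · exact ackA_succ _ _
  · exact ackB_succ _ _

theorem lt_growth (k s : ℕ) : s + 1 ≤ growth (k + 2) s := by
  have h2 : (k + 2) / 2 = k / 2 + 1 := by omega
  unfold growth
  rw [h2]
  split
  · exact (two_mul_le_ackA _ _).2
  · exact le_trans (by omega) (sq_le_ackB _ _).2

/-- One more argument step applies the function of the level below, which dominates doubling or
squaring; squaring at least doubles because the `B` values are at least `2`. -/
theorem two_mul_growth_le (k s : ℕ) : 2 * growth (k + 2) s ≤ growth (k + 2) (s + 1) := by
  have h2 : (k + 2) / 2 = k / 2 + 1 := by omega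
  unfold growth
  rw [h2]
  split
  · rw [ackA_succ]; exact (two_mul_le_ackA _ _).1
  · rw [ackB_succ]
    have := (sq_le_ackB (k / 2) (ackB (k / 2 + 1) s)).1
    have := (sq_le_ackB (k / 2) s).2
    nlinarith

theorem growth_mono (k : ℕ) : Monotone (growth (k + 2)) :=
  monotone_nat_of_le_succ fun s => by have := two_mul_growth_le k s; omega

/-- The chain `1, 2, 4` reproduces itself from level to level, so the small values of `α_k` for even
`k` do not depend on `k`. -/
theorem ackA_zero_one_two (j : ℕ) :
    ackA (j + 1) 0 = 1 ∧ ackA (j + 1) 1 = 2 ∧ ackA (j + 1) 2 = 4 := by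
  induction j with
  | zero => simp [ackA]
  | succ j ih =>
    obtain ⟨h0, h1, h2⟩ := ih
    have e0 : ackA (j + 2) 0 = 1 := by simp [ackA]
    have e1 : ackA (j + 2) 1 = 2 := by rw [ackA_succ, e0, h1]
    exact ⟨e0, e1, by rw [ackA_succ, e1, h2]⟩

/-- The value at `1` already outgrows the index, which is why `α_k` for odd `k` takes only the
values `0` and `1` in the range not governed by the recursion. -/
theorem ackB_one (j : ℕ) : ackB (j + 1) 0 = 2 ∧ 2 * j + 4 ≤ ackB (j + 1) 1 := by
  induction j with
  | zero => simp [ackB]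
  | succ j ih =>
    have e0 : ackB (j + 2) 0 = 2 := by simp [ackB]
    refine ⟨e0, ?_⟩
    rw [ackB_succ, e0, ackB_succ]
    have := (sq_le_ackB j (ackB (j + 1) 1)).1
    nlinarith [ih.2]

theorem four_le_growth_two (k : ℕ) : 4 ≤ growth (k + 2) 2 := by
  have h0 := lt_growth k 0
  have h1 := two_mul_growth_le k 0
  have h2 := two_mul_growth_le k 1
  simp only [zero_add, Nat.reduceAdd] at *
  omega

theorem alpha_le_of_le_growth {k n s : ℕ} (h : n ≤ growth k s) : alpha k n ≤ s := by
  rw [alpha_eq_sInf]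
  exact Nat.sInf_le h

theorem le_growth_alpha (k n : ℕ) : n ≤ growth (k + 2) (alpha (k + 2) n) := by
  rw [alpha_eq_sInf]
  exact Nat.sInf_mem (s := {s | n ≤ growth (k + 2) s})
    ⟨n, by have := lt_growth k n; simp only [Set.mem_ofPred_eq]; omega⟩

theorem alpha_zero_eq (n : ℕ) : alpha 0 n = (n + 1) / 2 := by
  apply le_antisymm
  · exact alpha_zero_le _ _ (by omega)
  · have : n ≤ growth 0 (alpha 0 n) := by
      rw [alpha_eq_sInf]
      exact Nat.sInf_mem (s := {s | n ≤ growth 0 s})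
        ⟨n, by simp only [Set.mem_ofPred_eq, growth]; simp [ackA]; omega⟩
    simp only [growth] at this
    simp [ackA] at this
    omega

theorem le_alpha_one_sq (n : ℕ) : n ≤ alpha 1 n * alpha 1 n := by
  have : n ≤ growth 1 (alpha 1 n) := by
    rw [alpha_eq_sInf]
    exact Nat.sInf_mem (s := {s | n ≤ growth 1 s})
      ⟨n, by simp only [Set.mem_ofPred_eq, growth]; simp [ackB]; nlinarith⟩
  simp only [growth] at this
  simp [ackB] at this
  nlinarith

theorem alpha_mono (k : ℕ) : Monotone (alpha (k + 2)) := fun _ n h =>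
  alpha_le_of_le_growth (h.trans (le_growth_alpha k n))

theorem lt_alpha_iff (k n s : ℕ) : s < alpha (k + 2) n ↔ growth (k + 2) s < n := by
  constructor
  · intro h
    by_contra hn
    have := alpha_le_of_le_growth (k := k + 2) (n := n) (s := s) (by omega)
    omega
  · intro h
    by_contra hn
    have := growth_mono k (show alpha (k + 2) n ≤ s by omega)
    have := le_growth_alpha k n
    omega

theorem growth_even (k : ℕ) (h : k % 2 = 0) :
    growth (k + 2) 0 = 1 ∧ growth (k + 2) 1 = 2 ∧ growth (k + 2) 2 = 4 ∧
      k + 3 ≤ growth (k + 2) 3 := by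
  have h2 : (k + 2) / 2 = k / 2 + 1 := by omega
  have h3 : (k + 2) % 2 = 0 := by omega
  unfold growth
  rw [h2, if_pos h3]
  have := ackA_three (k / 2)
  have := ackA_zero_one_two (k / 2)
  refine ⟨this.1, this.2.1, this.2.2, by omega⟩

theorem growth_odd (k : ℕ) (h : k % 2 = 1) :
    growth (k + 2) 0 = 2 ∧ k + 3 ≤ growth (k + 2) 1 := by
  have h2 : (k + 2) / 2 = k / 2 + 1 := by omega
  have h3 : ¬ (k + 2) % 2 = 0 := by omega
  unfold growth
  rw [h2, if_neg h3]
  have := ackB_one (k / 2)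
  refine ⟨this.1, by omega⟩

/-- The values of `α_k` on small arguments, for even indices. -/
theorem alpha_even_small (k n : ℕ) (hk : k % 2 = 0) (hn : n ≤ k + 3) :
    alpha (k + 2) n = if n ≤ 1 then 0 else if n ≤ 2 then 1 else if n ≤ 4 then 2 else 3 := by
  obtain ⟨h0, h1, h2, h3⟩ := growth_even k hk
  have a0 := lt_alpha_iff k n 0
  have a1 := lt_alpha_iff k n 1
  have a2 := lt_alpha_iff k n 2
  have a3 := lt_alpha_iff k n 3
  split_ifs <;> omega

/-- The values of `α_k` on small arguments, for odd indices. -/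
theorem alpha_odd_small (k n : ℕ) (hk : k % 2 = 1) (hn : n ≤ k + 3) :
    alpha (k + 2) n = if n ≤ 2 then 0 else 1 := by
  obtain ⟨h0, h1⟩ := growth_odd k hk
  have a0 := lt_alpha_iff k n 0
  have a1 := lt_alpha_iff k n 1
  split_ifs <;> omega

theorem alpha_pos_of_two_lt (k n : ℕ) (hn : 3 ≤ n) : 1 ≤ alpha (k + 2) n := by
  rcases Nat.mod_two_eq_zero_or_one k with h | h
  · have := (lt_alpha_iff k n 0).2 (by rw [(growth_even k h).1]; omega)
    omega
  · have := (lt_alpha_iff k n 0).2 (by rw [(growth_odd k h).1]; omega)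
    omega

theorem two_le_alphaPrime (k n : ℕ) (h : k + 4 ≤ n) : 2 ≤ alphaPrime k n := by
  match k with
  | 0 => rw [alphaPrime_zero, alpha_zero_eq]; omega
  | 1 =>
    rw [alphaPrime_one]
    have := le_alpha_one_sq n
    by_contra hn
    have : alpha 1 n ≤ 1 := by omega
    nlinarith
  | k + 2 => rw [alphaPrime_rec k n (by omega)]; omega

theorem alphaPrime_lt (k n : ℕ) (h : k + 4 ≤ n) : alphaPrime k n < n := by
  have := alphaPrime_le_sub_two k n h
  omega

/-- Only the transition from the explicit values to the recursion is delicate; on either side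
monotonicity is inherited from `α_k` or from level `k - 2`. -/
theorem alphaPrime_mono (k : ℕ) : Monotone (alphaPrime k) := by
  induction k using Nat.twoStepInduction with
  | zero =>
    intro m n h
    rw [alphaPrime_zero, alphaPrime_zero, alpha_zero_eq, alpha_zero_eq]
    omega
  | one =>
    intro m n h
    rw [alphaPrime_one, alphaPrime_one]
    exact alpha_one_le _ _ (by have := le_alpha_one_sq n; nlinarith)
  | more k ih _ =>
    intro m n
    induction n using Nat.strong_induction_on generalizing m with
    | _ n IH =>
      intro h
      by_cases h1 : n ≤ k + 3
      · rw [alphaPrime_small _ _ h1, alphaPrime_small _ _ (h.trans h1)]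
        exact alpha_mono k h
      have h2 := alphaPrime_lt k n (by omega)
      rw [alphaPrime_rec k n (by omega)]
      by_cases h3 : m ≤ k + 3
      · rw [alphaPrime_small _ _ h3]
        -- The argument of the recursive call is at least `2`. For even indices this gives `2 +
        -- α'(2) = 3`, the largest explicit value; for odd indices the summand `2` alone suffices.
        have h4 := IH _ h2 (two_le_alphaPrime k n (by omega))
        rw [alphaPrime_small _ 2 (by omega)] at h4
        rcases Nat.mod_two_eq_zero_or_one k with h | h
        · rw [alpha_even_small k 2 h (by omega)] at h4
          rw [alpha_even_small k m h h3]
          simp at h4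
          split_ifs <;> omega
        · rw [alpha_odd_small k m h h3]
          split_ifs <;> omega
      · rw [alphaPrime_rec k m (by omega)]
        exact Nat.add_le_add_left (IH _ h2 (ih h)) 2

/-- Up to an additive constant, `α'_k` is decreasing in `k`. -/
theorem alphaPrime_add_two_le (k n : ℕ) :
    alphaPrime (k + 2) n ≤ max (alphaPrime k n) 7 := by
  by_cases h1 : n ≤ k + 3
  · rw [alphaPrime_small _ _ h1]
    have := alpha_le_three k n h1
    omega
  rw [alphaPrime_rec k n (by omega)]
  set m := alphaPrime k n
  -- The `7` is `2 + 2 + 3`: at most two unfoldings lead to an explicit value, which is at most `3`.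
  -- For larger `m` the bound `α'_{k+2}(m) ≤ m - 2` absorbs the summand `2`.
  by_cases h2 : m ≤ k + 3
  · rw [alphaPrime_small _ _ h2]
    have := alpha_le_three k m h2
    omega
  by_cases h3 : m ≤ k + 5
  · rw [alphaPrime_rec k m (by omega)]
    have := alphaPrime_le_sub_two k m (by omega)
    rw [alphaPrime_small _ _ (by omega)]
    have := alpha_le_three k (alphaPrime k m) (by omega)
    omega
  · have := alphaPrime_le_sub_two (k + 2) m (by omega)
    omega

/-! ### Comparison of `α'` with logarithms and with `α` -/

theorem alphaPrime_zero_le_half (n : ℕ) : alphaPrime 0 n ≤ (n + 1) / 2 := by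
  rw [alphaPrime_zero, alpha_zero_eq]

theorem alphaPrime_one_le_half (n : ℕ) (h : 5 ≤ n) : alphaPrime 1 n ≤ (n + 1) / 2 := by
  rw [alphaPrime_one]
  apply alpha_one_le
  obtain ⟨m, hm⟩ : ∃ m, (n + 1) / 2 = m := ⟨_, rfl⟩
  have h1 : n ≤ 2 * m := by omega
  have h2 : 3 ≤ m := by omega
  rw [hm]
  nlinarith

/-- A logarithmic bound on `α'_2` and `α'_3`. -/
theorem alphaPrime_le_two_mul_log (k s n : ℕ) (hk : k < 2) (h : n ≤ 2 ^ s) :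
    alphaPrime (k + 2) n ≤ 2 * s := by
  induction s generalizing n with
  | zero =>
    rw [alphaPrime_small _ _ (by omega)]
    have := alpha_le_pred k n
    omega
  | succ s ih =>
    by_cases h1 : n ≤ k + 3
    · rw [alphaPrime_small _ _ h1]
      have h0 := alpha_le_pred k n
      interval_cases k
      · rw [alpha_even_small _ _ rfl h1]
        split_ifs <;> omega
      · rw [alpha_odd_small _ _ rfl h1]
        split_ifs <;> omega
    -- At the two lowest levels one unfolding adds `2` and halves the argument.
    · rw [alphaPrime_rec k n (by omega)]
      have : alphaPrime k n ≤ 2 ^ s := by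
        have : alphaPrime k n ≤ (n + 1) / 2 := by
          interval_cases k
          · exact alphaPrime_zero_le_half n
          · exact alphaPrime_one_le_half n (by omega)
        omega
      have := ih _ this
      omega

/-- The error in `alphaPrime_add_two_le` is a maximum and not a summand, so it does not accumulate
on the way down to level `2` or `3`. -/
theorem alphaPrime_le_max (k n : ℕ) : alphaPrime (k + 2) n ≤ max (alphaPrime (k % 2 + 2) n) 7 := by
  induction k using Nat.twoStepInduction with
  | zero => simp
  | one => simp
  | more k ih _ =>
    have := alphaPrime_add_two_le (k + 2) n
    have h : (k + 2) % 2 = k % 2 := by omega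
    rw [h]
    omega

/-- Since `α'_0 = α_0` and `α'_1 = α_1`, each unfolding undoes exactly one step of `growth (k + 2)`;
no additive error arises. -/
theorem alphaPrime_le_two_mul_alpha_base (k n s : ℕ) (hk : k < 2) (h : n ≤ growth (k + 2) s) :
    alphaPrime (k + 2) n ≤ 2 * s := by
  induction s generalizing n with
  | zero =>
    have h1 : n ≤ k + 3 := by
      interval_cases k
      · have := (growth_even 0 rfl).1; omega
      · have := (growth_odd 1 rfl).1; omega
    rw [alphaPrime_small _ _ h1]
    exact alpha_le_of_le_growth h
  | succ s ih =>
    by_cases h1 : n ≤ k + 3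
    · rw [alphaPrime_small _ _ h1]
      exact (alpha_le_of_le_growth h).trans (by omega)
    rw [alphaPrime_rec k n (by omega)]
    rw [growth_succ] at h
    have : alphaPrime k n ≤ growth (k + 2) s := by
      interval_cases k
      · rw [alphaPrime_zero]; exact alpha_le_of_le_growth h
      · rw [alphaPrime_one]; exact alpha_le_of_le_growth h
    have := ih _ this
    omega

/-- The error `2 α + 10` of level `k + 2` enters the argument at every unfolding. The slack `4 * _ +
16` is chosen to be stable under it: with `x` the previous value, `n ≤ 4 g(x) + 16 ≤ 8 g(x) ≤ g(x +
3)`, so the new argument is at most `2 (x + 3) + 10 ≤ 4 x + 16`. The induction starts at the index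
`s₀` of the value `2`, to have `g(x) ≥ 4`. -/
theorem alphaPrime_le_of_le_growth (k n s s₀ : ℕ)
    (ih : ∀ n, alphaPrime (k + 2) n ≤ 2 * alpha (k + 2) n + 10)
    (hs₀ : growth (k + 4) s₀ = 2) (h : n ≤ 4 * growth (k + 4) (s₀ + s) + 16) :
    alphaPrime (k + 4) n ≤ 2 * (s₀ + s) + 10 := by
  induction s generalizing n with
  | zero =>
    rw [add_zero, hs₀] at h
    -- Here `n ≤ 4 * 2 + 16 = 24 ≤ 2 ^ 5`, and the logarithmic bound gives `2 * 5`; this is where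
    -- the constant `10` comes from.
    have h1 := alphaPrime_le_max (k + 2) n
    have h2 := alphaPrime_le_two_mul_log ((k + 2) % 2) 5 n (by omega) (by omega)
    have e : k + 2 + 2 = k + 4 := rfl
    rw [e] at h1
    omega
  | succ s ihs =>
    by_cases h1 : n ≤ k + 5
    · rw [alphaPrime_small (k + 2) _ h1]
      have := alpha_le_three (k + 2) n h1
      have h4 : k + 2 + 2 = k + 4 := rfl
      rw [h4] at *
      omega
    rw [alphaPrime_rec (k + 2) n (by omega)]
    have hx : 2 ≤ growth (k + 4) (s₀ + s) := by
      rw [← hs₀]; exact growth_mono (k + 2) (by omega)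
    rw [← add_assoc, growth_succ (k + 2)] at h
    have e : k + 2 + 2 = k + 4 := rfl
    rw [e] at *
    set x := growth (k + 4) (s₀ + s)
    have g0 : 4 ≤ growth (k + 2) x := (four_le_growth_two k).trans (growth_mono k hx)
    have g1 := two_mul_growth_le k x
    have g2 := two_mul_growth_le k (x + 1)
    have g3 := two_mul_growth_le k (x + 2)
    have a := alpha_le_of_le_growth (k := k + 2) (n := n) (s := x + 3) (by
      simp only [add_assoc, Nat.reduceAdd] at *; omega)
    have a' := ih n
    have := ihs (alphaPrime (k + 2) n) (by omega)
    omega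

theorem alphaPrime_le_two_mul_alpha (k n : ℕ) :
    alphaPrime (k + 2) n ≤ 2 * alpha (k + 2) n + 10 := by
  induction k using Nat.twoStepInduction generalizing n with
  | zero =>
    have := alphaPrime_le_two_mul_alpha_base 0 n _ (by omega) (le_growth_alpha 0 n)
    omega
  | one =>
    have := alphaPrime_le_two_mul_alpha_base 1 n _ (by omega) (le_growth_alpha 1 n)
    omega
  | more k ih _ =>
    by_cases h1 : n ≤ k + 5
    · rw [alphaPrime_small (k + 2) _ h1]
      omega
    have h := le_growth_alpha (k + 2) n
    obtain ⟨s₀, hs₀⟩ : ∃ s₀, growth (k + 2 + 2) s₀ = 2 := by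
      rcases Nat.mod_two_eq_zero_or_one k with h | h
      · exact ⟨1, (growth_even (k + 2) (by omega)).2.1⟩
      · exact ⟨0, (growth_odd (k + 2) (by omega)).1⟩
    have hs : s₀ ≤ alpha (k + 2 + 2) n := by
      by_contra hc
      have := growth_mono (k + 2) (show alpha (k + 2 + 2) n ≤ s₀ by omega)
      omega
    obtain ⟨s, hs⟩ := Nat.exists_eq_add_of_le hs
    rw [hs] at h ⊢
    exact alphaPrime_le_of_le_growth k n s s₀ ih hs₀ (by
      have e : k + 2 + 2 = k + 4 := rfl
      rw [e] at *; omega)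

end TreeSpanner

namespace TreeSpanner

/-! ### The cost of computing `α'` -/

/-- The number of steps of `computeAlpha`. -/
noncomputable def alphaCost : ℕ → ℕ → ℕ
  | 0, _ => 1
  | 1, n => alpha 1 n + 2
  | k + 2, n =>
    if k + 4 ≤ n then 1 + alphaCost k n + alphaCost (k + 2) (min (alphaPrime k n) (n - 1)) else 1
termination_by k n => (k, n)
decreasing_by
  · exact Prod.Lex.left _ _ (by omega)
  · exact Prod.Lex.right _ (by omega)

theorem alphaCost_small (k n : ℕ) (h : n ≤ k + 3) : alphaCost (k + 2) n = 1 := by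
  rw [alphaCost, if_neg (by omega)]

theorem alphaCost_rec (k n : ℕ) (h : k + 4 ≤ n) :
    alphaCost (k + 2) n = 1 + alphaCost k n + alphaCost (k + 2) (alphaPrime k n) := by
  have := alphaPrime_lt k n h
  rw [alphaCost, if_pos h, min_eq_left (by omega)]

theorem alphaCost_le_of_lt_two (j n : ℕ) (hj : j < 2) : alphaCost j n ≤ n + 2 := by
  interval_cases j
  · rw [alphaCost]; omega
  · rw [alphaCost]
    have := alpha_one_le n n (by nlinarith)
    omega

/-- The recursion is unrolled along the levels `j, j - 2, ...` with `n` fixed. The lowest level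
makes a call with argument at most about `n / 2`. At every other level the argument is at most `M`,
and the call costs more than one step only if the level is below `M`; hence the factor `min j M`,
while `2 * j` counts the single steps. -/
theorem alphaCost_le_of_ih (c n M : ℕ) (hc : 1 ≤ c)
    (hM : ∀ k, alphaPrime (k + 2) n ≤ M)
    (ih : ∀ m < n, ∀ k, k + 4 ≤ m → alphaCost (k + 2) m ≤ c * m) (j : ℕ) (hj : j + 4 ≤ n) :
    alphaCost (j + 2) n ≤ n + 3 + c * ((n + 1) / 2) + 2 * j + c * M * min j M := by
  induction j using Nat.strong_induction_on with
  | _ j IH =>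
    rw [alphaCost_rec j n hj]
    have hlt := alphaPrime_lt j n hj
    have hm : alphaCost (j + 2) (alphaPrime j n) ≤
        if j + 4 ≤ alphaPrime j n then c * alphaPrime j n else 1 := by
      split_ifs with h
      · exact ih _ hlt _ h
      · rw [alphaCost_small _ _ (by omega)]
    by_cases h2 : j < 2
    · have h0 := alphaCost_le_of_lt_two j n h2
      have h1 : alphaPrime j n ≤ (n + 1) / 2 := by
        interval_cases j
        · exact alphaPrime_zero_le_half n
        · exact alphaPrime_one_le_half n (by omega)
      have h3 : alphaCost (j + 2) (alphaPrime j n) ≤ c * ((n + 1) / 2) := by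
        refine hm.trans ?_
        split_ifs
        · exact Nat.mul_le_mul_left _ h1
        · exact Nat.mul_pos hc (by omega)
      have : 0 ≤ c * M * min j M := Nat.zero_le _
      omega
    · obtain ⟨i, rfl⟩ : ∃ i, j = i + 2 := ⟨j - 2, by omega⟩
      have h0 := IH i (by omega) (by omega)
      have h1 := hM i
      split_ifs at hm with h
      · have h4 : c * alphaPrime (i + 2) n ≤ c * M := Nat.mul_le_mul_left _ h1
        have h5 : c * M * min i M + c * M ≤ c * M * min (i + 2) M := by
          rw [← Nat.mul_succ]
          exact Nat.mul_le_mul_left _ (by omega)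
        omega
      · have h5 : c * M * min i M ≤ c * M * min (i + 2) M := Nat.mul_le_mul_left _ (by omega)
        omega

/-- The inequality first holds at `s = 13`, which determines the threshold `2 ^ 13` below. -/
theorem sq_lt_two_pow (s : ℕ) (h : 13 ≤ s) : 16 * s ^ 2 + 2 ≤ 2 ^ (s - 1) := by
  induction s, h using Nat.le_induction with
  | base => norm_num
  | succ s hs ih =>
    obtain ⟨t, rfl⟩ : ∃ t, s = t + 1 := ⟨s - 1, by omega⟩
    simp only [Nat.add_sub_cancel] at *
    rw [pow_succ 2 t]
    nlinarith

/-- All levels share a logarithmic bound `M`, so that `M ^ 2`, the number of levels times the size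
of their arguments, is below `n / 4`. -/
theorem alphaPrime_sq_le (n : ℕ) (hn : 2 ^ 13 ≤ n) :
    ∃ M, (∀ k, alphaPrime (k + 2) n ≤ M) ∧ 4 * M ^ 2 + 2 ≤ n := by
  have h1 : n ≤ 2 ^ Nat.clog 2 n := Nat.le_pow_clog (by omega) n
  have h2 : 2 ^ (Nat.clog 2 n - 1) < n := Nat.pow_pred_clog_lt_self (by omega) (by omega)
  have h3 : 13 ≤ Nat.clog 2 n := by
    by_contra h
    have : 2 ^ Nat.clog 2 n < 2 ^ 13 := Nat.pow_lt_pow_right (by omega) (by omega)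
    omega
  refine ⟨2 * Nat.clog 2 n, fun k => ?_, ?_⟩
  · have := alphaPrime_le_max k n
    have := alphaPrime_le_two_mul_log (k % 2) _ n (by omega) h1
    omega
  · have := sq_lt_two_pow _ h3
    nlinarith

/-- The computation of `α'_k(n)` takes linear time, uniformly in `k`. -/
theorem exists_alphaCost_le : ∃ c, ∀ k n, k + 2 ≤ n → alphaCost k n ≤ c * n := by
  -- Only finitely many pairs lie below the threshold, because `k + 2 ≤ n`; the sum of their costs
  -- bounds each of them.
  obtain ⟨c₀, hc₀⟩ : ∃ c₀, ∀ k < 2 ^ 13, ∀ n < 2 ^ 13, alphaCost k n ≤ c₀ := by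
    refine ⟨∑ k ∈ Finset.range (2 ^ 13), ∑ n ∈ Finset.range (2 ^ 13), alphaCost k n, ?_⟩
    intro k hk n hn
    refine le_trans ?_ (Finset.single_le_sum (f := fun k => ∑ n ∈ Finset.range (2 ^ 13),
      alphaCost k n) (fun _ _ => Nat.zero_le _) (Finset.mem_range.2 hk))
    exact Finset.single_le_sum (f := fun n => alphaCost k n) (fun _ _ => Nat.zero_le _)
      (Finset.mem_range.2 hn)
  refine ⟨c₀ + 24, fun k n => ?_⟩
  induction n using Nat.strong_induction_on generalizing k with
  | _ n ih =>
    intro h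
    by_cases hk : k < 2
    · have := alphaCost_le_of_lt_two k n hk
      nlinarith
    obtain ⟨j, rfl⟩ : ∃ j, k = j + 2 := ⟨k - 2, by omega⟩
    by_cases hn : n < 2 ^ 13
    · have := hc₀ (j + 2) (by omega) n hn
      nlinarith
    obtain ⟨M, hM, hM'⟩ := alphaPrime_sq_le n (by omega)
    have := alphaCost_le_of_ih (c₀ + 24) n M (by omega) hM
      (fun m hm k hk => ih m hm (k + 2) (by omega)) j (by omega)
    have h1 : (c₀ + 24) * M * min j M ≤ (c₀ + 24) * M ^ 2 := by
      rw [mul_assoc, pow_two]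
      exact Nat.mul_le_mul_left _ (Nat.mul_le_mul_left _ (min_le_right _ _))
    obtain ⟨q, hq⟩ : ∃ q, (n + 1) / 2 = q := ⟨_, rfl⟩
    rw [hq] at this
    -- With `c = c₀ + 24`, three quarters of `c * n` pay for the calls with argument about `n / 2`
    -- or at most `M`; the last quarter pays for `n + 3 + 2 * j`.
    have h3 : (c₀ + 24) * (4 * M ^ 2 + 2 + 2 * (2 * q)) ≤ (c₀ + 24) * (n + 2 * (n + 1)) :=
      Nat.mul_le_mul_left _ (by omega)
    nlinarith

end TreeSpanner

namespace TreeSpanner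

open Forest

variable {V : Type}

/-! ### Results and costs of the procedures -/

theorem run_tick_bind {X : Type} (f : Unit → Alg X) (t : ℕ) :
    (tick >>= f).run t = (f ()).run (t + 1) := rfl

theorem run_bind_of_eq {X Y : Type} {p : Alg X} {f : X → Alg Y} {t t' : ℕ} {x : X}
    (h : p.run t = some (x, t')) : (p >>= f).run t = (f x).run t' := by
  rw [StateT.run_bind, h]; rfl

theorem run_return {X : Type} (x : X) (t : ℕ) : (pure x : Alg X).run t = some (x, t) := rfl

theorem run_sqrtSearch (n : ℕ) (r s : ℕ) (hr : n ≤ (s + r) * (s + r))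
    (hlt : ∀ i < s + r, i * i < n) (d : ℕ) (hd : r + 1 ≤ d) (t : ℕ) :
    (sqrtSearch d n s).run t = some (s + r, t + (r + 1)) := by
  induction r generalizing s d t with
  | zero =>
    obtain ⟨d, rfl⟩ : ∃ e, d = e + 1 := ⟨d - 1, by omega⟩
    rw [sqrtSearch, run_tick_bind, if_pos (by simpa using hr)]
    rfl
  | succ r ih =>
    obtain ⟨d, rfl⟩ : ∃ e, d = e + 1 := ⟨d - 1, by omega⟩
    rw [sqrtSearch, run_tick_bind, if_neg (by have := hlt s (by omega); omega)]
    have e : s + (r + 1) = s + 1 + r := by omega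
    rw [e] at hr hlt
    rw [ih (s + 1) hr hlt d (by omega), e]
    congr 2; omega

theorem run_computeAlpha (k n : ℕ) :
    ∃ d₀, ∀ d ≥ d₀, ∀ t, (computeAlpha d k n).run t = some (alphaPrime k n, t + alphaCost k n) := by
  induction k using Nat.twoStepInduction generalizing n with
  | zero =>
    refine ⟨1, fun d hd t => ?_⟩
    obtain ⟨d, rfl⟩ : ∃ e, d = e + 1 := ⟨d - 1, by omega⟩
    rw [computeAlpha, run_tick_bind, if_pos rfl, alphaPrime_zero, alpha_zero_eq, alphaCost]
    rfl
  | one =>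
    refine ⟨alpha 1 n + 2, fun d hd t => ?_⟩
    obtain ⟨d, rfl⟩ : ∃ e, d = e + 1 := ⟨d - 1, by omega⟩
    rw [computeAlpha, run_tick_bind, if_neg (by omega), if_pos rfl, alphaPrime_one, alphaCost,
      run_sqrtSearch n (alpha 1 n) 0 _ _ d (by omega)]
    · congr 2 <;> omega
    · simpa using le_alpha_one_sq n
    · intro i hi
      by_contra hc
      have := alpha_one_le n i (by nlinarith)
      omega
  | more k ih _ =>
    induction n using Nat.strong_induction_on with
    | _ n IH =>
      by_cases h : n ≤ k + 3
      · refine ⟨1, fun d hd t => ?_⟩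
        obtain ⟨d, rfl⟩ : ∃ e, d = e + 1 := ⟨d - 1, by omega⟩
        rw [computeAlpha, run_tick_bind, if_neg (by omega), if_neg (by omega), if_pos (by omega),
          alphaPrime_small _ _ h, alphaCost_small _ _ h]
        rcases Nat.mod_two_eq_zero_or_one k with hk | hk
        · rw [if_pos (by omega), alpha_even_small _ _ hk h]
          split_ifs <;> rfl
        · rw [if_neg (by omega), alpha_odd_small _ _ hk h]
          split_ifs <;> rfl
      · obtain ⟨d₁, h₁⟩ := ih n
        obtain ⟨d₂, h₂⟩ := IH _ (alphaPrime_lt k n (by omega))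
        refine ⟨max d₁ d₂ + 1, fun d hd t => ?_⟩
        obtain ⟨d, rfl⟩ : ∃ e, d = e + 1 := ⟨d - 1, by omega⟩
        rw [computeAlpha, run_tick_bind, if_neg (by omega), if_neg (by omega), if_neg (by omega),
          Nat.add_sub_cancel, run_bind_of_eq (h₁ d (by omega) _), run_bind_of_eq (h₂ d (by omega) _),
          alphaPrime_rec k n (by omega), alphaCost_rec k n (by omega), run_return]
        congr 2; omega

/-- The number of vertices of a forest. -/
def Forest.size {A : Type} : Forest A → ℕ
  | nil => 0
  | node _ c s => c.size + s.size + 1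

theorem Forest.length_labels {A : Type} (T : Forest A) : T.labels.length = T.size := by
  induction T with
  | nil => rfl
  | node a c s hc hs => simp [labels, size, hc, hs]

/-- The vertex-wise image of a forest. -/
def Forest.map {A B : Type} (f : A → B) : Forest A → Forest B
  | nil => nil
  | node a c s => node (f a) (c.map f) (s.map f)

/-- The result of `prune`. -/
def pruned : Forest (V × Bool) → Forest (V × Bool)
  | .nil => .nil
  | .node (v, b) c s =>
    if b then .node (v, b) (pruned c) (pruned s)
    else match pruned c with
      | .nil => pruned s
      | .node a d .nil => .node a d (pruned s)
      | .node a d (.node a₂ d₂ s₂) => .node (v, b) (.node a d (.node a₂ d₂ s₂)) (pruned s)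

theorem run_prune (T : Forest (V × Bool)) (t : ℕ) :
    (prune T).run t = some (pruned T, t + (2 * T.size + 1)) := by
  induction T generalizing t with
  | nil => rfl
  | node a c s hc hs =>
    obtain ⟨v, b⟩ := a
    rw [prune, run_tick_bind, run_bind_of_eq (hc _), run_bind_of_eq (hs _), pruned]
    have e : t + 1 + (2 * c.size + 1) + (2 * s.size + 1) =
      t + (2 * (Forest.node (v, b) c s).size + 1) := by simp only [Forest.size]; omega
    rw [e]
    split_ifs
    · rfl
    · cases pruned c with
      | nil => rfl
      | node a d s₁ => cases s₁ <;> rfl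

/-- The result of `decomp`. -/
def decomposed (ℓ : ℕ) : Forest (V × Bool) → Forest (V × Bool × Bool) × ℕ
  | .nil => (.nil, 0)
  | .node (v, b) c s =>
    let size := if b then (decomposed ℓ c).2 + 1 else (decomposed ℓ c).2
    if ℓ < size then (.node (v, b, true) (decomposed ℓ c).1 (decomposed ℓ s).1, (decomposed ℓ s).2)
    else (.node (v, b, false) (decomposed ℓ c).1 (decomposed ℓ s).1, size + (decomposed ℓ s).2)

theorem run_decomp (ℓ : ℕ) (T : Forest (V × Bool)) (t : ℕ) :
    (decomp ℓ T).run t = some (decomposed ℓ T, t + (2 * T.size + 1)) := by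
  induction T generalizing t with
  | nil => rfl
  | node a c s hc hs =>
    obtain ⟨v, b⟩ := a
    rw [decomp, run_tick_bind, run_bind_of_eq (hc _), run_bind_of_eq (hs _), decomposed]
    have e : t + 1 + (2 * c.size + 1) + (2 * s.size + 1) =
      t + (2 * (Forest.node (v, b) c s).size + 1) := by simp only [Forest.size]; omega
    rw [e]
    dsimp only
    split_ifs <;> rfl

/-- The cut vertices of a forest as returned by `decomp`. -/
def cuts : Forest (V × Bool × Bool) → List V
  | .nil => []
  | .node (v, _, cut) c s => if cut then v :: (cuts s ++ cuts c) else cuts s ++ cuts c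

theorem run_cutVertices (M : Forest (V × Bool × Bool)) (acc : List V) (t : ℕ) :
    (cutVertices M acc).run t = some (cuts M ++ acc, t + (2 * M.size + 1)) := by
  induction M generalizing t acc with
  | nil => rfl
  | node a c s hc hs =>
    obtain ⟨v, b, x⟩ := a
    rw [cutVertices, run_tick_bind, run_bind_of_eq (hc _ _), run_bind_of_eq (hs _ _), cuts]
    have e : t + 1 + (2 * c.size + 1) + (2 * s.size + 1) =
      t + (2 * (Forest.node (v, b, x) c s).size + 1) := by simp only [Forest.size]; omega
    rw [e]
    split_ifs <;> simp

theorem run_recolor (M : Forest (V × Bool × Bool)) (t : ℕ) :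
    (recolor M).run t = some (M.map (fun a => (a.1, a.2.2)), t + (2 * M.size + 1)) := by
  induction M generalizing t with
  | nil => rfl
  | node a c s hc hs =>
    obtain ⟨v, b, x⟩ := a
    rw [recolor, run_tick_bind, run_bind_of_eq (hc _), run_bind_of_eq (hs _), run_return]
    have e : t + 1 + (2 * c.size + 1) + (2 * s.size + 1) =
      t + (2 * (Forest.node (v, b, x) c s).size + 1) := by simp only [Forest.size]; omega
    rw [e]
    rfl

theorem run_count {X : Type} (l : List X) (t : ℕ) :
    (count l).run t = some (l.length, t + (l.length + 1)) := by
  induction l generalizing t with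
  | nil => rfl
  | cons x l ih =>
    rw [count, run_tick_bind, run_bind_of_eq (ih _), run_return]
    simp; omega

theorem run_pairsWith (v : V) (l : List V) (acc : List (V × V)) (t : ℕ) :
    (pairsWith v l acc).run t =
      some ((l.map fun u => (u, v)).reverse ++ acc, t + (l.length + 1)) := by
  induction l generalizing t acc with
  | nil => rfl
  | cons x l ih =>
    rw [pairsWith, run_tick_bind, ih]
    simp; omega

/-- The edges of the complete graph on a list of vertices. -/
def completePairs : List V → List (V × V)
  | [] => []
  | v :: l => completePairs l ++ (l.map fun u => (u, v)).reverse

/-- A quadratic bound on the number of steps is enough, since the square of the number of cut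
vertices is at most `n` when `k = 3`. -/
theorem run_completeEdges (l : List V) :
    ∃ s ≤ (l.length + 1) * (l.length + 1), ∀ (acc : List (V × V)) (t : ℕ),
      (completeEdges l acc).run t = some (completePairs l ++ acc, t + s) := by
  induction l with
  | nil => exact ⟨1, by simp, fun _ _ => rfl⟩
  | cons x l ih =>
    obtain ⟨s, hs, h⟩ := ih
    refine ⟨1 + (l.length + 1) + s, ?_, fun acc t => ?_⟩
    · simp only [List.length_cons]; nlinarith
    · rw [completeEdges, run_tick_bind, run_bind_of_eq (run_pairsWith _ _ _ _), h]
      simp [completePairs, add_assoc]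

/-- The edges of a forest, including those from a given parent to the roots. -/
def parentEdges : Option V → Forest (V × Bool) → List (V × V)
  | _, .nil => []
  | parent, .node (v, _) c s =>
    (parent.toList.map fun p => (p, v)) ++ (parentEdges parent s ++ parentEdges (some v) c)

theorem run_treeEdges (p : Option V) (T : Forest (V × Bool)) (acc : List (V × V)) (t : ℕ) :
    (treeEdges p T acc).run t = some (parentEdges p T ++ acc, t + (2 * T.size + 1)) := by
  induction T generalizing p t acc with
  | nil => rfl
  | node a c s hc hs =>
    obtain ⟨v, b⟩ := a
    rw [treeEdges, run_tick_bind, run_bind_of_eq (hc _ _ _), run_bind_of_eq (hs _ _ _),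
      parentEdges]
    have e : t + 1 + (2 * c.size + 1) + (2 * s.size + 1) =
      t + (2 * (Forest.node (v, b) c s).size + 1) := by simp only [Forest.size]; omega
    rw [e]
    cases p <;> simp

/-- The required vertices of a forest. -/
def requireds : Forest (V × Bool) → List V
  | .nil => []
  | .node (v, b) c s => if b then v :: (requireds s ++ requireds c) else requireds s ++ requireds c

theorem run_requiredList (T : Forest (V × Bool)) (acc : List V) (t : ℕ) :
    (requiredList T acc).run t = some (requireds T ++ acc, t + (2 * T.size + 1)) := by
  induction T generalizing t acc with
  | nil => rfl
  | node a c s hc hs =>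
    obtain ⟨v, b⟩ := a
    rw [requiredList, run_tick_bind, run_bind_of_eq (hc _ _), run_bind_of_eq (hs _ _), requireds]
    have e : t + 1 + (2 * c.size + 1) + (2 * s.size + 1) =
      t + (2 * (Forest.node (v, b) c s).size + 1) := by simp only [Forest.size]; omega
    rw [e]
    split_ifs <;> simp

/-- The result of `split`, started with empty accumulators. -/
def splitted : Position V → Forest (V × Bool × Bool) →
    Forest (V × Bool) × List V × List (Component V)
  | _, .nil => (.nil, [], [])
  | pos, .node (v, _, true) c s =>
    ((splitted pos s).1, (splitted pos s).2.1 ++ [v],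
      (splitted pos s).2.2 ++ (splitted (.below (some v)) c).2.2)
  | .inside, .node (v, b, false) c s =>
    (.node (v, b) (splitted .inside c).1 (splitted .inside s).1,
      (splitted .inside s).2.1 ++ (splitted .inside c).2.1,
      (splitted .inside s).2.2 ++ (splitted .inside c).2.2)
  | .below u, .node (v, b, false) c s =>
    ((splitted (.below u) s).1, (splitted (.below u) s).2.1,
      (splitted (.below u) s).2.2 ++
        ⟨.node (v, b) (splitted .inside c).1 .nil, u.toList ++ (splitted .inside c).2.1⟩ ::
        (splitted .inside c).2.2)

theorem run_split (pos : Position V) (M : Forest (V × Bool × Bool)) (border : List V)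
    (done : List (Component V)) (t : ℕ) :
    (split pos M border done).run t =
      some (((splitted pos M).1, (splitted pos M).2.1 ++ border, (splitted pos M).2.2 ++ done),
        t + (2 * M.size + 1)) := by
  induction M generalizing pos border done t with
  | nil => cases pos <;> rfl
  | node a c s hc hs =>
    obtain ⟨v, b, x⟩ := a
    have e : t + 1 + (2 * c.size + 1) + (2 * s.size + 1) =
      t + (2 * (Forest.node (v, b, x) c s).size + 1) := by simp only [Forest.size]; omega
    cases x
    · cases pos with
      | inside =>
        rw [split, run_tick_bind, run_bind_of_eq (hc _ _ _ _)]
        dsimp only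
        rw [run_bind_of_eq (hs _ _ _ _), e]
        simp [splitted]
      | below u =>
        rw [split, run_tick_bind, run_bind_of_eq (hc _ _ _ _)]
        dsimp only
        rw [hs, e]
        cases u <;> simp [splitted]
    · rw [split, run_tick_bind, run_bind_of_eq (hc _ _ _ _)]
      dsimp only
      rw [hs, e]
      simp [splitted]

/-- The pairs of a vertex of the first list and a vertex of the second list. -/
def crossPairs (border : List V) : List V → List (V × V)
  | [] => []
  | v :: l => crossPairs border l ++ (border.map fun u => (u, v)).reverse

theorem run_connectAll (border l : List V) (acc : List (V × V)) (t : ℕ) :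
    (connectAll border l acc).run t =
      some (crossPairs border l ++ acc, t + (l.length * (border.length + 2) + 1)) := by
  induction l generalizing acc t with
  | nil => rw [connectAll, run_tick_bind, run_return]; simp [crossPairs]
  | cons v l ih =>
    rw [connectAll, run_tick_bind, run_bind_of_eq (run_pairsWith _ _ _ _), ih]
    simp [crossPairs]; ring

/-- The edges between the required vertices of the subtrees and the border vertices. -/
def borderPairs : List (Component V) → List (V × V)
  | [] => []
  | t :: l => borderPairs l ++ crossPairs t.border (requireds t.tree)

/-- The number of steps of `borderEdges`. -/
def borderCost : List (Component V) → ℕ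
  | [] => 1
  | t :: l => borderCost l + (3 + 2 * t.tree.size +
      (requireds t.tree).length * (t.border.length + 2))

theorem run_borderEdges (l : List (Component V)) (acc : List (V × V)) (t : ℕ) :
    (borderEdges l acc).run t = some (borderPairs l ++ acc, t + borderCost l) := by
  induction l generalizing acc t with
  | nil => rfl
  | cons x l ih =>
    rw [borderEdges, run_tick_bind, run_bind_of_eq (run_requiredList _ _ _),
      run_bind_of_eq (run_connectAll _ _ _ _), ih]
    simp [borderPairs, borderCost]; ring

/-- The recursive call enters only through its behaviour on the members of `l`, so that the
induction hypothesis can be inserted for `E` and `cost`. -/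
theorem run_spanComponents
    {call : Forest (V × Bool) → ℕ → List (V × V) → Alg (List (V × V))}
    (E : Component V → List (V × V)) (cost : Component V → ℕ) (l : List (Component V))
    (h : ∀ x ∈ l, ∀ acc t, (call (pruned x.tree) (requireds x.tree).length acc).run t =
      some (E x ++ acc, t + cost x))
    (acc : List (V × V)) (t : ℕ) :
    (spanComponents call l acc).run t = some (l.reverse.flatMap E ++ acc,
      t + ((l.map fun x => cost x + 4 * x.tree.size + (requireds x.tree).length + 4).sum + 1)) := by
  induction l generalizing acc t with
  | nil => rfl
  | cons x l ih =>
    rw [spanComponents, run_tick_bind, run_bind_of_eq (run_prune _ _),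
      run_bind_of_eq (run_requiredList _ _ _), run_bind_of_eq (run_count _ _)]
    rw [List.append_nil, run_bind_of_eq (h x (by simp) _ _),
      ih (fun y hy => h y (by simp [hy]))]
    simp; ring

end TreeSpanner

namespace TreeSpanner

variable {V : Type}

/-! ### Reduced forests -/

namespace Forest

@[simp] theorem verts_nil : (nil : Forest (V × Bool)).verts = [] := rfl

@[simp] theorem verts_node (a : V × Bool) (c s : Forest (V × Bool)) :
    (node a c s).verts = a.1 :: (c.verts ++ s.verts) := by
  simp [verts, labels]

theorem nodup_node {a : V × Bool} {c s : Forest (V × Bool)} :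
    (node a c s).verts.Nodup ↔ a.1 ∉ c.verts ∧ a.1 ∉ s.verts ∧ c.verts.Nodup ∧ s.verts.Nodup ∧
      ∀ x ∈ c.verts, x ∉ s.verts := by
  rw [verts_node, List.nodup_cons, List.nodup_append', List.mem_append, not_or]
  simp only [List.disjoint_left]
  tauto

theorem mem_verts_of_mem_roots {T : Forest (V × Bool)} {x : V} (h : x ∈ T.roots.map Prod.fst) :
    x ∈ T.verts := by
  induction T with
  | nil => simp [roots] at h
  | node a c s _ hs =>
    simp only [roots, List.map_cons, List.mem_cons] at h
    rcases h with rfl | h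
    · simp
    · simp [hs h]

theorem IsChild.mem {T : Forest (V × Bool)} {x y : V} (h : T.IsChild x y) :
    x ∈ T.verts ∧ y ∈ T.verts := by
  induction T with
  | nil => exact h.elim
  | node a c s hc hs =>
    rcases h with ⟨rfl, h⟩ | h | h
    · exact ⟨by simp, by simp [mem_verts_of_mem_roots h]⟩
    · have := hc h
      simp [this]
    · have := hs h
      simp [this]

theorem IsChild.ne {T : Forest (V × Bool)} (hT : T.verts.Nodup) {x y : V} (h : T.IsChild x y) :
    x ≠ y := by
  induction T with
  | nil => exact h.elim
  | node a c s hc hs =>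
    rw [nodup_node] at hT
    rcases h with ⟨rfl, h⟩ | h | h
    · rintro rfl
      exact hT.1 (mem_verts_of_mem_roots h)
    · exact hc hT.2.2.1 h
    · exact hs hT.2.2.2.1 h

theorem mem_requireds {T : Forest (V × Bool)} {x : V} :
    x ∈ requireds T ↔ (x, true) ∈ T.labels := by
  induction T with
  | nil => simp [requireds, labels]
  | node a c s hc hs =>
    obtain ⟨v, b⟩ := a
    cases b <;> simp [requireds, labels, hc, hs, or_comm]

theorem mem_verts_of_mem_requireds {T : Forest (V × Bool)} {x : V} (h : x ∈ requireds T) :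
    x ∈ T.verts :=
  List.mem_map.2 ⟨_, mem_requireds.1 h, rfl⟩

theorem requireds_nodup {T : Forest (V × Bool)} (hT : T.verts.Nodup) : (requireds T).Nodup := by
  induction T with
  | nil => simp [requireds]
  | node a c s hc hs =>
    rw [nodup_node] at hT
    obtain ⟨h1, h2, h3, h4, h5⟩ := hT
    have h6 : (requireds s ++ requireds c).Nodup := by
      rw [List.nodup_append']
      exact ⟨hs h4, hc h3, fun x hx hx' =>
        h5 x (mem_verts_of_mem_requireds hx') (mem_verts_of_mem_requireds hx)⟩
    obtain ⟨v, b⟩ := a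
    rw [requireds]
    split_ifs
    · refine List.nodup_cons.2 ⟨?_, h6⟩
      rw [List.mem_append]
      rintro (h | h)
      · exact h2 (mem_verts_of_mem_requireds h)
      · exact h1 (mem_verts_of_mem_requireds h)
    · exact h6

theorem length_requireds_node (a : V × Bool) (c s : Forest (V × Bool)) :
    (requireds (node a c s)).length =
      (if a.2 then 1 else 0) + (requireds c).length + (requireds s).length := by
  obtain ⟨v, b⟩ := a
  cases b <;> simp [requireds] <;> omega

/-- Structural form of being pruned: Steiner vertices have at least two children. -/
def IsReduced : Forest (V × Bool) → Prop
  | nil => True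
  | node a c s => (a.2 = true ∨ 2 ≤ c.roots.length) ∧ c.IsReduced ∧ s.IsReduced

theorem IsReduced.roots_le {T : Forest (V × Bool)} (h : T.IsReduced) :
    T.roots.length ≤ (requireds T).length := by
  induction T with
  | nil => simp [roots]
  | node a c s hc hs =>
    obtain ⟨h1, h2, h3⟩ := h
    have := hc h2
    have := hs h3
    rw [length_requireds_node, roots, List.length_cons]
    split_ifs with hb
    · omega
    · have := h1.resolve_left hb
      omega

/-- A Steiner root merges at least two trees into one and thus pays for itself; a required root
contributes `2` on the right. This makes the whole tree linear in its required-size. -/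
theorem IsReduced.size_add_roots_le {T : Forest (V × Bool)} (h : T.IsReduced) :
    T.size + T.roots.length ≤ 2 * (requireds T).length := by
  induction T with
  | nil => simp [roots, size]
  | node a c s hc hs =>
    obtain ⟨h1, h2, h3⟩ := h
    have := hc h2
    have := hs h3
    rw [length_requireds_node, roots, List.length_cons, size]
    split_ifs with hb
    · omega
    · have := h1.resolve_left hb
      omega

theorem eq_nil_of_roots {T : Forest (V × Bool)} (h : T.roots.length = 0) : T = nil := by
  cases T with
  | nil => rfl
  | node a c s => simp [roots] at h

/-- The concatenation of two forests. -/
def append {A : Type} : Forest A → Forest A → Forest A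
  | nil, G => G
  | node a c s, G => node a c (s.append G)

theorem labels_append {A : Type} (F G : Forest A) : (F.append G).labels = F.labels ++ G.labels := by
  induction F with
  | nil => rfl
  | node a c s _ hs => simp [append, labels, hs]

theorem requireds_append (F G : Forest (V × Bool)) :
    (requireds (F.append G)).Perm (requireds F ++ requireds G) := by
  induction F with
  | nil => simp [append, requireds]
  | node a c s _ hs =>
    obtain ⟨v, b⟩ := a
    have h : (requireds (s.append G) ++ requireds c).Perm
        (requireds s ++ requireds c ++ requireds G) := by
      refine (hs.append_right _).trans ?_
      rw [List.append_assoc, List.append_assoc]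
      exact List.perm_append_comm.append_left _
    cases b
    · simpa [append, requireds] using h
    · simpa [append, requireds] using h

theorem IsReduced.append {F G : Forest (V × Bool)} (hF : F.IsReduced) (hG : G.IsReduced) :
    (F.append G).IsReduced := by
  induction F with
  | nil => exact hG
  | node a c s _ hs => exact ⟨hF.1, hF.2.1, hs hF.2.2⟩

end Forest

open Forest

theorem pruned_true (v : V) (c s : Forest (V × Bool)) :
    pruned (.node (v, true) c s) = .node (v, true) (pruned c) (pruned s) := by
  simp [pruned]

/-- With at most one tree left below a Steiner vertex, deletion and replacement are both the
concatenation of what remains below with what remains to the right. -/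
theorem pruned_false (v : V) (c s : Forest (V × Bool)) :
    pruned (.node (v, false) c s) = if 2 ≤ (pruned c).roots.length then
      .node (v, false) (pruned c) (pruned s) else (pruned c).append (pruned s) := by
  rw [pruned]
  rcases pruned c with _ | ⟨a, d, _ | ⟨a₂, d₂, s₂⟩⟩ <;> simp [roots, append]

theorem pruned_isReduced (T : Forest (V × Bool)) : (pruned T).IsReduced := by
  induction T with
  | nil => trivial
  | node a c s hc hs =>
    obtain ⟨v, _ | _⟩ := a
    · rw [pruned_false]
      split_ifs with h
      · exact ⟨Or.inr h, hc, hs⟩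
      · exact hc.append hs
    · rw [pruned_true]
      exact ⟨Or.inl rfl, hc, hs⟩

theorem labels_pruned_sublist (T : Forest (V × Bool)) : (pruned T).labels.Sublist T.labels := by
  induction T with
  | nil => exact List.Sublist.refl _
  | node a c s hc hs =>
    obtain ⟨v, _ | _⟩ := a
    · rw [pruned_false]
      split_ifs with h
      · exact (hc.append hs).cons_cons _
      · rw [labels_append]
        exact (hc.append hs).cons _
    · rw [pruned_true]
      exact (hc.append hs).cons_cons _

theorem verts_pruned_sublist (T : Forest (V × Bool)) : (pruned T).verts.Sublist T.verts :=
  (labels_pruned_sublist T).map _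

theorem requireds_pruned (T : Forest (V × Bool)) : (requireds (pruned T)).Perm (requireds T) := by
  induction T with
  | nil => exact List.Perm.refl _
  | node a c s hc hs =>
    obtain ⟨v, _ | _⟩ := a
    · rw [pruned_false]
      split_ifs with h
      · simpa [requireds] using hs.append hc
      · refine (requireds_append _ _).trans ?_
        simpa [requireds] using List.perm_append_comm.trans (hs.append hc)
    · rw [pruned_true]
      simpa [requireds] using hs.append hc

/-! ### Paths in forests -/

namespace Forest

/-- Adjacency in the underlying graph of a forest. -/
def Linked (T : Forest (V × Bool)) (x y : V) : Prop := T.IsChild x y ∨ T.IsChild y x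

theorem Linked.symm {T : Forest (V × Bool)} {x y : V} (h : T.Linked x y) : T.Linked y x := Or.symm h

theorem Linked.mem {T : Forest (V × Bool)} {x y : V} (h : T.Linked x y) :
    x ∈ T.verts ∧ y ∈ T.verts :=
  h.elim (fun h => h.mem) (fun h => h.mem.symm)

/-- A list of vertices that is empty or the vertex sequence of a path. -/
structure IsPathList (T : Forest (V × Bool)) (p : List V) : Prop where
  nodup : p.Nodup
  mem : ∀ x ∈ p, x ∈ T.verts
  chain : p.IsChain T.Linked

/-- A list of vertices that is empty or leads downwards from a root. -/
def IsDown : Forest (V × Bool) → List V → Prop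
  | nil, l => l = []
  | node a c s, l => (∃ l', l = a.1 :: l' ∧ c.IsDown l') ∨ s.IsDown l

/-- Two lists that lead downwards in different trees of a forest. -/
def IsFork : Forest (V × Bool) → List V → List V → Prop
  | nil, l₁, l₂ => l₁ = [] ∧ l₂ = []
  | node a c s, l₁, l₂ => (∃ l', l₁ = a.1 :: l' ∧ c.IsDown l' ∧ s.IsDown l₂) ∨
      (∃ l', l₂ = a.1 :: l' ∧ c.IsDown l' ∧ s.IsDown l₁) ∨ s.IsFork l₁ l₂

/-- A list of vertices that is empty or the vertex sequence of a path, described recursively: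
at its topmost vertex a path splits into two branches. -/
def IsBend : Forest (V × Bool) → List V → Prop
  | nil, p => p = []
  | node a c s, p => (∃ l₁ l₂, c.IsFork l₁ l₂ ∧ p = l₁.reverse ++ a.1 :: l₂) ∨
      c.IsBend p ∨ s.IsBend p

variable {T F G : Forest (V × Bool)}

theorem isDown_nil (T : Forest (V × Bool)) : T.IsDown [] := by
  induction T with
  | nil => rfl
  | node a c s _ hs => exact Or.inr hs

theorem isBend_nil (T : Forest (V × Bool)) : T.IsBend [] := by
  induction T with
  | nil => rfl
  | node a c s _ hs => exact Or.inr (Or.inr hs)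

theorem IsFork.symm {l₁ l₂ : List V} (h : T.IsFork l₁ l₂) : T.IsFork l₂ l₁ := by
  induction T with
  | nil => exact And.symm h
  | node a c s _ hs =>
    rcases h with h | h | h
    · exact Or.inr (Or.inl h)
    · exact Or.inl h
    · exact Or.inr (Or.inr (hs h))

theorem IsDown.isFork {l : List V} (h : T.IsDown l) : T.IsFork l [] := by
  induction T with
  | nil => exact ⟨h, rfl⟩
  | node a c s _ hs =>
    rcases h with ⟨l', h, h'⟩ | h
    · exact Or.inl ⟨l', h, h', isDown_nil _⟩
    · exact Or.inr (Or.inr (hs h))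

theorem IsFork.left {l₁ l₂ : List V} (h : T.IsFork l₁ l₂) : T.IsDown l₁ := by
  induction T with
  | nil => exact h.1
  | node a c s _ hs =>
    rcases h with ⟨l', h, h', _⟩ | ⟨l', _, _, h⟩ | h
    · exact Or.inl ⟨l', h, h'⟩
    · exact Or.inr h
    · exact Or.inr (hs h)

theorem IsFork.right {l₁ l₂ : List V} (h : T.IsFork l₁ l₂) : T.IsDown l₂ := h.symm.left

theorem IsDown.isBend {l : List V} (h : T.IsDown l) : T.IsBend l := by
  induction T with
  | nil => exact h
  | node a c s _ hs =>
    rcases h with ⟨l', rfl, h'⟩ | h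
    · exact Or.inl ⟨[], l', h'.isFork.symm, rfl⟩
    · exact Or.inr (Or.inr (hs h))

theorem IsDown.isBend_reverse {l : List V} (h : T.IsDown l) : T.IsBend l.reverse := by
  induction T with
  | nil => simp only [IsDown] at h; subst h; rfl
  | node a c s _ hs =>
    rcases h with ⟨l', rfl, h'⟩ | h
    · exact Or.inl ⟨l', [], h'.isFork, by simp⟩
    · exact Or.inr (Or.inr (hs h))

theorem IsFork.eq_nil {l₁ l₂ : List V} (h : T.IsFork l₁ l₂) (hT : ¬ 2 ≤ T.roots.length) :
    l₁ = [] ∨ l₂ = [] := by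
  match T with
  | nil => exact Or.inl h.1
  | node a c nil =>
    rcases h with ⟨_, _, _, h⟩ | ⟨_, _, _, h⟩ | h
    · exact Or.inr h
    · exact Or.inl h
    · exact Or.inl h.1
  | node a c (node a₂ c₂ s) => simp [roots] at hT

theorem IsDown.append_left {l : List V} (h : F.IsDown l) : (F.append G).IsDown l := by
  induction F with
  | nil => simp only [IsDown] at h; subst h; exact isDown_nil _
  | node a c s _ hs => exact h.imp id hs

theorem IsDown.append_right {l : List V} (h : G.IsDown l) : (F.append G).IsDown l := by
  induction F with
  | nil => exact h
  | node a c s _ hs => exact Or.inr hs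

theorem IsFork.append_right {l₁ l₂ : List V} (h : G.IsFork l₁ l₂) : (F.append G).IsFork l₁ l₂ := by
  induction F with
  | nil => exact h
  | node a c s _ hs => exact Or.inr (Or.inr hs)

theorem IsDown.isFork_append {l₁ l₂ : List V} (h₁ : F.IsDown l₁) (h₂ : G.IsDown l₂) :
    (F.append G).IsFork l₁ l₂ := by
  induction F with
  | nil => simp only [IsDown] at h₁; subst h₁; exact h₂.isFork.symm
  | node a c s _ hs =>
    rcases h₁ with ⟨l', h, h'⟩ | h
    · exact Or.inl ⟨l', h, h', h₂.append_right⟩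
    · exact Or.inr (Or.inr (hs h))

theorem IsBend.append_left {p : List V} (h : F.IsBend p) : (F.append G).IsBend p := by
  induction F with
  | nil => simp only [IsBend] at h; subst h; exact isBend_nil _
  | node a c s _ hs => exact h.imp id (Or.imp id hs)

theorem IsBend.append_right {p : List V} (h : G.IsBend p) : (F.append G).IsBend p := by
  induction F with
  | nil => exact h
  | node a c s _ hs => exact Or.inr (Or.inr hs)

theorem IsDown.mem {l : List V} (h : T.IsDown l) : ∀ x ∈ l, x ∈ T.verts := by
  induction T generalizing l with
  | nil => simp only [IsDown] at h; subst h; simp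
  | node a c s hc hs =>
    rcases h with ⟨l', rfl, h'⟩ | h
    · simp only [List.mem_cons, verts_node, List.mem_append]
      rintro x (hx | hx)
      · exact Or.inl hx
      · exact Or.inr (Or.inl (hc h' x hx))
    · intro x hx
      simp [hs h x hx]

theorem IsBend.mem {p : List V} (h : T.IsBend p) : ∀ x ∈ p, x ∈ T.verts := by
  induction T with
  | nil => simp only [IsBend] at h; subst h; simp
  | node a c s hc hs =>
    intro x hx
    simp only [verts_node, List.mem_cons, List.mem_append]
    rcases h with ⟨l₁, l₂, h, rfl⟩ | h | h
    · simp only [List.mem_append, List.mem_reverse, List.mem_cons] at hx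
      rcases hx with hx | hx | hx
      · exact Or.inr (Or.inl (h.left.mem x hx))
      · exact Or.inl hx
      · exact Or.inr (Or.inl (h.right.mem x hx))
    · exact Or.inr (Or.inl (hc h x hx))
    · exact Or.inr (Or.inr (hs h x hx))

end Forest

end TreeSpanner

namespace TreeSpanner

variable {V : Type}

namespace Forest

variable {T F G : Forest (V × Bool)}

/-! ### Paths as lists of linked vertices, and their recursive description -/

theorem Linked.node_left {a : V × Bool} {c s : Forest (V × Bool)} {x y : V} (h : c.Linked x y) :
    (node a c s).Linked x y :=
  h.imp (fun h => Or.inr (Or.inl h)) (fun h => Or.inr (Or.inl h))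

theorem Linked.node_right {a : V × Bool} {c s : Forest (V × Bool)} {x y : V} (h : s.Linked x y) :
    (node a c s).Linked x y :=
  h.imp (fun h => Or.inr (Or.inr h)) (fun h => Or.inr (Or.inr h))

theorem IsDown.head_mem_roots {l : List V} (h : T.IsDown l) :
    ∀ x ∈ l.head?, x ∈ T.roots.map Prod.fst := by
  induction T with
  | nil => simp only [IsDown] at h; subst h; simp
  | node a c s _ hs =>
    rcases h with ⟨l', rfl, -⟩ | h
    · simp [roots]
    · intro x hx
      simp only [roots, List.map_cons, List.mem_cons]
      exact Or.inr (hs h x hx)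

theorem IsDown.isChain {l : List V} (h : T.IsDown l) : l.IsChain T.Linked := by
  induction T generalizing l with
  | nil => simp only [IsDown] at h; subst h; simp
  | node a c s hc hs =>
    rcases h with ⟨l', rfl, h⟩ | h
    · exact ((hc h).imp fun _ _ h => h.node_left).cons
        fun y hy => Or.inl (Or.inl ⟨rfl, h.head_mem_roots y hy⟩)
    · exact (hs h).imp fun _ _ h => h.node_right

theorem isChain_reverse_linked {l : List V} : l.reverse.IsChain T.Linked ↔ l.IsChain T.Linked := by
  rw [List.isChain_reverse]
  exact List.IsChain.iff fun _ _ => ⟨Linked.symm, Linked.symm⟩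

theorem IsBend.isChain {p : List V} (h : T.IsBend p) : p.IsChain T.Linked := by
  induction T with
  | nil => simp only [IsBend] at h; subst h; simp
  | node a c s hc hs =>
    rcases h with ⟨l₁, l₂, h, rfl⟩ | h | h
    · have key : ∀ l, c.IsDown l → (a.1 :: l).IsChain (node a c s).Linked := fun l hl =>
        IsDown.isChain (T := node a c s) (Or.inl ⟨l, rfl, hl⟩)
      rw [List.isChain_split]
      refine ⟨?_, key _ h.right⟩
      rw [← isChain_reverse_linked]
      simpa using key _ h.left
    · exact (hc h).imp fun _ _ h => h.node_left
    · exact (hs h).imp fun _ _ h => h.node_right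

/-- Two non-empty downward lists in the same tree would share its root. -/
theorem IsDown.isFork_of_disjoint {l₁ l₂ : List V} (h₁ : T.IsDown l₁) (h₂ : T.IsDown l₂)
    (hd : l₁.Disjoint l₂) : T.IsFork l₁ l₂ := by
  induction T with
  | nil => exact ⟨h₁, h₂⟩
  | node a c s _ hs =>
    rcases h₁ with ⟨l', rfl, h₁⟩ | h₁ <;> rcases h₂ with ⟨l'', rfl, h₂⟩ | h₂
    · exact (hd (List.mem_cons_self ..) (List.mem_cons_self ..)).elim
    · exact Or.inl ⟨_, rfl, h₁, h₂⟩
    · exact Or.inr (Or.inl ⟨_, rfl, h₂, h₁⟩)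
    · exact Or.inr (Or.inr (hs h₁ h₂))

/-- The transport principle for paths: a chain that starts in a region `P` and meets only vertices
in `Q` cannot leave the region, and its steps are steps of the structure inside. It is applied to
subforests, to the subtrees between cut vertices, and to walks. -/
theorem isChain_of_closed {R S : V → V → Prop} {P Q : V → Prop}
    (h : ∀ x y, R x y → Q y → P x → P y ∧ S x y) (l : List V) (x : V)
    (hl : (x :: l).IsChain R) (hQ : ∀ y ∈ l, Q y) (hx : P x) :
    (∀ y ∈ x :: l, P y) ∧ (x :: l).IsChain S := by
  induction l generalizing x with
  | nil => simpa using hx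
  | cons y l ih =>
    rw [List.isChain_cons_cons] at hl
    have h1 := h x y hl.1 (hQ y (by simp)) hx
    have h2 := ih y hl.2 (fun z hz => hQ z (by simp [hz])) h1.1
    exact ⟨fun z hz => (List.mem_cons.1 hz).elim (fun h => h ▸ hx) (h2.1 z),
      List.isChain_cons_cons.2 ⟨h1.2, h2.2⟩⟩

section Node

variable {a : V × Bool} {c s : Forest (V × Bool)}

theorem mem_roots_of_linked (hT : (node a c s).verts.Nodup) {y : V}
    (h : (node a c s).Linked a.1 y) : y ∈ c.roots.map Prod.fst := by
  rw [nodup_node] at hT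
  rcases h with (⟨-, h⟩ | h | h) | (⟨-, h⟩ | h | h)
  · exact h
  · exact (hT.1 h.mem.1).elim
  · exact (hT.2.1 h.mem.1).elim
  · exact (hT.1 (mem_verts_of_mem_roots h)).elim
  · exact (hT.1 h.mem.2).elim
  · exact (hT.2.1 h.mem.2).elim

theorem linked_left (hT : (node a c s).verts.Nodup) {x y : V}
    (h : (node a c s).Linked x y) (hy : y ≠ a.1) (hx : x ∈ c.verts) :
    y ∈ c.verts ∧ c.Linked x y := by
  rw [nodup_node] at hT
  rcases h with (⟨h, -⟩ | h | h) | (⟨h, -⟩ | h | h)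
  · exact (hT.1 (h ▸ hx)).elim
  · exact ⟨h.mem.2, Or.inl h⟩
  · exact (hT.2.2.2.2 x hx h.mem.1).elim
  · exact (hy h).elim
  · exact ⟨h.mem.1, Or.inr h⟩
  · exact (hT.2.2.2.2 x hx h.mem.2).elim

theorem linked_right (hT : (node a c s).verts.Nodup) {x y : V}
    (h : (node a c s).Linked x y) (hx : x ∈ s.verts) : y ∈ s.verts ∧ s.Linked x y := by
  rw [nodup_node] at hT
  rcases h with (⟨h, -⟩ | h | h) | (⟨-, h⟩ | h | h)
  · exact (hT.2.1 (h ▸ hx)).elim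
  · exact (hT.2.2.2.2 x h.mem.1 hx).elim
  · exact ⟨h.mem.2, Or.inl h⟩
  · exact (hT.2.2.2.2 x (mem_verts_of_mem_roots h) hx).elim
  · exact (hT.2.2.2.2 x h.mem.2 hx).elim
  · exact ⟨h.mem.1, Or.inr h⟩

end Node

/-- From a root the only way is to a child, and a path never returns, so the rest lies in the
children forest and starts at one of its roots. -/
theorem isDown_of_isChain (hT : T.verts.Nodup) {r : V} {l : List V} (hr : r ∈ T.roots.map Prod.fst)
    (hl : (r :: l).Nodup) (h : (r :: l).IsChain T.Linked) : T.IsDown (r :: l) := by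
  induction T generalizing r l with
  | nil => simp [roots] at hr
  | node a c s hc hs =>
    have hT' := nodup_node.1 hT
    simp only [roots, List.map_cons, List.mem_cons] at hr
    rcases hr with rfl | hr
    · refine Or.inl ⟨l, rfl, ?_⟩
      cases l with
      | nil => exact isDown_nil _
      | cons y l =>
        rw [List.isChain_cons_cons] at h
        have hy := mem_roots_of_linked hT h.1
        rw [List.nodup_cons] at hl
        refine hc hT'.2.2.1 hy hl.2 (isChain_of_closed (Q := fun y => y ≠ a.1)
          (fun _ _ => linked_left hT) l y h.2 ?_ (mem_verts_of_mem_roots hy)).2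
        rintro z hz rfl
        exact hl.1 (by simp [hz])
    · exact Or.inr (hs hT'.2.2.2.1 hr hl (isChain_of_closed (Q := fun _ => True)
        (fun _ _ h _ => linked_right hT h) l r h (by simp) (mem_verts_of_mem_roots hr)).2)

/-- A path through the first root is cut there: both halves, read away from the root, lead
downwards, and they are disjoint. Any other path stays among the descendants of this root or among
the further trees. -/
theorem IsPathList.isBend (hT : T.verts.Nodup) {p : List V} (h : T.IsPathList p) :
    T.IsBend p := by
  induction T generalizing p with
  | nil =>
    cases p with
    | nil => rfl
    | cons x p => simpa using h.mem x (by simp)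
  | node a c s hc hs =>
    have hT' := nodup_node.1 hT
    by_cases ha : a.1 ∈ p
    · obtain ⟨p₁, p₂, rfl⟩ := List.append_of_mem ha
      have key : ∀ l, (a.1 :: l).Nodup → (a.1 :: l).IsChain (node a c s).Linked → c.IsDown l := by
        intro l h₁ h₂
        have := isDown_of_isChain hT (by simp [roots]) h₁ h₂
        rcases this with ⟨l', h, h'⟩ | h
        · obtain rfl : l = l' := by simpa using h
          exact h'
        · exact (hT'.2.1 (h.mem a.1 (by simp))).elim
      have hch := List.isChain_split.1 h.chain
      have hnd := h.nodup
      rw [List.nodup_append'] at hnd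
      have hd : p₁.Disjoint p₂ := fun x h₁ h₂ => hnd.2.2 h₁ (by simp [h₂])
      refine Or.inl ⟨p₁.reverse, p₂, ?_, by simp⟩
      refine IsDown.isFork_of_disjoint (key _ ?_ ?_) (key _ hnd.2.1 hch.2) ?_
      · rw [List.nodup_cons, List.nodup_reverse, List.mem_reverse]
        exact ⟨fun h => hnd.2.2 h (by simp), hnd.1⟩
      · rw [← isChain_reverse_linked]
        simpa using hch.1
      · simpa using hd
    · cases p with
      | nil => exact isBend_nil _
      | cons x l =>
        have hne : ∀ y ∈ l, y ≠ a.1 := by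
          rintro y hy rfl
          exact ha (by simp [hy])
        have hx := h.mem x (by simp)
        rw [verts_node, List.mem_cons, List.mem_append] at hx
        rcases hx with rfl | hx | hx
        · simp at ha
        · have := isChain_of_closed (Q := fun y => y ≠ a.1)
            (fun _ _ => linked_left hT) l x h.chain hne hx
          exact Or.inr (Or.inl (hc hT'.2.2.1 ⟨h.nodup, this.1, this.2⟩))
        · have := isChain_of_closed (Q := fun y => True)
            (fun _ _ h _ => linked_right hT h) l x h.chain (by simp) hx
          exact Or.inr (Or.inr (hs hT'.2.2.2.1 ⟨h.nodup, this.1, this.2⟩))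

/-! ### Lengths of paths in reduced forests -/

/-- A Steiner vertex on the way down has a child off the path, and the subtree of this child
contains a required vertex that can be charged. So can every tree of the forest that the path does
not use. -/
theorem IsDown.length_add_roots_le (hT : T.IsReduced) {l : List V} (h : T.IsDown l) (hl : l ≠ []) :
    l.length + T.roots.length ≤ (requireds T).length + 1 := by
  induction T generalizing l with
  | nil => exact (hl h).elim
  | node a c s hc hs =>
    obtain ⟨h1, h2, h3⟩ := hT
    rw [length_requireds_node, roots, List.length_cons]
    have r1 := h2.roots_le
    have r2 := h3.roots_le
    rcases h with ⟨l', rfl, h⟩ | h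
    · rw [List.length_cons]
      have h4 : l' = [] ∨ (l' ≠ [] ∧ l'.length + c.roots.length ≤ (requireds c).length + 1) := by
        by_cases h0 : l' = []
        · exact Or.inl h0
        · exact Or.inr ⟨h0, hc h2 h h0⟩
      split_ifs with hb
      · rcases h4 with rfl | ⟨h5, h4⟩
        · simp; omega
        · have : 1 ≤ c.roots.length := by
            by_contra h0
            obtain rfl := eq_nil_of_roots (T := c) (by omega)
            exact h5 h
          omega
      · have := h1.resolve_left hb
        rcases h4 with rfl | ⟨-, h4⟩
        · simp; omega
        · omega
    · have := hs h3 h hl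
      split_ifs with hb
      · omega
      · have := h1.resolve_left hb
        omega

theorem IsFork.length_add_roots_le (hT : T.IsReduced) {l₁ l₂ : List V} (h : T.IsFork l₁ l₂)
    (h₁ : l₁ ≠ []) (h₂ : l₂ ≠ []) :
    l₁.length + l₂.length + T.roots.length ≤ (requireds T).length + 2 := by
  induction T with
  | nil => exact (h₁ h.1).elim
  | node a c s hc hs =>
    have aux : ∀ l l₂ : List V, l₂ ≠ [] → c.IsDown l → s.IsDown l₂ →
        l.length + 1 + l₂.length + (node a c s).roots.length ≤
          (requireds (node a c s)).length + 2 := by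
      intro l l₂ h₂ hl hl₂
      have e1 := IsDown.length_add_roots_le (T := node a c nil) ⟨hT.1, hT.2.1, trivial⟩
        (Or.inl ⟨l, rfl, hl⟩) (by simp)
      have e2 := hl₂.length_add_roots_le hT.2.2 h₂
      rw [length_requireds_node, roots, List.length_cons] at *
      simp [requireds, roots] at e1
      omega
    rcases h with ⟨l', rfl, h, h'⟩ | ⟨l', rfl, h, h'⟩ | h
    · exact aux _ _ h₂ h h'
    · have := aux _ _ h₁ h h'
      rw [List.length_cons]; omega
    · have := hs hT.2.2 h
      have r := IsReduced.roots_le (T := node a c nil) ⟨hT.1, hT.2.1, trivial⟩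
      rw [length_requireds_node, roots, List.length_cons] at *
      simp [requireds, roots] at r
      omega

/-- A path through the root of a reduced tree. -/
theorem IsFork.length_le {a : V × Bool} {c : Forest (V × Bool)}
    (hT : (node a c nil).IsReduced) {l₁ l₂ : List V} (h : c.IsFork l₁ l₂) :
    l₁.length + l₂.length + 1 ≤ (requireds (node a c nil)).length ∨
      (l₁.length + l₂.length ≤ (requireds (node a c nil)).length ∧ l₁ ≠ [] ∧ l₂ ≠ [] ∧
        c.roots.length = 2) := by
  have key : ∀ l, c.IsDown l → l.length + 1 ≤ (requireds (node a c nil)).length := by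
    intro l hl
    have := IsDown.length_add_roots_le (T := node a c nil) hT (Or.inl ⟨l, rfl, hl⟩) (by simp)
    simp [roots] at this
    omega
  by_cases h₁ : l₁ = []
  · subst h₁
    have := key _ h.right
    simp; omega
  by_cases h₂ : l₂ = []
  · subst h₂
    have := key _ h.left
    simp; omega
  have h3 := h.length_add_roots_le hT.2.1 h₁ h₂
  have h4 : 2 ≤ c.roots.length := by
    by_contra h4
    exact (h.eq_nil h4).elim h₁ h₂
  -- A required root or a third child supplies the required vertex that pays for the root; only a
  -- Steiner root with two children is left over.
  rw [length_requireds_node]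
  split_ifs with hb
  · left; omega
  · by_cases h5 : c.roots.length = 2
    · right; exact ⟨by omega, h₁, h₂, h5⟩
    · left; omega

/-- Both branches are paid for as downward paths, so at most the turning point is in excess. -/
theorem IsBend.length_add_roots_le (hT : T.IsReduced) {p : List V} (h : T.IsBend p)
    (hp : p ≠ []) : p.length + T.roots.length ≤ (requireds T).length + 2 := by
  induction T with
  | nil => exact (hp h).elim
  | node a c s hc hs =>
    have r1 := IsReduced.roots_le (T := node a c nil) ⟨hT.1, hT.2.1, trivial⟩
    have r2 := hT.2.2.roots_le
    rcases h with ⟨l₁, l₂, h, rfl⟩ | h | h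
    · have := h.length_le (a := a) ⟨hT.1, hT.2.1, trivial⟩
      rw [length_requireds_node] at *
      simp [roots, requireds] at *
      omega
    · have := hc hT.2.1 h
      rw [length_requireds_node] at *
      simp [roots, requireds] at r1
      rw [roots, List.length_cons]
      have h1 : 1 ≤ c.roots.length := by
        by_contra h0
        obtain rfl := eq_nil_of_roots (T := c) (by omega)
        exact hp h
      split_ifs with hb
      · omega
      · have := hT.1.resolve_left hb
        omega
    · have := hs hT.2.2 h
      rw [length_requireds_node] at *
      simp [roots, requireds] at r1
      rw [roots, List.length_cons]
      omega

/-- A path in a reduced forest with more vertices than the forest has required vertices passes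
through the only root, and that root has exactly two children. -/
theorem IsBend.exists_of_length (hT : T.IsReduced) {p : List V} (h : T.IsBend p)
    (hp : (requireds T).length < p.length) :
    ∃ a c₁ d₁ c₂ d₂ l₁ l₂, T = node a (node c₁ d₁ (node c₂ d₂ nil)) nil ∧
      (node c₁ d₁ (node c₂ d₂ nil)).IsFork l₁ l₂ ∧ l₁ ≠ [] ∧ l₂ ≠ [] ∧
      p = l₁.reverse ++ a.1 :: l₂ ∧ l₁.length + l₂.length ≤ (requireds T).length := by
  have hp0 : p ≠ [] := by rintro rfl; simp at hp
  have h0 := h.length_add_roots_le hT hp0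
  match T with
  | nil => exact (hp0 h).elim
  | node a c (node _ _ _) => simp [roots] at h0; omega
  | node a c nil =>
    rcases h with ⟨l₁, l₂, h, rfl⟩ | h | h
    · rcases h.length_le hT with h1 | ⟨h1, h2, h3, h4⟩
      · simp at hp; omega
      · match c with
        | nil => simp [roots] at h4
        | node c₁ d₁ nil => simp [roots] at h4
        | node c₁ d₁ (node c₂ d₂ nil) => exact ⟨a, c₁, d₁, c₂, d₂, l₁, l₂, rfl, h, h2, h3, rfl, h1⟩
        | node c₁ d₁ (node c₂ d₂ (node _ _ _)) => simp [roots] at h4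
    · have h1 := h.length_add_roots_le hT.2.1 hp0
      have h2 : 1 ≤ c.roots.length := by
        by_contra h0
        obtain rfl := eq_nil_of_roots (T := c) (by omega)
        exact hp0 h
      rw [length_requireds_node] at hp
      split_ifs at hp with hb
      · omega
      · have := hT.1.resolve_left hb
        omega
    · exact (hp0 h).elim

/-! ### Paths in pruned forests -/

/-- The list `l'` is a sublist of `l` that contains all vertices that survive in `pruned T`. -/
structure Keeps (T : Forest (V × Bool)) (l l' : List V) : Prop where
  sublist : l'.Sublist l
  mem : ∀ x ∈ l, x ∈ (pruned T).verts → x ∈ l'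

theorem mem_verts_append {x : V} : x ∈ (F.append G).verts ↔ x ∈ F.verts ∨ x ∈ G.verts := by
  simp [verts, labels_append, List.map_append]

section Node

variable {a : V × Bool} {c s : Forest (V × Bool)}

theorem pruned_node_cases (a : V × Bool) (c s : Forest (V × Bool)) :
    pruned (node a c s) = node a (pruned c) (pruned s) ∨
      (¬ 2 ≤ (pruned c).roots.length ∧ pruned (node a c s) = (pruned c).append (pruned s)) := by
  obtain ⟨v, _ | _⟩ := a
  · rw [pruned_false]
    split_ifs with h
    · exact Or.inl rfl
    · exact Or.inr ⟨h, rfl⟩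
  · exact Or.inl (pruned_true ..)

theorem mem_verts_pruned_node {x : V} (h : x ∈ (pruned (node a c s)).verts) :
    x = a.1 ∨ x ∈ (pruned c).verts ∨ x ∈ (pruned s).verts := by
  rcases pruned_node_cases a c s with e | ⟨-, e⟩ <;> rw [e] at h
  · simpa using h
  · exact Or.inr (mem_verts_append.1 h)

theorem Keeps.node_left (hT : (node a c s).verts.Nodup) {l l' : List V} (h : c.Keeps l l')
    (hl : ∀ x ∈ l, x ∈ c.verts) : (node a c s).Keeps l l' := by
  rw [nodup_node] at hT
  refine ⟨h.sublist, fun x hx hx' => ?_⟩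
  rcases mem_verts_pruned_node hx' with rfl | h' | h'
  · exact (hT.1 (hl _ hx)).elim
  · exact h.mem x hx h'
  · exact (hT.2.2.2.2 x (hl x hx) ((verts_pruned_sublist s).subset h')).elim

theorem Keeps.node_right (hT : (node a c s).verts.Nodup) {l l' : List V} (h : s.Keeps l l')
    (hl : ∀ x ∈ l, x ∈ s.verts) : (node a c s).Keeps l l' := by
  rw [nodup_node] at hT
  refine ⟨h.sublist, fun x hx hx' => ?_⟩
  rcases mem_verts_pruned_node hx' with rfl | h' | h'
  · exact (hT.2.1 (hl _ hx)).elim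
  · exact (hT.2.2.2.2 x ((verts_pruned_sublist c).subset h') (hl x hx)).elim
  · exact h.mem x hx h'

theorem Keeps.cons {v : V} {l l' : List V} (h : T.Keeps l l') : T.Keeps (v :: l) (v :: l') :=
  ⟨h.sublist.cons_cons _, fun x hx hx' => by
    rcases List.mem_cons.1 hx with rfl | hx
    · simp
    · exact List.mem_cons_of_mem _ (h.mem x hx hx')⟩

theorem Keeps.skip {v : V} {l l' : List V} (h : T.Keeps l l') (hv : v ∉ (pruned T).verts) :
    T.Keeps (v :: l) l' :=
  ⟨h.sublist.cons _, fun x hx hx' => by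
    rcases List.mem_cons.1 hx with rfl | hx
    · exact (hv hx').elim
    · exact h.mem x hx hx'⟩

theorem Keeps.append {l₁ l₁' l₂ l₂' : List V} (h₁ : T.Keeps l₁ l₁') (h₂ : T.Keeps l₂ l₂') :
    T.Keeps (l₁ ++ l₂) (l₁' ++ l₂') :=
  ⟨h₁.sublist.append h₂.sublist, fun x hx hx' =>
    List.mem_append.2 ((List.mem_append.1 hx).imp (h₁.mem x · hx') (h₂.mem x · hx'))⟩

theorem Keeps.reverse {l l' : List V} (h : T.Keeps l l') : T.Keeps l.reverse l'.reverse :=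
  ⟨h.sublist.reverse, fun x hx hx' =>
    List.mem_reverse.2 (h.mem x (List.mem_reverse.1 hx) hx')⟩

theorem notMem_pruned_of_append (hT : (node a c s).verts.Nodup)
    (e : pruned (node a c s) = (pruned c).append (pruned s)) :
    a.1 ∉ (pruned (node a c s)).verts := by
  rw [nodup_node] at hT
  rw [e, mem_verts_append]
  rintro (h | h)
  · exact hT.1 ((verts_pruned_sublist c).subset h)
  · exact hT.2.1 ((verts_pruned_sublist s).subset h)

end Node

theorem IsDown.exists_pruned (hT : T.verts.Nodup) {l : List V} (h : T.IsDown l) :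
    ∃ l', T.Keeps l l' ∧ (pruned T).IsDown l' := by
  induction T generalizing l with
  | nil => exact ⟨l, ⟨List.Sublist.refl _, fun _ h _ => h⟩, h⟩
  | node a c s hc hs =>
    have hT' := nodup_node.1 hT
    rcases h with ⟨l, rfl, h⟩ | h
    · obtain ⟨l', h₁, h₂⟩ := hc hT'.2.2.1 h
      have h₃ := h₁.node_left hT h.mem
      rcases pruned_node_cases a c s with e | ⟨-, e⟩
      · exact ⟨_, h₃.cons, by rw [e]; exact Or.inl ⟨_, rfl, h₂⟩⟩
      · exact ⟨_, h₃.skip (notMem_pruned_of_append hT e), by rw [e]; exact h₂.append_left⟩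
    · obtain ⟨l', h₁, h₂⟩ := hs hT'.2.2.2.1 h
      refine ⟨l', h₁.node_right hT h.mem, ?_⟩
      rcases pruned_node_cases a c s with e | ⟨-, e⟩ <;> rw [e]
      · exact Or.inr h₂
      · exact h₂.append_right

theorem IsFork.exists_pruned (hT : T.verts.Nodup) {l₁ l₂ : List V} (h : T.IsFork l₁ l₂) :
    ∃ l₁' l₂', T.Keeps l₁ l₁' ∧ T.Keeps l₂ l₂' ∧ (pruned T).IsFork l₁' l₂' := by
  induction T with
  | nil =>
    exact ⟨l₁, l₂, ⟨List.Sublist.refl _, fun _ h _ => h⟩,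
      ⟨List.Sublist.refl _, fun _ h _ => h⟩, h⟩
  | node a c s hc hs =>
    have hT' := nodup_node.1 hT
    have key : ∀ l l₂, c.IsDown l → s.IsDown l₂ → ∃ l₁' l₂', (node a c s).Keeps (a.1 :: l) l₁' ∧
        (node a c s).Keeps l₂ l₂' ∧ (pruned (node a c s)).IsFork l₁' l₂' := by
      intro l l₂ h h'
      obtain ⟨l', h₁, h₂⟩ := h.exists_pruned hT'.2.2.1
      obtain ⟨l₂', h₃, h₄⟩ := h'.exists_pruned hT'.2.2.2.1
      have h₁ := h₁.node_left hT h.mem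
      have h₃ := h₃.node_right hT h'.mem
      rcases pruned_node_cases a c s with e | ⟨-, e⟩
      · exact ⟨_, _, h₁.cons, h₃, by rw [e]; exact Or.inl ⟨_, rfl, h₂, h₄⟩⟩
      · exact ⟨_, _, h₁.skip (notMem_pruned_of_append hT e), h₃, by
          rw [e]; exact h₂.isFork_append h₄⟩
    rcases h with ⟨l, rfl, h, h'⟩ | ⟨l, rfl, h, h'⟩ | h
    · exact key _ _ h h'
    · obtain ⟨l₂', l₁', h₂, h₁, h₃⟩ := key _ _ h h'
      exact ⟨l₁', l₂', h₁, h₂, h₃.symm⟩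
    · obtain ⟨l₁', l₂', h₁, h₂, h₃⟩ := hs hT'.2.2.2.1 h
      refine ⟨l₁', l₂', h₁.node_right hT h.left.mem, h₂.node_right hT h.right.mem, ?_⟩
      rcases pruned_node_cases a c s with e | ⟨-, e⟩ <;> rw [e]
      · exact Or.inr (Or.inr h₃)
      · exact h₃.append_right

/-- If the turning point is deleted, then at most one tree survives below it. One of the two
restricted branches is therefore empty, and what is left is a downward path, possibly reversed. -/
theorem IsBend.exists_pruned (hT : T.verts.Nodup) {p : List V} (h : T.IsBend p) :
    ∃ p', T.Keeps p p' ∧ (pruned T).IsBend p' := by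
  induction T with
  | nil => exact ⟨p, ⟨List.Sublist.refl _, fun _ h _ => h⟩, h⟩
  | node a c s hc hs =>
    have hT' := nodup_node.1 hT
    rcases h with ⟨l₁, l₂, h, rfl⟩ | h | h
    · obtain ⟨l₁', l₂', h₁, h₂, h₃⟩ := h.exists_pruned hT'.2.2.1
      have h₁ := h₁.node_left hT h.left.mem
      have h₂ := h₂.node_left hT h.right.mem
      rcases pruned_node_cases a c s with e | ⟨h₀, e⟩
      · exact ⟨_, h₁.reverse.append h₂.cons, by rw [e]; exact Or.inl ⟨_, _, h₃, rfl⟩⟩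
      · refine ⟨_, h₁.reverse.append (h₂.skip (notMem_pruned_of_append hT e)), ?_⟩
        rw [e]
        rcases h₃.eq_nil h₀ with rfl | rfl
        · simpa using h₃.right.isBend.append_left
        · simpa using h₃.left.isBend_reverse.append_left
    · obtain ⟨p', h₁, h₂⟩ := hc hT'.2.2.1 h
      refine ⟨p', h₁.node_left hT h.mem, ?_⟩
      rcases pruned_node_cases a c s with e | ⟨-, e⟩ <;> rw [e]
      · exact Or.inr (Or.inl h₂)
      · exact h₂.append_left
    · obtain ⟨p', h₁, h₂⟩ := hs hT'.2.2.2.1 h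
      refine ⟨p', h₁.node_right hT h.mem, ?_⟩
      rcases pruned_node_cases a c s with e | ⟨-, e⟩ <;> rw [e]
      · exact Or.inr (Or.inr h₂)
      · exact h₂.append_right

/-- The restriction of a path to the vertices that survive pruning is a path. -/
theorem IsPathList.exists_pruned (hT : T.verts.Nodup) {p : List V} (h : T.IsPathList p) :
    ∃ p', T.Keeps p p' ∧ (pruned T).IsPathList p' := by
  obtain ⟨p', h₁, h₂⟩ := (h.isBend hT).exists_pruned hT
  exact ⟨p', h₁, h₁.sublist.nodup h.nodup, h₂.mem, h₂.isChain⟩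

end Forest

end TreeSpanner

namespace TreeSpanner

variable {V : Type}

open Forest

/-! ### The decomposition -/

namespace Forest

theorem size_map {A B : Type} (f : A → B) (T : Forest A) : (T.map f).size = T.size := by
  induction T with
  | nil => rfl
  | node a c s hc hs => simp [map, size, hc, hs]

theorem labels_map {A B : Type} (f : A → B) (T : Forest A) :
    (T.map f).labels = T.labels.map f := by
  induction T with
  | nil => rfl
  | node a c s hc hs => simp [map, labels, hc, hs]

theorem roots_map {A B : Type} (f : A → B) (T : Forest A) : (T.map f).roots = T.roots.map f := by
  induction T with
  | nil => rfl
  | node a c s _ hs => simp [map, roots, hs]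

theorem length_requireds_eq_countP (T : Forest (V × Bool)) :
    (requireds T).length = T.labels.countP (·.2) := by
  induction T with
  | nil => rfl
  | node a c s hc hs =>
    obtain ⟨v, _ | _⟩ := a
    · simp [requireds, labels, hc, hs]; omega
    · simp [requireds, labels, hc, hs]; omega

theorem label_unique {T : Forest (V × Bool)} (hT : T.verts.Nodup) {v : V} {b b' : Bool}
    (h : (v, b) ∈ T.labels) (h' : (v, b') ∈ T.labels) : b = b' :=
  congrArg Prod.snd (List.inj_on_of_nodup_map hT h h' rfl)

end Forest

/-- The tree underlying a forest with cut marks. -/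
def unmarked (M : Forest (V × Bool × Bool)) : Forest (V × Bool) := M.map fun a => (a.1, a.2.1)

/-- The copy in which exactly the cut vertices are required. -/
def recolored (M : Forest (V × Bool × Bool)) : Forest (V × Bool) := M.map fun a => (a.1, a.2.2)

theorem unmarked_decomposed (ℓ : ℕ) (T : Forest (V × Bool)) : unmarked (decomposed ℓ T).1 = T := by
  unfold unmarked
  induction T with
  | nil => rfl
  | node a c s hc hs =>
    obtain ⟨v, b⟩ := a
    rw [decomposed]
    split_ifs <;> simp [Forest.map, hc, hs]

theorem size_decomposed (ℓ : ℕ) (T : Forest (V × Bool)) : (decomposed ℓ T).1.size = T.size := by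
  conv_rhs => rw [← unmarked_decomposed ℓ T, unmarked, size_map]

theorem isChild_recolored (M : Forest (V × Bool × Bool)) (x y : V) :
    (recolored M).IsChild x y ↔ (unmarked M).IsChild x y := by
  unfold recolored unmarked
  induction M with
  | nil => rfl
  | node a c s hc hs => simp [Forest.map, IsChild, hc, hs, roots_map]

theorem verts_recolored (M : Forest (V × Bool × Bool)) :
    (recolored M).verts = (unmarked M).verts := by
  simp [recolored, unmarked, verts, labels_map]

theorem requireds_recolored (M : Forest (V × Bool × Bool)) : requireds (recolored M) = cuts M := by
  unfold recolored
  induction M with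
  | nil => rfl
  | node a c s hc hs =>
    obtain ⟨v, b, x⟩ := a
    simp [Forest.map, requireds, cuts, hc, hs]

theorem isPathList_recolored {M : Forest (V × Bool × Bool)} {p : List V}
    (h : (unmarked M).IsPathList p) : (recolored M).IsPathList p :=
  ⟨h.nodup, fun x hx => verts_recolored M ▸ h.mem x hx,
    h.chain.imp fun x y => Or.imp (isChild_recolored M x y).2 (isChild_recolored M y x).2⟩

/-- A cut consumes at least `ℓ + 1` required vertices; the second component of `decomposed` counts
those not yet consumed and must be carried along in the induction. -/
theorem mul_length_cuts_add_le (ℓ : ℕ) (T : Forest (V × Bool)) :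
    (ℓ + 1) * (cuts (decomposed ℓ T).1).length + (decomposed ℓ T).2 ≤ (requireds T).length := by
  induction T with
  | nil => simp [decomposed, cuts]
  | node a c s hc hs =>
    obtain ⟨v, b⟩ := a
    rw [length_requireds_node, decomposed]
    split_ifs <;> simp [cuts] <;> nlinarith

/-- The marks of `M` are given by the function `cut`. -/
def IsMarkedBy (M : Forest (V × Bool × Bool)) (cut : V → Bool) : Prop :=
  ∀ a ∈ M.labels, a.2.2 = cut a.1

theorem IsMarkedBy.of_node {a : V × Bool × Bool} {c s : Forest (V × Bool × Bool)} {cut : V → Bool}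
    (h : IsMarkedBy (.node a c s) cut) : a.2.2 = cut a.1 ∧ IsMarkedBy c cut ∧ IsMarkedBy s cut :=
  ⟨h a (by simp [labels]), fun x hx => h x (by simp [labels, hx]),
    fun x hx => h x (by simp [labels, hx])⟩

theorem mem_cuts {M : Forest (V × Bool × Bool)} {x : V} :
    x ∈ cuts M ↔ ∃ b, (x, b, true) ∈ M.labels := by
  rw [← requireds_recolored, mem_requireds, recolored, labels_map]
  simp

open Classical in
-- Distinct names make the mark a function of the name, so that the lemmas on edges below can speak
-- of vertices instead of positions in the forest.
theorem exists_isMarkedBy {M : Forest (V × Bool × Bool)} (hM : (unmarked M).verts.Nodup) :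
    ∃ cut : V → Bool, IsMarkedBy M cut ∧ ∀ x, x ∈ cuts M ↔ cut x = true := by
  refine ⟨fun x => decide (x ∈ cuts M), ?_, by simp⟩
  rintro ⟨v, b, x⟩ h
  cases x
  · symm
    simp only [decide_eq_false_iff_not, mem_cuts]
    rintro ⟨b', h'⟩
    rw [← verts_recolored] at hM
    have := label_unique hM (v := v) (b := false) (b' := true)
      (by rw [recolored, labels_map]; exact List.mem_map.2 ⟨_, h, rfl⟩)
      (by rw [recolored, labels_map]; exact List.mem_map.2 ⟨_, h', rfl⟩)
    simp at this
  · symm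
    exact decide_eq_true (mem_cuts.2 ⟨b, h⟩)

/-! ### How `splitted` distributes vertices, edges and border vertices -/

theorem splitted_below_fst (u : Option V) (M : Forest (V × Bool × Bool)) :
    (splitted (.below u) M).1 = .nil := by
  induction M with
  | nil => rfl
  | node a c s _ hs => obtain ⟨w, b, _ | _⟩ := a <;> simpa [splitted] using hs

/-- The vertices that remain after the removal of the cut vertices. -/
theorem labels_splitted (pos : Position V) (M : Forest (V × Bool × Bool)) :
    ((splitted pos M).1.labels ++ (splitted pos M).2.2.flatMap (·.tree.labels)).Perm
      ((M.labels.filter fun a => !a.2.2).map fun a => (a.1, a.2.1)) := by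
  induction M generalizing pos with
  | nil => cases pos <;> simp [splitted, labels]
  | node a c s hc hs =>
    obtain ⟨v, b, x⟩ := a
    simp only [← Multiset.coe_eq_coe, ← Multiset.coe_add] at hc hs ⊢
    cases x
    · cases pos with
      | inside =>
        simp only [splitted, labels, List.flatMap_append, List.filter_append, List.map_append,
          ← Multiset.coe_add, Bool.not_false, List.filter_cons_of_pos, List.map_cons,
          ← Multiset.cons_coe, ← hc .inside, ← hs .inside, ← Multiset.singleton_add]
        abel
      | below u =>
        simp only [splitted, labels, List.flatMap_append, List.filter_append, List.map_append,
          ← Multiset.coe_add, Bool.not_false, List.filter_cons_of_pos, List.map_cons,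
          List.flatMap_cons, List.append_nil,
          ← Multiset.cons_coe, ← hc .inside, ← hs (.below u), ← Multiset.singleton_add]
        abel
    · have hc' := hc (.below (some v))
      rw [splitted_below_fst] at hc'
      simp only [labels, Multiset.coe_nil, zero_add] at hc'
      simp only [splitted, labels, List.flatMap_append, List.filter_append, List.map_append,
          ← Multiset.coe_add, Bool.not_true, Bool.false_eq_true, not_false_eq_true,
          List.filter_cons_of_neg, ← hc', ← hs pos]
      abel

section Split

variable {M : Forest (V × Bool × Bool)} {cut : V → Bool}

theorem mem_roots_splitted (hM : IsMarkedBy M cut) {y : V}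
    (hy : y ∈ (unmarked M).roots.map Prod.fst) (h : cut y = false) :
    y ∈ (splitted .inside M).1.roots.map Prod.fst := by
  induction M with
  | nil => simpa [splitted, unmarked, Forest.map] using hy
  | node a c s _ hs =>
    obtain ⟨v, b, x⟩ := a
    obtain ⟨hx, -, hM₂⟩ := hM.of_node
    simp only [unmarked, Forest.map, roots, List.map_cons, List.mem_cons] at hy
    cases x
    · simp only [splitted, roots, List.map_cons, List.mem_cons]
      exact hy.imp id (hs hM₂)
    · simp only [splitted]
      refine hs hM₂ (hy.resolve_left ?_)
      rintro rfl
      simp only [h] at hx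
      exact Bool.noConfusion hx

theorem mem_border_of_mem_roots (hM : IsMarkedBy M cut) {y : V}
    (hy : y ∈ (unmarked M).roots.map Prod.fst) (h : cut y = true) :
    y ∈ (splitted .inside M).2.1 := by
  induction M with
  | nil => simp [unmarked, Forest.map, roots] at hy
  | node a c s _ hs =>
    obtain ⟨v, b, x⟩ := a
    obtain ⟨hx, -, hM₂⟩ := hM.of_node
    simp only [unmarked, Forest.map, roots, List.map_cons, List.mem_cons] at hy
    cases x
    · simp only [splitted, List.mem_append]
      refine Or.inl (hs hM₂ (hy.resolve_left ?_))
      rintro rfl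
      simp only [h] at hx
      exact Bool.noConfusion hx
    · simp only [splitted, List.mem_append, List.mem_singleton]
      exact hy.symm.imp (hs hM₂) id

theorem exists_component_of_mem_roots (hM : IsMarkedBy M cut) {y u : V}
    (hy : y ∈ (unmarked M).roots.map Prod.fst) (h : cut y = false) :
    ∃ t ∈ (splitted (.below (some u)) M).2.2, y ∈ t.tree.verts ∧ u ∈ t.border := by
  induction M with
  | nil => simp [unmarked, Forest.map, roots] at hy
  | node a c s _ hs =>
    obtain ⟨v, b, x⟩ := a
    obtain ⟨hx, -, hM₂⟩ := hM.of_node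
    simp only [unmarked, Forest.map, roots, List.map_cons, List.mem_cons] at hy
    cases x
    · simp only [splitted, List.mem_append, List.mem_cons]
      rcases hy with rfl | hy
      · exact ⟨_, Or.inr (Or.inl rfl), by simp, by simp⟩
      · obtain ⟨t, ht, h⟩ := hs hM₂ hy
        exact ⟨t, Or.inl ht, h⟩
    · simp only [splitted, List.mem_append]
      have hy : y ∈ (unmarked s).roots.map Prod.fst := by
        refine hy.resolve_left ?_
        rintro rfl
        simp only [h] at hx
        exact Bool.noConfusion hx
      obtain ⟨t, ht, h⟩ := hs hM₂ hy
      exact ⟨t, Or.inl ht, h⟩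

/-- This and the next two lemmas follow an edge of the tree through the removal, according to which
ends are cut. The first alternative concerns the part still attached to the current subtree; it is
empty for `below`. -/
theorem exists_component_of_isChild (hM : IsMarkedBy M cut) (pos : Position V) {x y : V}
    (h : (unmarked M).IsChild x y) (hx : cut x = false) (hy : cut y = false) :
    (splitted pos M).1.IsChild x y ∨ ∃ t ∈ (splitted pos M).2.2, t.tree.IsChild x y := by
  induction M generalizing pos with
  | nil => exact h.elim
  | node a c s hc hs =>
    obtain ⟨v, b, z⟩ := a
    obtain ⟨hz, hM₁, hM₂⟩ := hM.of_node
    cases z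
    · have key : (Forest.node (v, b) (splitted .inside c).1 .nil).IsChild x y ∨
          (∃ t ∈ (splitted .inside c).2.2, t.tree.IsChild x y) ∨
          (unmarked s).IsChild x y := by
        rcases h with ⟨h1, h2⟩ | h | h
        · exact Or.inl (Or.inl ⟨h1, mem_roots_splitted hM₁ h2 hy⟩)
        · exact (hc hM₁ .inside h).imp (fun h => Or.inr (Or.inl h)) Or.inl
        · exact Or.inr (Or.inr h)
      cases pos with
      | inside =>
        simp only [splitted, List.mem_append]
        rcases key with (h | h | h) | ⟨t, ht, h⟩ | h
        · exact Or.inl (Or.inl h)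
        · exact Or.inl (Or.inr (Or.inl h))
        · exact h.elim
        · exact Or.inr ⟨t, Or.inr ht, h⟩
        · rcases hs hM₂ .inside h with h | ⟨t, ht, h⟩
          · exact Or.inl (Or.inr (Or.inr h))
          · exact Or.inr ⟨t, Or.inl ht, h⟩
      | below u =>
        simp only [splitted, List.mem_append, List.mem_cons]
        rcases key with h | ⟨t, ht, h⟩ | h
        · exact Or.inr ⟨_, Or.inr (Or.inl rfl), h⟩
        · exact Or.inr ⟨t, Or.inr (Or.inr ht), h⟩
        · exact (hs hM₂ (.below u) h).imp id fun ⟨t, ht, h⟩ => ⟨t, Or.inl ht, h⟩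
    · simp only [splitted, List.mem_append]
      rcases h with ⟨h1, h2⟩ | h | h
      · simp only at hz h1
        rw [h1, ← hz] at hx
        exact Bool.noConfusion hx
      · have := hc hM₁ (.below (some v)) h
        rw [splitted_below_fst] at this
        obtain ⟨t, ht, h⟩ := this.resolve_left (fun h => h)
        exact Or.inr ⟨t, Or.inr ht, h⟩
      · exact (hs hM₂ pos h).imp id fun ⟨t, ht, h⟩ => ⟨t, Or.inl ht, h⟩

/-- The child of a cut vertex is the root of a new subtree, which is completed at once; so no
alternative for the attached part is needed. -/
theorem exists_component_of_parent_cut (hM : IsMarkedBy M cut) (pos : Position V) {x y : V}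
    (h : (unmarked M).IsChild x y) (hx : cut x = true) (hy : cut y = false) :
    ∃ t ∈ (splitted pos M).2.2, y ∈ t.tree.verts ∧ x ∈ t.border := by
  induction M generalizing pos with
  | nil => exact h.elim
  | node a c s hc hs =>
    obtain ⟨v, b, z⟩ := a
    obtain ⟨hz, hM₁, hM₂⟩ := hM.of_node
    cases z
    · have h : (unmarked c).IsChild x y ∨ (unmarked s).IsChild x y := by
        refine Or.resolve_left h ?_
        rintro ⟨h1, -⟩
        simp only at hz h1
        rw [h1, ← hz] at hx
        exact Bool.noConfusion hx
      cases pos with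
      | inside =>
        simp only [splitted, List.mem_append]
        rcases h with h | h
        · obtain ⟨t, ht, h⟩ := hc hM₁ .inside h
          exact ⟨t, Or.inr ht, h⟩
        · obtain ⟨t, ht, h⟩ := hs hM₂ .inside h
          exact ⟨t, Or.inl ht, h⟩
      | below u =>
        simp only [splitted, List.mem_append, List.mem_cons]
        rcases h with h | h
        · obtain ⟨t, ht, h⟩ := hc hM₁ .inside h
          exact ⟨t, Or.inr (Or.inr ht), h⟩
        · obtain ⟨t, ht, h⟩ := hs hM₂ (.below u) h
          exact ⟨t, Or.inl ht, h⟩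
    · simp only [splitted, List.mem_append]
      rcases h with ⟨rfl, h⟩ | h | h
      · obtain ⟨t, ht, h⟩ := exists_component_of_mem_roots (u := x) hM₁ h hy
        exact ⟨t, Or.inr ht, h⟩
      · obtain ⟨t, ht, h⟩ := hc hM₁ (.below (some v)) h
        exact ⟨t, Or.inr ht, h⟩
      · obtain ⟨t, ht, h⟩ := hs hM₂ pos h
        exact ⟨t, Or.inl ht, h⟩

theorem exists_component_of_child_cut (hM : IsMarkedBy M cut) (pos : Position V) {x y : V}
    (h : (unmarked M).IsChild x y) (hx : cut x = false) (hy : cut y = true) :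
    (x ∈ (splitted pos M).1.verts ∧ y ∈ (splitted pos M).2.1) ∨
      ∃ t ∈ (splitted pos M).2.2, x ∈ t.tree.verts ∧ y ∈ t.border := by
  induction M generalizing pos with
  | nil => exact h.elim
  | node a c s hc hs =>
    obtain ⟨v, b, z⟩ := a
    obtain ⟨hz, hM₁, hM₂⟩ := hM.of_node
    cases z
    · have key : ((x = v ∨ x ∈ (splitted .inside c).1.verts) ∧ y ∈ (splitted .inside c).2.1) ∨
          (∃ t ∈ (splitted .inside c).2.2, x ∈ t.tree.verts ∧ y ∈ t.border) ∨
          (unmarked s).IsChild x y := by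
        rcases h with ⟨h1, h2⟩ | h | h
        · exact Or.inl ⟨Or.inl h1, mem_border_of_mem_roots hM₁ h2 hy⟩
        · exact (hc hM₁ .inside h).imp (fun h => ⟨Or.inr h.1, h.2⟩) Or.inl
        · exact Or.inr (Or.inr h)
      cases pos with
      | inside =>
        simp only [splitted, List.mem_append, verts_node, List.mem_cons]
        rcases key with h | ⟨t, ht, h⟩ | h
        · exact Or.inl ⟨h.1.imp id Or.inl, Or.inr h.2⟩
        · exact Or.inr ⟨t, Or.inr ht, h⟩
        · rcases hs hM₂ .inside h with h | ⟨t, ht, h⟩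
          · exact Or.inl ⟨Or.inr (Or.inr h.1), Or.inl h.2⟩
          · exact Or.inr ⟨t, Or.inl ht, h⟩
      | below u =>
        simp only [splitted, List.mem_append, List.mem_cons]
        rcases key with h | ⟨t, ht, h⟩ | h
        · exact Or.inr ⟨_, Or.inr (Or.inl rfl), by simpa using h.1, by simp [h.2]⟩
        · exact Or.inr ⟨t, Or.inr (Or.inr ht), h⟩
        · exact (hs hM₂ (.below u) h).imp id fun ⟨t, ht, h⟩ => ⟨t, Or.inl ht, h⟩
    · simp only [splitted, List.mem_append]
      rcases h with ⟨h1, h2⟩ | h | h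
      · simp only at hz h1
        rw [h1, ← hz] at hx
        exact Bool.noConfusion hx
      · have := hc hM₁ (.below (some v)) h
        rw [splitted_below_fst] at this
        obtain ⟨t, ht, h⟩ := this.resolve_left (fun h => by simpa using h.1)
        exact Or.inr ⟨t, Or.inr ht, h⟩
      · exact (hs hM₂ pos h).imp (fun h => ⟨h.1, Or.inl h.2⟩) fun ⟨t, ht, h⟩ => ⟨t, Or.inl ht, h⟩

end Split

theorem border_splitted_subset (C : Set V) (pos : Position V) (M : Forest (V × Bool × Bool))
    (hM : ∀ x ∈ cuts M, x ∈ C) (hpos : ∀ u, pos = .below (some u) → u ∈ C) :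
    (∀ x ∈ (splitted pos M).2.1, x ∈ C) ∧
      ∀ t ∈ (splitted pos M).2.2, ∀ x ∈ t.border, x ∈ C := by
  induction M generalizing pos with
  | nil => cases pos <;> simp [splitted]
  | node a c s hc hs =>
    obtain ⟨v, b, z⟩ := a
    have h1 : ∀ x ∈ cuts c, x ∈ C := fun x hx => hM x (by cases z <;> simp [cuts, hx])
    have h2 : ∀ x ∈ cuts s, x ∈ C := fun x hx => hM x (by cases z <;> simp [cuts, hx])
    have hs := hs pos h2 hpos
    cases z
    · have hc := hc .inside h1 (by simp)
      cases pos with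
      | inside =>
        simp only [splitted, List.mem_append]
        exact ⟨fun x hx => hx.elim (hs.1 x) (hc.1 x), fun t ht => ht.elim (hs.2 t) (hc.2 t)⟩
      | below u =>
        simp only [splitted, List.mem_append, List.mem_cons]
        refine ⟨hs.1, ?_⟩
        rintro t (ht | rfl | ht)
        · exact hs.2 t ht
        · intro x hx
          rcases List.mem_append.1 hx with hx | hx
          · exact hpos x (by simpa using hx)
          · exact hc.1 x hx
        · exact hc.2 t ht
    · have hv : v ∈ C := hM v (by simp [cuts])
      have hc := hc (.below (some v)) h1 (by simpa using hv)
      simp only [splitted, List.mem_append, List.mem_singleton]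
      exact ⟨fun x hx => hx.elim (hs.1 x) (fun h => h ▸ hv), fun t ht => ht.elim (hs.2 t) (hc.2 t)⟩

/-- Every cut vertex is adjacent from below to at most one of the subtrees. -/
theorem sum_border_le (pos : Position V) (M : Forest (V × Bool × Bool)) :
    ((splitted pos M).2.2.map fun t => t.border.length - 1).sum +
      (match pos with | .inside => (splitted pos M).2.1.length | .below _ => 0) ≤
      (cuts M).length := by
  induction M generalizing pos with
  | nil => cases pos <;> simp [splitted, cuts]
  | node a c s hc hs =>
    obtain ⟨v, b, _ | _⟩ := a
    · have hc := hc .inside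
      have hs := hs pos
      cases pos with
      | inside =>
        simp [splitted, cuts] at hc hs ⊢
        omega
      | below u =>
        -- The truncated `- 1` removes the cut vertex above the root. With `none` there is no such
        -- vertex, and it only weakens the inequality.
        cases u
        · simp [splitted, cuts] at hc hs ⊢
          omega
        · simp [splitted, cuts] at hc hs ⊢
          omega
    · have hc := hc (.below (some v))
      have hs := hs pos
      cases pos <;> simp [splitted, cuts] at hc hs ⊢ <;> omega

theorem length_requireds_splitted (ℓ : ℕ) (T : Forest (V × Bool)) :
    (requireds (splitted .inside (decomposed ℓ T).1).1).length = (decomposed ℓ T).2 := by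
  induction T with
  | nil => rfl
  | node a c s hc hs =>
    obtain ⟨v, b⟩ := a
    rw [decomposed]
    by_cases h : ℓ < if b then (decomposed ℓ c).2 + 1 else (decomposed ℓ c).2
    · rw [if_pos h]
      simpa [splitted] using hs
    · rw [if_neg h]
      simp only [splitted, length_requireds_node, hc, hs]
      split_ifs <;> omega

/-- The root of a subtree was not cut, so its count, which by `length_requireds_splitted` is the
required-size of the subtree, did not exceed `ℓ`. -/
theorem length_requireds_component_le (ℓ : ℕ) (pos : Position V) (T : Forest (V × Bool)) :
    ∀ t ∈ (splitted pos (decomposed ℓ T).1).2.2, (requireds t.tree).length ≤ ℓ := by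
  induction T generalizing pos with
  | nil => cases pos <;> simp [decomposed, splitted]
  | node a c s hc hs =>
    obtain ⟨v, b⟩ := a
    rw [decomposed]
    by_cases h : ℓ < if b then (decomposed ℓ c).2 + 1 else (decomposed ℓ c).2
    · rw [if_pos h]
      simp only [splitted, List.mem_append]
      exact fun t ht => ht.elim (hs pos t) (hc _ t)
    · rw [if_neg h]
      cases pos with
      | inside =>
        simp only [splitted, List.mem_append]
        exact fun t ht => ht.elim (hs _ t) (hc _ t)
      | below u =>
        simp only [splitted, List.mem_append, List.mem_cons]
        rintro t (ht | rfl | ht)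
        · exact hs _ t ht
        · have := length_requireds_splitted ℓ c
          rw [length_requireds_node, this]
          simp only [requireds, List.length_nil]
          split_ifs at h ⊢ <;> omega
        · exact hc _ t ht

end TreeSpanner

namespace TreeSpanner

variable {V : Type}

open Forest

/-! ### Monotone paths with few edges -/

/-- Adjacency in the graph with a given list of edges. -/
def Joined (E : List (V × V)) (x y : V) : Prop := (x, y) ∈ E ∨ (y, x) ∈ E

theorem Joined.mono {E E' : List (V × V)} (h : E ⊆ E') {x y : V} (hxy : Joined E x y) :
    Joined E' x y := hxy.imp (fun he => h he) (fun he => h he)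

/-- `q` has the same ends as `p`, and its vertices form a subsequence of `p`. -/
structure Shortens (q p : List V) : Prop where
  sublist : q.Sublist p
  head : q.head? = p.head?
  last : q.getLast? = p.getLast?

theorem Shortens.trans {p q r : List V} (h₁ : Shortens p q) (h₂ : Shortens q r) : Shortens p r :=
  ⟨h₁.sublist.trans h₂.sublist, h₁.head.trans h₂.head, h₁.last.trans h₂.last⟩

/-- Along every path between two vertices of `R` there is a path with edges in `E` that consists
of at most `k` edges. -/
def HasShortcuts (T : Forest (V × Bool)) (R : List V) (E : List (V × V)) (k : ℕ) : Prop :=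
  ∀ p, T.IsPathList p → ∀ u ∈ R, ∀ v ∈ R, p.head? = some u → p.getLast? = some v →
    ∃ q, Shortens q p ∧ q.IsChain (Joined E) ∧ q.length ≤ k + 1

theorem head?_eq_of_sublist {l l' : List V} {u : V} (hl : l.Nodup) (h : l'.Sublist l)
    (hu : l.head? = some u) (hu' : u ∈ l') : l'.head? = some u := by
  cases h with
  | slnil => simp at hu
  | cons a h =>
    simp at hu
    subst hu
    exact ((List.nodup_cons.1 hl).1 (h.subset hu')).elim
  | cons_cons a h => simpa using hu

theorem shortens_of_mem {l l' : List V} {u v : V} (hl : l.Nodup) (h : l'.Sublist l)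
    (hu : l.head? = some u) (hv : l.getLast? = some v) (hu' : u ∈ l') (hv' : v ∈ l') :
    Shortens l' l := by
  refine ⟨h, (head?_eq_of_sublist hl h hu hu').trans hu.symm, ?_⟩
  rw [hv, List.getLast?_eq_head?_reverse]
  exact head?_eq_of_sublist (List.nodup_reverse.2 hl) h.reverse
    (by rwa [List.head?_reverse]) (by simpa using hv')

/-- Required vertices survive pruning, so the restricted path keeps its ends, and a shortcut of it
is a shortcut of the original path. -/
theorem HasShortcuts.of_pruned {T : Forest (V × Bool)} (hT : T.verts.Nodup) {E : List (V × V)}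
    {k : ℕ} (h : HasShortcuts (pruned T) (requireds (pruned T)) E k) :
    HasShortcuts T (requireds T) E k := by
  intro p hp u hu v hv hpu hpv
  obtain ⟨p', h₁, h₂⟩ := hp.exists_pruned hT
  have hu' := (requireds_pruned T).mem_iff.2 hu
  have hv' := (requireds_pruned T).mem_iff.2 hv
  have h₃ : Shortens p' p := shortens_of_mem hp.nodup h₁.sublist hpu hpv
    (h₁.mem u (List.mem_of_mem_head? hpu) (mem_verts_of_mem_requireds hu'))
    (h₁.mem v (List.mem_of_getLast? hpv) (mem_verts_of_mem_requireds hv'))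
  obtain ⟨q, hq, hq', hq''⟩ := h p' h₂ u hu' v hv' (h₃.head.trans hpu) (h₃.last.trans hpv)
  exact ⟨q, hq.trans h₃, hq', hq''⟩

theorem HasShortcuts.of_recolored {M : Forest (V × Bool × Bool)} {E : List (V × V)}
    {k : ℕ} (h : HasShortcuts (recolored M) (requireds (recolored M)) E k) :
    HasShortcuts (unmarked M) (cuts M) E k := by
  rw [requireds_recolored] at h
  exact fun p hp => h p (isPathList_recolored hp)

theorem exists_first {P : V → Prop} {p : List V} (h : ∃ x ∈ p, P x) :
    ∃ p₁ x p₂, p = p₁ ++ x :: p₂ ∧ P x ∧ ∀ z ∈ p₁, ¬ P z := by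
  induction p with
  | nil => simp at h
  | cons a p ih =>
    by_cases ha : P a
    · exact ⟨[], a, p, rfl, ha, by simp⟩
    · obtain ⟨p₁, x, p₂, rfl, hx, hp⟩ := ih (by simpa [ha] using h)
      refine ⟨a :: p₁, x, p₂, rfl, hx, ?_⟩
      simpa [ha] using hp

theorem exists_first_last {P : V → Prop} {p : List V} (h : ∃ x ∈ p, P x) :
    ∃ p₁ m p₂ x y, p = p₁ ++ m ++ p₂ ∧ m.head? = some x ∧ m.getLast? = some y ∧ P x ∧ P y ∧
      (∀ z ∈ p₁, ¬ P z) ∧ ∀ z ∈ p₂, ¬ P z := by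
  obtain ⟨p₁, x, p₂, rfl, hx, h₁⟩ := exists_first h
  obtain ⟨r₁, y, r₂, hr, hy, h₂⟩ := exists_first (P := P) (p := (x :: p₂).reverse)
    ⟨x, by simp, hx⟩
  have hr : x :: p₂ = (r₂.reverse ++ [y]) ++ r₁.reverse := by
    rw [← List.reverse_reverse (x :: p₂), hr]
    simp
  refine ⟨p₁, r₂.reverse ++ [y], r₁.reverse, x, y, by rw [hr]; simp, ?_, by simp, hx, hy, h₁,
    by simpa using h₂⟩
  have : ((r₂.reverse ++ [y]) ++ r₁.reverse).head? = some x := by rw [← hr]; rfl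
  rw [← this]
  cases r₂.reverse <;> simp

theorem Forest.IsPathList.infix {T : Forest (V × Bool)} {p l : List V} (h : T.IsPathList p)
    (hl : l <:+: p) : T.IsPathList l :=
  ⟨hl.sublist.nodup h.nodup, fun x hx => h.mem x (hl.subset hx), h.chain.infix hl⟩

theorem Forest.IsPathList.reverse {T : Forest (V × Bool)} {p : List V} (h : T.IsPathList p) :
    T.IsPathList p.reverse :=
  ⟨List.nodup_reverse.2 h.nodup, fun x hx => h.mem x (List.mem_reverse.1 hx),
    isChain_reverse_linked.2 h.chain⟩

/-! ### The subtrees that remain after the removal of the cut vertices -/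

/-- The subtrees obtained from `T` by removing the cut vertices. -/
def components (ℓ : ℕ) (T : Forest (V × Bool)) : List (Component V) :=
  (splitted (.below none) (decomposed ℓ T).1).2.2

/-- The cut vertices of `T`. -/
def cutSet (ℓ : ℕ) (T : Forest (V × Bool)) : List V := cuts (decomposed ℓ T).1

theorem labels_components (ℓ : ℕ) (T : Forest (V × Bool)) :
    ((components ℓ T).flatMap (·.tree.labels)).Perm
      (((decomposed ℓ T).1.labels.filter fun a => !a.2.2).map fun a => (a.1, a.2.1)) := by
  simpa [components, splitted_below_fst, labels] using labels_splitted (.below none) (decomposed ℓ T).1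

theorem labels_components_sublist (ℓ : ℕ) (T : Forest (V × Bool)) :
    (((decomposed ℓ T).1.labels.filter fun a => !a.2.2).map fun a => (a.1, a.2.1)).Sublist
      T.labels := by
  conv_rhs => rw [← unmarked_decomposed ℓ T, unmarked, labels_map]
  exact List.filter_sublist.map _

theorem mem_labels_of_component {ℓ : ℕ} {T : Forest (V × Bool)} {t : Component V}
    (ht : t ∈ components ℓ T) {a : V × Bool} (ha : a ∈ t.tree.labels) : a ∈ T.labels :=
  (labels_components_sublist ℓ T).subset ((labels_components ℓ T).subset
    (List.mem_flatMap.2 ⟨t, ht, ha⟩))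

theorem mem_verts_of_component {ℓ : ℕ} {T : Forest (V × Bool)} {t : Component V}
    (ht : t ∈ components ℓ T) {x : V} (hx : x ∈ t.tree.verts) : x ∈ T.verts := by
  obtain ⟨a, ha, rfl⟩ := List.mem_map.1 hx
  exact List.mem_map_of_mem (mem_labels_of_component ht ha)

theorem sum_countP_components_le (ℓ : ℕ) (T : Forest (V × Bool)) (f : V × Bool → Bool) :
    ((components ℓ T).map fun t => t.tree.labels.countP f).sum ≤ T.labels.countP f := by
  have h1 := (labels_components_sublist ℓ T).countP_le (p := f)
  rw [← (labels_components ℓ T).countP_eq, List.countP_flatMap] at h1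
  exact h1

theorem sum_length_requireds_components_le (ℓ : ℕ) (T : Forest (V × Bool)) :
    ((components ℓ T).map fun t => (requireds t.tree).length).sum ≤ (requireds T).length := by
  simpa only [length_requireds_eq_countP] using sum_countP_components_le ℓ T (·.2)

theorem sum_size_components_le (ℓ : ℕ) (T : Forest (V × Bool)) :
    ((components ℓ T).map fun t => t.tree.size).sum ≤ T.size := by
  simpa [length_labels] using sum_countP_components_le ℓ T (fun _ => true)

theorem one_le_size_splitted (pos : Position V) (M : Forest (V × Bool × Bool)) :
    ∀ t ∈ (splitted pos M).2.2, 1 ≤ t.tree.size := by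
  induction M generalizing pos with
  | nil => cases pos <;> simp [splitted]
  | node a c s hc hs =>
    obtain ⟨v, b, _ | _⟩ := a
    · cases pos with
      | inside =>
        simp only [splitted, List.mem_append]
        exact fun t ht => ht.elim (hs _ t) (hc _ t)
      | below u =>
        simp only [splitted, List.mem_append, List.mem_cons]
        rintro t (ht | rfl | ht)
        · exact hs _ t ht
        · simp [size]
        · exact hc _ t ht
    · simp only [splitted, List.mem_append]
      exact fun t ht => ht.elim (hs _ t) (hc _ t)

theorem length_components_le (ℓ : ℕ) (T : Forest (V × Bool)) :
    (components ℓ T).length ≤ T.size := by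
  have h := List.sum_le_sum (l := components ℓ T) (f := fun _ => 1) (g := fun t => t.tree.size)
    (one_le_size_splitted _ _)
  rw [List.map_const', List.sum_replicate, smul_eq_mul, mul_one] at h
  exact h.trans (sum_size_components_le ℓ T)

theorem mul_length_cutSet_le (ℓ : ℕ) (T : Forest (V × Bool)) :
    (ℓ + 1) * (cutSet ℓ T).length ≤ (requireds T).length :=
  (Nat.le_add_right _ _).trans (mul_length_cuts_add_le ℓ T)

/-- The number of edges between subtrees and their borders. -/
theorem sum_border_components_le (ℓ : ℕ) (T : Forest (V × Bool)) :
    ((components ℓ T).map fun t => (requireds t.tree).length * t.border.length).sum ≤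
      2 * (requireds T).length := by
  -- One border vertex is charged to the required vertices themselves, each further one costs at
  -- most `ℓ`; the sums are at most `n` and `ℓ * |CV| ≤ n`.
  have h1 : ((components ℓ T).map fun t => (requireds t.tree).length * t.border.length).sum ≤
      ((components ℓ T).map fun t =>
        (requireds t.tree).length + ℓ * (t.border.length - 1)).sum := by
    refine List.sum_le_sum fun t ht => ?_
    have := length_requireds_component_le ℓ (.below none) T t ht
    rcases Nat.eq_zero_or_pos t.border.length with h | h
    · simp [h]
    · obtain ⟨b, hb⟩ := Nat.exists_eq_add_of_le' h
      rw [hb, Nat.add_sub_cancel]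
      nlinarith
  rw [List.sum_map_add, List.sum_map_mul_left] at h1
  have h2 := sum_length_requireds_components_le ℓ T
  have h3 : ((components ℓ T).map fun t => t.border.length - 1).sum ≤ (cutSet ℓ T).length :=
    sum_border_le (.below none) (decomposed ℓ T).1
  have h4 := mul_length_cutSet_le ℓ T
  nlinarith [Nat.mul_le_mul_left ℓ h3]

section Components

variable {ℓ : ℕ} {T : Forest (V × Bool)}

theorem exists_isMarkedBy_decomposed (hT : T.verts.Nodup) (ℓ : ℕ) : ∃ cut : V → Bool,
    IsMarkedBy (decomposed ℓ T).1 cut ∧ ∀ x, x ∈ cutSet ℓ T ↔ cut x = true :=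
  exists_isMarkedBy (by rwa [unmarked_decomposed])

theorem mem_verts_of_mem_cutSet {x : V} (hx : x ∈ cutSet ℓ T) : x ∈ T.verts := by
  rw [cutSet, ← requireds_recolored] at hx
  have := mem_verts_of_mem_requireds hx
  rwa [verts_recolored, unmarked_decomposed] at this

theorem notMem_cutSet_of_component (hT : T.verts.Nodup) {t : Component V}
    (ht : t ∈ components ℓ T) {x : V} (hx : x ∈ t.tree.verts) : x ∉ cutSet ℓ T := by
  obtain ⟨cut, h1, h2⟩ := exists_isMarkedBy_decomposed hT ℓ
  obtain ⟨a, ha, rfl⟩ := List.mem_map.1 hx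
  have := (labels_components ℓ T).subset (List.mem_flatMap.2 ⟨t, ht, ha⟩)
  simp only [List.mem_map, List.mem_filter] at this
  obtain ⟨b, ⟨hb, hb'⟩, rfl⟩ := this
  rw [h2, ← h1 b hb]
  simpa using hb'

theorem exists_component (hT : T.verts.Nodup) {x : V} (hx : x ∈ T.verts) (hx' : x ∉ cutSet ℓ T) :
    ∃ t ∈ components ℓ T, x ∈ t.tree.verts := by
  obtain ⟨cut, h1, h2⟩ := exists_isMarkedBy_decomposed hT ℓ
  rw [← unmarked_decomposed ℓ T, unmarked, verts, labels_map, List.map_map] at hx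
  obtain ⟨a, ha, rfl⟩ := List.mem_map.1 hx
  have h3 : (a.1, a.2.1) ∈ (components ℓ T).flatMap (·.tree.labels) := by
    refine (labels_components ℓ T).mem_iff.2 (List.mem_map.2 ⟨a, List.mem_filter.2 ⟨ha, ?_⟩, rfl⟩)
    rw [h1 a ha]
    simpa [h2] using hx'
  obtain ⟨t, ht, h⟩ := List.mem_flatMap.1 h3
  exact ⟨t, ht, List.mem_map.2 ⟨_, h, rfl⟩⟩

theorem nodup_components (hT : T.verts.Nodup) :
    ((components ℓ T).flatMap (·.tree.verts)).Nodup := by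
  have h1 := (((labels_components ℓ T).map Prod.fst).nodup_iff).2
    (((labels_components_sublist ℓ T).map Prod.fst).nodup hT)
  rwa [List.map_flatMap] at h1

theorem nodup_component (hT : T.verts.Nodup) {t : Component V} (ht : t ∈ components ℓ T) :
    t.tree.verts.Nodup :=
  (List.nodup_flatMap.1 (nodup_components hT)).1 t ht

theorem component_unique (hT : T.verts.Nodup) {t t' : Component V} (ht : t ∈ components ℓ T)
    (ht' : t' ∈ components ℓ T) {x : V} (hx : x ∈ t.tree.verts) (hx' : x ∈ t'.tree.verts) :
    t = t' := by
  by_contra hne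
  have : Std.Symm (Function.onFun List.Disjoint fun t : Component V => t.tree.verts) :=
    ⟨fun _ _ h => List.Disjoint.symm h⟩
  exact (List.nodup_flatMap.1 (nodup_components hT)).2.forall ht ht' hne hx hx'

theorem linked_component (hT : T.verts.Nodup) {t : Component V} (ht : t ∈ components ℓ T) {x y : V}
    (h : T.Linked x y) (hy : y ∉ cutSet ℓ T) (hx : x ∈ t.tree.verts) :
    y ∈ t.tree.verts ∧ t.tree.Linked x y := by
  obtain ⟨cut, h1, h2⟩ := exists_isMarkedBy_decomposed hT ℓ
  have cx : cut x = false := by simpa [h2] using notMem_cutSet_of_component hT ht hx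
  have cy : cut y = false := by simpa [h2] using hy
  rw [← unmarked_decomposed ℓ T] at h
  suffices h : t.tree.Linked x y from ⟨h.mem.2, h⟩
  rcases h with h | h
  · have h' := exists_component_of_isChild h1 (.below none) h cx cy
    rw [splitted_below_fst] at h'
    obtain ⟨t', ht', h'⟩ := h'.resolve_left id
    rw [component_unique hT ht ht' hx h'.mem.1]
    exact Or.inl h'
  · have h' := exists_component_of_isChild h1 (.below none) h cy cx
    rw [splitted_below_fst] at h'
    obtain ⟨t', ht', h'⟩ := h'.resolve_left id
    rw [component_unique hT ht ht' hx h'.mem.2]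
    exact Or.inr h'

theorem mem_border_of_linked (hT : T.verts.Nodup) {t : Component V} (ht : t ∈ components ℓ T)
    {x y : V} (h : T.Linked x y) (hy : y ∈ cutSet ℓ T) (hx : x ∈ t.tree.verts) :
    y ∈ t.border := by
  obtain ⟨cut, h1, h2⟩ := exists_isMarkedBy_decomposed hT ℓ
  have cx : cut x = false := by simpa [h2] using notMem_cutSet_of_component hT ht hx
  have cy : cut y = true := by simpa [h2] using hy
  rw [← unmarked_decomposed ℓ T] at h
  rcases h with h | h
  · have h' := exists_component_of_child_cut h1 (.below none) h cx cy
    rw [splitted_below_fst] at h'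
    obtain ⟨t', ht', hx', h'⟩ := h'.resolve_left (fun h => by simpa using h.1)
    rwa [component_unique hT ht ht' hx hx']
  · obtain ⟨t', ht', hx', h'⟩ := exists_component_of_parent_cut h1 (.below none) h cy cx
    rwa [component_unique hT ht ht' hx hx']

theorem mem_cutSet_of_mem_border {t : Component V} (ht : t ∈ components ℓ T) {x : V}
    (hx : x ∈ t.border) : x ∈ cutSet ℓ T :=
  (border_splitted_subset {x | x ∈ cutSet ℓ T} (.below none) _ (fun _ h => h) (by simp)).2 t ht x hx

theorem exists_component_of_isPathList (hT : T.verts.Nodup) {p : List V} (hp : T.IsPathList p)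
    (hne : p ≠ []) (hc : ∀ x ∈ p, x ∉ cutSet ℓ T) : ∃ t ∈ components ℓ T, t.tree.IsPathList p := by
  cases p with
  | nil => exact (hne rfl).elim
  | cons x l =>
    obtain ⟨t, ht, hx⟩ := exists_component hT (hp.mem x (by simp)) (hc x (by simp))
    have := isChain_of_closed (Q := fun y => y ∉ cutSet ℓ T)
      (fun _ _ => linked_component hT ht) l x hp.chain (fun y hy => hc y (by simp [hy])) hx
    exact ⟨t, ht, hp.nodup, this.1, this.2⟩

theorem mem_requireds_component (hT : T.verts.Nodup) {t : Component V} (ht : t ∈ components ℓ T)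
    {x : V} (hx : x ∈ t.tree.verts) (hx' : x ∈ requireds T) : x ∈ requireds t.tree := by
  obtain ⟨⟨v, b⟩, ha, rfl⟩ := List.mem_map.1 hx
  have := label_unique hT (mem_labels_of_component ht ha) (mem_requireds.1 hx')
  subst this
  exact mem_requireds.2 ha

theorem mem_crossPairs {B l : List V} {e : V × V} :
    e ∈ crossPairs B l ↔ e.1 ∈ B ∧ e.2 ∈ l := by
  induction l with
  | nil => simp [crossPairs]
  | cons v l ih =>
    obtain ⟨x, y⟩ := e
    simp only [crossPairs, List.mem_append, ih, List.mem_reverse, List.mem_map, List.mem_cons,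
      Prod.mk.injEq]
    constructor
    · rintro (⟨h, h'⟩ | ⟨u, hu, rfl, rfl⟩)
      · exact ⟨h, Or.inr h'⟩
      · exact ⟨hu, Or.inl rfl⟩
    · rintro ⟨h, rfl | h'⟩
      · exact Or.inr ⟨x, h, rfl, rfl⟩
      · exact Or.inl ⟨h, h'⟩

theorem mem_borderPairs {L : List (Component V)} {e : V × V} :
    e ∈ borderPairs L ↔ ∃ t ∈ L, e.1 ∈ t.border ∧ e.2 ∈ requireds t.tree := by
  induction L with
  | nil => simp [borderPairs]
  | cons t L ih => simp [borderPairs, ih, mem_crossPairs, or_comm]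

/-- The first required vertex of a path is joined to the first cut vertex. -/
theorem joined_of_isPathList (hT : T.verts.Nodup) {l : List V} {u x : V}
    (hp : T.IsPathList (l ++ [x])) (hu : l.head? = some u) (hur : u ∈ requireds T)
    (hl : ∀ z ∈ l, z ∉ cutSet ℓ T) (hx : x ∈ cutSet ℓ T) :
    Joined (borderPairs (components ℓ T)) u x := by
  have hne : l ≠ [] := by rintro rfl; simp at hu
  obtain ⟨t, ht, hpt⟩ := exists_component_of_isPathList hT
    (hp.infix (List.prefix_append l [x]).isInfix) hne hl
  refine Or.inr (mem_borderPairs.2 ⟨t, ht, ?_, mem_requireds_component hT ht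
    (hpt.mem u (List.mem_of_mem_head? hu)) hur⟩)
  have := (List.isChain_append.1 hp.chain).2.2 (l.getLast hne) (by simp [List.getLast?_eq_some_getLast hne]) x
    (by simp)
  exact mem_border_of_linked hT ht this hx (hpt.mem _ (List.getLast_mem hne))

/-- The options cover the case that an end of the path is itself a cut vertex; then no border edge
is used on that side. -/
theorem Shortens.cons_append {q m p₁ p₂ : List V} (h : Shortens q m) (hm : m ≠ []) :
    Shortens (p₁.head?.toList ++ q ++ p₂.getLast?.toList) (p₁ ++ m ++ p₂) := by
  have hq : q ≠ [] := by
    rintro rfl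
    have := h.head
    cases m <;> simp at *
  refine ⟨?_, ?_, ?_⟩
  · refine List.Sublist.append (List.Sublist.append ?_ h.sublist) ?_
    · cases p₁ <;> simp
    · rcases List.eq_nil_or_concat p₂ with rfl | ⟨l, b, rfl⟩ <;> simp
  · have := h.head
    cases p₁ <;> cases q <;> cases m <;> simp_all
  · have := h.last
    rcases List.eq_nil_or_concat p₂ with rfl | ⟨l, b, rfl⟩
    · simp [List.getLast?_append, this]
      cases hm' : m.getLast? with
      | none => simp_all
      | some _ => rfl
    · simp [List.getLast?_append]

/-- The combination of the edges between cut vertices, the edges between cut vertices and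
subtrees, and the edges within the subtrees. -/
theorem HasShortcuts.combine (hT : T.verts.Nodup) {E E' : List (V × V)} {k : ℕ}
    (hE' : E' ⊆ E) (hcut : HasShortcuts T (cutSet ℓ T) E' k)
    (hborder : borderPairs (components ℓ T) ⊆ E)
    (hcomp : ∀ t ∈ components ℓ T, ∃ F ⊆ E, HasShortcuts t.tree (requireds t.tree) F (k + 2)) :
    HasShortcuts T (requireds T) E (k + 2) := by
  intro p hp u hu v hv hpu hpv
  by_cases hc : ∃ x ∈ p, x ∈ cutSet ℓ T
  -- `x` and `y` are the first and the last cut vertex on the path; `p₁` and `p₂` avoid the cut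
  -- vertices, so each lies in one subtree.
  · obtain ⟨p₁, m, p₂, x, y, rfl, hmx, hmy, hx, hy, h₁, h₂⟩ := exists_first_last hc
    obtain ⟨q, hq, hq', hq''⟩ := hcut m (hp.infix ⟨p₁, p₂, rfl⟩) x hx y hy hmx hmy
    have hm : m ≠ [] := by rintro rfl; simp at hmx
    refine ⟨_, hq.cons_append hm, ?_, ?_⟩
    · have e₁ : ∀ w ∈ p₁.head?, Joined E w x := by
        intro w hw
        obtain ⟨m', rfl⟩ : ∃ m', m = x :: m' := by
          cases m with
          | nil => simp at hmx
          | cons z m' => simp at hmx; exact ⟨m', by rw [hmx]⟩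
        have hw' : p₁.head? = some w := hw
        have : w = u := by
          rw [List.append_assoc, List.head?_append, hw'] at hpu
          simpa using hpu
        subst this
        exact (joined_of_isPathList hT (hp.infix ⟨[], m' ++ p₂, by simp⟩) hw' hu h₁ hx).mono hborder
      have e₂ : ∀ w ∈ p₂.getLast?, Joined E w y := by
        intro w hw
        obtain ⟨m', rfl⟩ : ∃ m', m = m' ++ [y] := by
          rcases List.eq_nil_or_concat m with rfl | ⟨m', z, rfl⟩
          · simp at hmx
          · simp at hmy; exact ⟨m', by rw [hmy]; simp⟩
        have hw' : p₂.getLast? = some w := hw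
        have : w = v := by
          rw [List.getLast?_append, hw'] at hpv
          simpa using hpv
        subst this
        refine (joined_of_isPathList (l := p₂.reverse) hT ?_ (by rwa [List.head?_reverse]) hv
          (by simpa using h₂) hy).mono hborder
        have := (hp.infix (l := y :: p₂) ⟨p₁ ++ m', [], by simp⟩).reverse
        simpa using this
      refine List.IsChain.append (List.IsChain.append ?_ (hq'.imp fun _ _ h => h.mono hE') ?_) ?_ ?_
      · cases p₁.head? <;> simp
      · intro w hw z hz
        rw [hq.head, hmx] at hz
        obtain rfl : x = z := by simpa using hz
        exact e₁ w (by cases h : p₁.head? <;> simp_all)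
      · cases p₂.getLast? <;> simp
      · intro z hz w hw
        rw [List.getLast?_append, hq.last, hmy] at hz
        obtain rfl : y = z := by simpa using hz
        have := e₂ w (by cases h : p₂.getLast? <;> simp_all)
        exact Or.symm this
    · have : p₁.head?.toList.length ≤ 1 := by cases p₁.head? <;> simp
      have : p₂.getLast?.toList.length ≤ 1 := by cases p₂.getLast? <;> simp
      simp only [List.length_append]
      omega
  · have hne : p ≠ [] := by rintro rfl; simp at hpu
    obtain ⟨t, ht, hpt⟩ := exists_component_of_isPathList (ℓ := ℓ) hT hp hne
      (fun x hx hx' => hc ⟨x, hx, hx'⟩)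
    obtain ⟨F, hF, h⟩ := hcomp t ht
    obtain ⟨q, hq, hq', hq''⟩ := h p hpt u
      (mem_requireds_component hT ht (hpt.mem u (List.mem_of_mem_head? hpu)) hu) v
      (mem_requireds_component hT ht (hpt.mem v (List.mem_of_getLast? hpv)) hv) hpu hpv
    exact ⟨q, hq, hq'.imp fun _ _ h => h.mono hF, hq''⟩

end Components

end TreeSpanner

namespace TreeSpanner

variable {V : Type}

open Forest

/-! ### Numbers of edges and steps -/

theorem mem_parentEdges {p : Option V} {T : Forest (V × Bool)} {x y : V} :
    (x, y) ∈ parentEdges p T ↔ (p = some x ∧ y ∈ T.roots.map Prod.fst) ∨ T.IsChild x y := by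
  induction T generalizing p with
  | nil => simp [parentEdges, roots, IsChild]
  | node a c s hc hs =>
    obtain ⟨v, b⟩ := a
    simp only [parentEdges, List.mem_append, hc, hs, roots, List.map_cons, List.mem_cons, IsChild,
      List.mem_map, Option.mem_toList, Prod.mk.injEq, Option.some.injEq]
    constructor
    · rintro (⟨w, rfl, rfl, rfl⟩ | (⟨rfl, h⟩ | h) | (⟨rfl, h⟩ | h))
      · exact Or.inl ⟨rfl, Or.inl rfl⟩
      · exact Or.inl ⟨rfl, Or.inr h⟩
      · exact Or.inr (Or.inr (Or.inr h))
      · exact Or.inr (Or.inl ⟨rfl, h⟩)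
      · exact Or.inr (Or.inr (Or.inl h))
    · rintro (⟨rfl, rfl | h⟩ | ⟨rfl, h⟩ | h | h)
      · exact Or.inl ⟨x, rfl, rfl, rfl⟩
      · exact Or.inr (Or.inl (Or.inl ⟨rfl, h⟩))
      · exact Or.inr (Or.inr (Or.inl ⟨rfl, h⟩))
      · exact Or.inr (Or.inr (Or.inr h))
      · exact Or.inr (Or.inl (Or.inr h))

theorem length_parentEdges_some (v : V) (T : Forest (V × Bool)) :
    (parentEdges (some v) T).length = T.size := by
  induction T generalizing v with
  | nil => rfl
  | node a c s hc hs => simp [parentEdges, size, hc, hs]; omega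

theorem length_parentEdges_none (T : Forest (V × Bool)) :
    (parentEdges none T).length + T.roots.length = T.size := by
  induction T with
  | nil => rfl
  | node a c s hc hs => simp [parentEdges, size, length_parentEdges_some, roots]; omega

theorem length_crossPairs (B l : List V) :
    (crossPairs B l).length = l.length * B.length := by
  induction l with
  | nil => simp [crossPairs]
  | cons v l ih => simp [crossPairs, ih]; ring

theorem length_borderPairs (L : List (Component V)) : (borderPairs L).length =
    (L.map fun t => (requireds t.tree).length * t.border.length).sum := by
  induction L with
  | nil => rfl
  | cons t L ih => simp [borderPairs, ih, length_crossPairs]; omega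

theorem borderCost_eq (L : List (Component V)) : borderCost L = 1 + 3 * L.length +
    2 * (L.map fun t => t.tree.size).sum + 2 * (L.map fun t => (requireds t.tree).length).sum +
    (L.map fun t => (requireds t.tree).length * t.border.length).sum := by
  induction L with
  | nil => rfl
  | cons t L ih => simp [borderCost, ih]; ring

theorem length_completePairs_le (l : List V) :
    (completePairs l).length ≤ l.length * l.length := by
  induction l with
  | nil => simp [completePairs]
  | cons v l ih => simp [completePairs]; nlinarith

theorem mem_of_mem_completePairs {l : List V} (hl : l.Nodup) {e : V × V}
    (he : e ∈ completePairs l) : e.1 ∈ l ∧ e.2 ∈ l ∧ e.1 ≠ e.2 := by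
  induction l with
  | nil => simp [completePairs] at he
  | cons v l ih =>
    rw [List.nodup_cons] at hl
    simp only [completePairs, List.mem_append, List.mem_reverse, List.mem_map] at he
    rcases he with he | ⟨u, hu, rfl⟩
    · have := ih hl.2 he
      exact ⟨by simp [this.1], by simp [this.2.1], this.2.2⟩
    · refine ⟨by simp [hu], by simp, ?_⟩
      intro (h : u = v)
      exact hl.1 (h ▸ hu)

theorem joined_completePairs {l : List V} {x y : V} (hx : x ∈ l) (hy : y ∈ l) (h : x ≠ y) :
    Joined (completePairs l) x y := by
  induction l with
  | nil => simp at hx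
  | cons v l ih =>
    simp only [Joined, completePairs, List.mem_append, List.mem_reverse, List.mem_map,
      Prod.mk.injEq]
    rcases List.mem_cons.1 hx with rfl | hx'
    · rcases List.mem_cons.1 hy with rfl | hy'
      · exact (h rfl).elim
      · exact Or.inr (Or.inr ⟨y, hy', rfl, rfl⟩)
    · rcases List.mem_cons.1 hy with rfl | hy'
      · exact Or.inl (Or.inr ⟨x, hx', rfl, rfl⟩)
      · exact (ih hx' hy').imp Or.inl Or.inl

/-- The endpoints of the edges in `E` are distinct vertices of `T`. -/
def EdgesIn (T : Forest (V × Bool)) (E : List (V × V)) : Prop :=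
  ∀ e ∈ E, e.1 ∈ T.verts ∧ e.2 ∈ T.verts ∧ e.1 ≠ e.2

theorem edgesIn_parentEdges {T : Forest (V × Bool)} (hT : T.verts.Nodup) :
    EdgesIn T (parentEdges none T) := by
  rintro ⟨x, y⟩ h
  have h : T.IsChild x y := by simpa [mem_parentEdges] using h
  exact ⟨h.mem.1, h.mem.2, h.ne hT⟩

theorem edgesIn_borderPairs {T : Forest (V × Bool)} (hT : T.verts.Nodup) (ℓ : ℕ) :
    EdgesIn T (borderPairs (components ℓ T)) := by
  rintro ⟨x, y⟩ h
  obtain ⟨t, ht, hx, hy⟩ := mem_borderPairs.1 h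
  have hx := mem_cutSet_of_mem_border ht hx
  have hy := mem_verts_of_mem_requireds hy
  refine ⟨mem_verts_of_mem_cutSet hx, mem_verts_of_component ht hy, ?_⟩
  intro (h : x = y)
  subst h
  exact notMem_cutSet_of_component hT ht hy hx

theorem EdgesIn.append {T : Forest (V × Bool)} {E F : List (V × V)} (hE : EdgesIn T E)
    (hF : EdgesIn T F) : EdgesIn T (E ++ F) :=
  fun e he => (List.mem_append.1 he).elim (hE e) (hF e)

theorem EdgesIn.of_subset {T T' : Forest (V × Bool)} {E : List (V × V)} (hE : EdgesIn T E)
    (h : T.verts ⊆ T'.verts) : EdgesIn T' E :=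
  fun e he => ⟨h (hE e he).1, h (hE e he).2.1, (hE e he).2.2⟩

/-! ### Short trees -/

theorem isChain_joined_parentEdges {T : Forest (V × Bool)} {p : List V} (hp : T.IsPathList p) :
    p.IsChain (Joined (parentEdges none T)) :=
  hp.chain.imp fun _ _ h => h.imp (fun h => mem_parentEdges.2 (Or.inr h))
    (fun h => mem_parentEdges.2 (Or.inr h))

theorem hasShortcuts_of_le {T : Forest (V × Bool)} (hT : T.verts.Nodup) (hT' : T.IsReduced) {k : ℕ}
    (hk : (requireds T).length ≤ k) : HasShortcuts T (requireds T) (parentEdges none T) k := by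
  intro p hp u _ v _ hpu _
  refine ⟨p, ⟨List.Sublist.refl _, rfl, rfl⟩, isChain_joined_parentEdges hp, ?_⟩
  have hne : p ≠ [] := by rintro rfl; simp at hpu
  have h1 := (hp.isBend hT).length_add_roots_le hT' hne
  have h2 : 1 ≤ T.roots.length := by
    by_contra h0
    obtain rfl := eq_nil_of_roots (T := T) (by omega)
    exact hne (hp.isBend hT)
  omega

theorem hasShortcuts_of_ne {T : Forest (V × Bool)} (hT : T.verts.Nodup) (hT' : T.IsReduced) {k : ℕ}
    (hk : (requireds T).length = k + 1)
    (hne : ∀ a c₁ d₁ c₂ d₂, T ≠ .node a (.node c₁ d₁ (.node c₂ d₂ .nil)) .nil) :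
    HasShortcuts T (requireds T) (parentEdges none T) k := by
  intro p hp u _ v _ _ _
  refine ⟨p, ⟨List.Sublist.refl _, rfl, rfl⟩, isChain_joined_parentEdges hp, ?_⟩
  by_contra hlt
  obtain ⟨a, c₁, d₁, c₂, d₂, -, -, h, -⟩ := (hp.isBend hT).exists_of_length hT' (by omega)
  exact hne a c₁ d₁ c₂ d₂ h

theorem Forest.IsDown.head?_eq {a : V × Bool} {d : Forest (V × Bool)} {l : List V}
    (h : (node a d nil).IsDown l) (hl : l ≠ []) : l.head? = some a.1 := by
  rcases h with ⟨l', rfl, -⟩ | h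
  · rfl
  · exact (hl h).elim

theorem Forest.IsFork.heads {c₁ c₂ : V × Bool} {d₁ d₂ : Forest (V × Bool)} {l₁ l₂ : List V}
    (h : (node c₁ d₁ (node c₂ d₂ nil)).IsFork l₁ l₂) (h₁ : l₁ ≠ []) (h₂ : l₂ ≠ []) :
    (l₁.head? = some c₁.1 ∧ l₂.head? = some c₂.1) ∨
      (l₁.head? = some c₂.1 ∧ l₂.head? = some c₁.1) := by
  rcases h with ⟨l', rfl, h, h'⟩ | ⟨l', rfl, h, h'⟩ | h
  · exact Or.inl ⟨rfl, h'.head?_eq h₂⟩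
  · exact Or.inr ⟨h'.head?_eq h₁, rfl⟩
  · exact ((h.eq_nil (by simp [roots])).elim h₁ h₂).elim

/-- The only paths that are too long bend at the root, and there the additional edge saves one
vertex. -/
theorem hasShortcuts_two_children {T : Forest (V × Bool)} {a c₁ c₂ : V × Bool}
    {d₁ d₂ : Forest (V × Bool)} (e : T = .node a (.node c₁ d₁ (.node c₂ d₂ .nil)) .nil)
    (hT : T.verts.Nodup) (hT' : T.IsReduced) {k : ℕ} (hk : (requireds T).length = k + 1) :
    HasShortcuts T (requireds T) (parentEdges none T ++ [(c₁.1, c₂.1)]) k := by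
  intro p hp u _ v _ _ _
  have hE : p.IsChain (Joined (parentEdges none T ++ [(c₁.1, c₂.1)])) :=
    (isChain_joined_parentEdges hp).imp fun _ _ h => h.mono (List.subset_append_left _ _)
  by_cases hlt : p.length ≤ k + 1
  · exact ⟨p, ⟨List.Sublist.refl _, rfl, rfl⟩, hE, hlt⟩
  obtain ⟨a', c₁', d₁', c₂', d₂', l₁, l₂, h, hf, h₁, h₂, rfl, hlen⟩ :=
    (hp.isBend hT).exists_of_length hT' (by omega)
  rw [e] at h
  injection h with ha hc _
  injection hc with hc₁ hd₁ hc
  injection hc with hc₂ hd₂ _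
  subst ha hc₁ hd₁ hc₂ hd₂
  have hr : l₁.reverse ≠ [] := by simpa using h₁
  refine ⟨l₁.reverse ++ l₂, ⟨?_, ?_, ?_⟩, ?_, ?_⟩
  · exact (List.sublist_cons_self _ _).append_left _
  · rw [List.head?_append_of_ne_nil _ hr, List.head?_append_of_ne_nil _ hr]
  · rw [List.getLast?_append_of_ne_nil _ h₂, List.getLast?_append_of_ne_nil _ (by simp),
      List.getLast?_cons_of_ne_nil h₂]
  · have h3 := List.isChain_append.1 hE
    refine List.isChain_append.2 ⟨h3.1, (List.isChain_cons.1 h3.2.1).2, ?_⟩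
    intro x hx y hy
    rw [List.getLast?_reverse] at hx
    rcases hf.heads h₁ h₂ with ⟨h4, h5⟩ | ⟨h4, h5⟩
    · rw [h4] at hx
      rw [h5] at hy
      obtain rfl : c₁.1 = x := by simpa using hx
      obtain rfl : c₂.1 = y := by simpa using hy
      exact Or.inl (by simp)
    · rw [h4] at hx
      rw [h5] at hy
      obtain rfl : c₂.1 = x := by simpa using hx
      obtain rfl : c₁.1 = y := by simpa using hy
      exact Or.inr (by simp)
  · simpa using hlen.trans hk.le

theorem hasShortcuts_of_length_le_one {T : Forest (V × Bool)} {R : List V} (hR : R.length ≤ 1)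
    (E : List (V × V)) : HasShortcuts T R E 0 := by
  intro p hp u hu v hv hpu hpv
  obtain rfl : u = v := by
    match R with
    | [] => simp at hu
    | [x] => simp at hu hv; rw [hu, hv]
    | x :: y :: l => simp at hR
  refine ⟨[u], shortens_of_mem hp.nodup ?_ hpu hpv (by simp) (by simp), by simp, by simp⟩
  simpa using List.mem_of_mem_head? hpu

theorem hasShortcuts_completePairs (T : Forest (V × Bool)) (R : List V) :
    HasShortcuts T R (completePairs R) 1 := by
  intro p hp u hu v hv hpu hpv
  by_cases h : u = v
  · subst h
    refine ⟨[u], shortens_of_mem hp.nodup ?_ hpu hpv (by simp) (by simp), by simp, by simp⟩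
    simpa using List.mem_of_mem_head? hpu
  · refine ⟨[u, v], shortens_of_mem hp.nodup ?_ hpu hpv (by simp) (by simp), ?_, by simp⟩
    · cases p with
      | nil => simp at hpu
      | cons x p =>
        obtain rfl : x = u := by simpa using hpu
        have := List.mem_of_getLast? hpv
        rw [List.mem_cons] at this
        have := this.resolve_left (Ne.symm h)
        simpa using this
    · simpa using joined_completePairs hu hv h

end TreeSpanner

namespace TreeSpanner

variable {V : Type}

open Forest

/-! ### The algorithm -/

/-- The edges between the cut vertices that `tree1Spanner` adds, put in front of `acc`. -/
def innerEdges (d k : ℕ) (M : Forest (V × Bool × Bool)) (acc : List (V × V)) :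
    Alg (List (V × V)) :=
  if k = 2 then pure acc
  else if k = 3 then cutVertices M [] >>= fun cv => completeEdges cv acc
  else recolor M >>= fun τ => prune τ >>= fun τ' => cutVertices M [] >>= fun cv =>
    count cv >>= fun m => tree1Spanner d τ' m (k - 2) acc

theorem tree1Spanner_of_le (d : ℕ) (T : Forest (V × Bool)) {n k : ℕ} (acc : List (V × V))
    (h : n ≤ k) : tree1Spanner (d + 1) T n k acc = tick >>= fun _ => treeEdges none T acc := by
  unfold tree1Spanner
  simp only [if_pos h]

theorem tree1Spanner_two_children (d : ℕ) (a c₁ c₂ : V × Bool) (d₁ d₂ : Forest (V × Bool)) {k : ℕ}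
    (acc : List (V × V)) :
    tree1Spanner (d + 1) (.node a (.node c₁ d₁ (.node c₂ d₂ .nil)) .nil) (k + 1) k acc =
      tick >>= fun _ => treeEdges none (.node a (.node c₁ d₁ (.node c₂ d₂ .nil)) .nil)
        ((c₁.1, c₂.1) :: acc) := by
  unfold tree1Spanner
  simp

theorem tree1Spanner_succ (d : ℕ) (T : Forest (V × Bool)) {k : ℕ} (acc : List (V × V))
    (hT : ∀ a c₁ d₁ c₂ d₂, T ≠ .node a (.node c₁ d₁ (.node c₂ d₂ .nil)) .nil) :
    tree1Spanner (d + 1) T (k + 1) k acc = tick >>= fun _ => treeEdges none T acc := by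
  unfold tree1Spanner
  simp

theorem tree1Spanner_of_lt (d : ℕ) (T : Forest (V × Bool)) {n k : ℕ} (acc : List (V × V))
    (h : k + 2 ≤ n) : tree1Spanner (d + 1) T n k acc =
      tick >>= fun _ => computeAlpha d (k - 2) n >>= fun ℓ => decomp ℓ T >>= fun M =>
        innerEdges d k M.1 acc >>= fun acc => split (.below none) M.1 [] [] >>= fun r =>
          borderEdges r.2.2 acc >>= fun acc =>
            spanComponents (fun T' m acc => tree1Spanner d T' m k acc) r.2.2 acc := by
  conv_lhs => unfold tree1Spanner
  rw [if_neg (by omega), if_neg (by omega)]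
  unfold innerEdges
  by_cases h2 : k = 2
  · simp [if_pos h2]
  · by_cases h3 : k = 3
    · simp [if_pos h3, h2]
    · simp [if_neg h2, h3]

/-- What is claimed about the edges found and the number of steps, with constant `K`. -/
structure IsResult (K k : ℕ) (T : Forest (V × Bool)) (E : List (V × V)) (steps : ℕ) : Prop where
  edgesIn : EdgesIn T E
  shortcuts : HasShortcuts T (requireds T) E k
  length_even : k % 2 = 0 → E.length ≤ 2 * (requireds T).length * alphaPrime k (requireds T).length
  length_odd : k % 2 = 1 →
    E.length ≤ 3 * (requireds T).length * alphaPrime k (requireds T).length + 2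
  -- Needed for odd `k`: the additive `2` of a subtree must be charged to its required vertices, so
  -- at least two of them must be there whenever there are edges.
  length_small : (requireds T).length ≤ 1 → E.length = 0
  steps_le : steps ≤
    K * (requireds T).length * alphaPrime k (requireds T).length + K * (requireds T).length + 2

/-- The algorithm terminates on `T` and its result satisfies the claim. -/
def Succeeds (K k : ℕ) (T : Forest (V × Bool)) : Prop :=
  ∃ E steps, (∃ d₀, ∀ d ≥ d₀, ∀ acc t, (tree1Spanner d T (requireds T).length k acc).run t =
    some (E ++ acc, t + steps)) ∧ IsResult K k T E steps

theorem isResult_of_le {K k : ℕ} {T : Forest (V × Bool)} {E : List (V × V)} (hk : 2 ≤ k)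
    (hT : T.IsReduced) (hn : (requireds T).length ≤ k + 1) (hK : 4 ≤ K)
    (hE : EdgesIn T E) (hE' : HasShortcuts T (requireds T) E k)
    (hlen : E.length ≤ (parentEdges none T).length +
      if (requireds T).length = k + 1 then 1 else 0) :
    IsResult K k T E (2 * T.size + 2) := by
  obtain ⟨j, rfl⟩ := Nat.exists_eq_add_of_le' hk
  have h1 := hT.size_add_roots_le
  have h2 := length_parentEdges_none T
  have h3 : T.size = 0 ∨ 1 ≤ T.roots.length := by
    rcases Nat.eq_zero_or_pos T.roots.length with h | h
    · left
      rw [eq_nil_of_roots h]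
      rfl
    · exact Or.inr h
  have h4 := hT.roots_le
  set n := (requireds T).length with hn'
  have ha := alphaPrime_small j n (by omega)
  -- A non-empty reduced tree has at most `2 n - 1` vertices and one edge less than vertices.
  have hl : E.length ≤ 2 * n - 2 + if n = j + 2 + 1 then 1 else 0 := by omega
  have hpos : 3 ≤ n → 1 ≤ alphaPrime (j + 2) n := fun h => ha ▸ alpha_pos_of_two_lt j n h
  refine ⟨hE, hE', fun he => ?_, fun ho => ?_, fun h => ?_, ?_⟩ <;> rw [← hn'] at *
  · by_cases hn1 : n ≤ 1
    · rw [if_neg (by omega)] at hl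
      omega
    · have : 1 ≤ alphaPrime (j + 2) n := by
        rw [ha, alpha_even_small j n (by omega) (by omega)]
        split_ifs <;> omega
      have : 2 * n * 1 ≤ 2 * n * alphaPrime (j + 2) n := Nat.mul_le_mul_left _ this
      split_ifs at hl <;> omega
  -- For odd `k` the value `α'_k(2)` is `0`, while a tree with two required vertices may have two
  -- edges; this is what the `+ 2` in the bound is for.
  · by_cases hn1 : n ≤ 2
    · rw [if_neg (by omega)] at hl
      omega
    · have : 3 * n * 1 ≤ 3 * n * alphaPrime (j + 2) n := Nat.mul_le_mul_left _ (hpos (by omega))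
      split_ifs at hl <;> omega
  · rw [if_neg (by omega)] at hl
    omega
  · have : 4 * n ≤ K * n := Nat.mul_le_mul_right _ hK
    omega

theorem succeeds_of_le {K k : ℕ} {T : Forest (V × Bool)} (hk : 2 ≤ k) (hT : T.verts.Nodup)
    (hT' : T.IsReduced) (hn : (requireds T).length ≤ k + 1) (hK : 4 ≤ K) : Succeeds K k T := by
  rcases Nat.lt_or_ge k (requireds T).length with h | h
  · have h : (requireds T).length = k + 1 := by omega
    by_cases hc : ∃ a c₁ d₁ c₂ d₂, T = .node a (.node c₁ d₁ (.node c₂ d₂ .nil)) .nil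
    · obtain ⟨a, c₁, d₁, c₂, d₂, e⟩ := hc
      refine ⟨parentEdges none T ++ [(c₁.1, c₂.1)], 2 * T.size + 2, ⟨1, fun d hd acc t => ?_⟩,
        isResult_of_le hk hT' hn hK ((edgesIn_parentEdges hT).append ?_)
          (hasShortcuts_two_children e hT hT' h) (by simp [h])⟩
      · obtain ⟨d, rfl⟩ : ∃ e, d = e + 1 := ⟨d - 1, by omega⟩
        rw [h, e, tree1Spanner_two_children, run_tick_bind, run_treeEdges]
        simp; omega
      · intro x hx
        obtain rfl : x = (c₁.1, c₂.1) := by simpa using hx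
        subst e
        simp only [verts_node, List.nodup_cons, List.mem_append, List.mem_cons] at hT ⊢
        refine ⟨by simp, by simp, ?_⟩
        intro hcc
        simp [hcc] at hT
    · have hne : ∀ a c₁ d₁ c₂ d₂, T ≠ .node a (.node c₁ d₁ (.node c₂ d₂ .nil)) .nil :=
        fun a c₁ d₁ c₂ d₂ e => hc ⟨a, c₁, d₁, c₂, d₂, e⟩
      refine ⟨parentEdges none T, 2 * T.size + 2, ⟨1, fun d hd acc t => ?_⟩,
        isResult_of_le hk hT' hn hK (edgesIn_parentEdges hT)
          (hasShortcuts_of_ne hT hT' h hne) (by omega)⟩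
      obtain ⟨d, rfl⟩ : ∃ e, d = e + 1 := ⟨d - 1, by omega⟩
      rw [h, tree1Spanner_succ _ _ _ hne, run_tick_bind, run_treeEdges]
      simp; omega
  · refine ⟨parentEdges none T, 2 * T.size + 2, ⟨1, fun d hd acc t => ?_⟩,
      isResult_of_le hk hT' hn hK (edgesIn_parentEdges hT)
        (hasShortcuts_of_le hT hT' h) (by omega)⟩
    obtain ⟨d, rfl⟩ : ∃ e, d = e + 1 := ⟨d - 1, by omega⟩
    rw [tree1Spanner_of_le _ _ _ h, run_tick_bind, run_treeEdges]
    simp; omega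

/-- What is claimed about the edges between the cut vertices. -/
structure IsInnerResult (K k ℓ : ℕ) (T : Forest (V × Bool)) (E : List (V × V)) (steps : ℕ) :
    Prop where
  edgesIn : EdgesIn T E
  shortcuts : HasShortcuts T (cutSet ℓ T) E (k - 2)
  length_even : k % 2 = 0 → E.length ≤ 2 * (requireds T).length
  length_odd : k % 2 = 1 → E.length ≤ 3 * (requireds T).length + 2
  steps_le : steps ≤ K * (requireds T).length + 20 * (requireds T).length

theorem cutSet_nodup {T : Forest (V × Bool)} (hT : T.verts.Nodup) (ℓ : ℕ) :
    (cutSet ℓ T).Nodup := by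
  rw [cutSet, ← requireds_recolored]
  exact requireds_nodup (by rwa [verts_recolored, unmarked_decomposed])

/-- In all three cases `ℓ` is just large enough that `(ℓ + 1) * |CV| ≤ n` makes the edges on `CV`
linear in `n`. -/
theorem exists_innerEdges {K k : ℕ} {T : Forest (V × Bool)} (hk : 2 ≤ k) (hT : T.verts.Nodup)
    (hT' : T.IsReduced) (hn : k + 2 ≤ (requireds T).length)
    (ih : 4 ≤ k → ∀ T' : Forest (V × Bool), T'.verts.Nodup → T'.IsReduced →
      Succeeds K (k - 2) T')
    {ℓ : ℕ} (hℓ : ℓ = alphaPrime (k - 2) (requireds T).length) :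
    ∃ E steps, (∃ d₀, ∀ d ≥ d₀, ∀ acc t,
      (innerEdges d k (decomposed ℓ T).1 acc).run t = some (E ++ acc, t + steps)) ∧
      IsInnerResult K k ℓ T E steps := by
  have hm := mul_length_cutSet_le ℓ T
  have hsize := hT'.size_add_roots_le
  rcases (by omega : k = 2 ∨ k = 3 ∨ 4 ≤ k) with rfl | rfl | hk4
  -- Here `ℓ` is `n / 2` rounded up, so two cuts would need more than `n` required vertices.
  · have h1 : (cutSet ℓ T).length ≤ 1 := by
      rw [Nat.sub_self, alphaPrime_zero, alpha_zero_eq] at hℓ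
      by_contra h
      have : (ℓ + 1) * 2 ≤ (ℓ + 1) * (cutSet ℓ T).length := Nat.mul_le_mul_left _ (by omega)
      omega
    exact ⟨[], 0, ⟨0, fun d _ acc t => rfl⟩, by simp [EdgesIn], hasShortcuts_of_length_le_one h1 _,
      by simp, by simp, by simp⟩
  · have h1 : (requireds T).length ≤ ℓ * ℓ := by
      have : ℓ = alpha 1 (requireds T).length := by rw [hℓ]; exact alphaPrime_one _
      rw [this]
      exact le_alpha_one_sq _
    have h2 : (cutSet ℓ T).length ≤ ℓ := by
      by_contra h
      have : (ℓ + 1) * ℓ ≤ (ℓ + 1) * (cutSet ℓ T).length := Nat.mul_le_mul_left _ (by omega)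
      nlinarith
    have h3 : (cutSet ℓ T).length * (cutSet ℓ T).length ≤ (requireds T).length := by nlinarith
    have h4 := length_completePairs_le (cutSet ℓ T)
    obtain ⟨s, hs, hrun⟩ := run_completeEdges (cutSet ℓ T)
    refine ⟨completePairs (cutSet ℓ T), 2 * (decomposed ℓ T).1.size + 1 + s,
      ⟨0, fun d _ acc t => ?_⟩, ?_, hasShortcuts_completePairs T _, by omega, by omega, ?_⟩
    · rw [innerEdges, if_neg (by omega), if_pos rfl, run_bind_of_eq (run_cutVertices _ _ _),
        List.append_nil]
      exact (hrun _ _).trans (by rw [add_assoc])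
    · intro e he
      have := mem_of_mem_completePairs (cutSet_nodup hT ℓ) he
      exact ⟨mem_verts_of_mem_cutSet this.1, mem_verts_of_mem_cutSet this.2.1, this.2.2⟩
    · have := hs
      rw [size_decomposed]
      nlinarith
  · set M := (decomposed ℓ T).1 with hM
    have hMT : unmarked M = T := unmarked_decomposed ℓ T
    have hnd : (recolored M).verts.Nodup := by rwa [verts_recolored, hMT]
    have hreq : (requireds (pruned (recolored M))).length = (cutSet ℓ T).length := by
      rw [(requireds_pruned _).length_eq, requireds_recolored, cutSet]
    obtain ⟨E, s, ⟨d₀, hrun⟩, hres⟩ := ih hk4 (pruned (recolored M))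
      ((verts_pruned_sublist _).nodup hnd) (pruned_isReduced _)
    rw [hreq] at hrun
    have hα : alphaPrime (k - 2) (cutSet ℓ T).length ≤ ℓ := by
      have h : (cutSet ℓ T).length ≤ (requireds T).length := by nlinarith
      exact (alphaPrime_mono _ h).trans hℓ.ge
    -- By monotonicity the factor `α'_{k-2}(|CV|)` is at most `ℓ`, and the summand `|CV|` uses up
    -- the `1` in `ℓ + 1`.
    have hmα : (cutSet ℓ T).length * alphaPrime (k - 2) (cutSet ℓ T).length +
        (cutSet ℓ T).length ≤ (requireds T).length := by nlinarith
    refine ⟨E, 3 * (2 * T.size + 1) + ((cutSet ℓ T).length + 1) + s,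
      ⟨d₀, fun d hd acc t => ?_⟩, ?_, ?_, fun h => ?_, fun h => ?_, ?_⟩
    · rw [innerEdges, if_neg (by omega), if_neg (by omega), run_bind_of_eq (run_recolor _ _),
        run_bind_of_eq (run_prune _ _), run_bind_of_eq (run_cutVertices _ _ _),
        run_bind_of_eq (run_count _ _), List.append_nil]
      refine (hrun d hd _ _).trans ?_
      rw [size_map, size_decomposed]
      congr 2
      simp only [cutSet, ← hM]
      omega
    · refine hres.edgesIn.of_subset fun x hx => ?_
      have := (verts_pruned_sublist _).subset hx
      rwa [verts_recolored, hMT] at this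
    · have := hres.shortcuts.of_pruned hnd
      have := this.of_recolored
      rwa [hMT] at this
    · have := hres.length_even (by omega)
      rw [hreq] at this
      nlinarith
    · have := hres.length_odd (by omega)
      rw [hreq] at this
      nlinarith
    · have := hres.steps_le
      rw [hreq] at this
      have h5 := Nat.mul_le_mul_left K hmα
      nlinarith

end TreeSpanner

namespace TreeSpanner

variable {V : Type}

open Forest

/-! ### The recursive case and the two nested inductions -/

theorem sum_map_le_mul {L : List (Component V)} {f g : Component V → ℕ} (c : ℕ)
    (h : ∀ t ∈ L, f t ≤ c * g t) : (L.map f).sum ≤ c * (L.map g).sum := by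
  rw [← List.sum_map_mul_left]
  exact List.sum_le_sum h

/-- The difference `α'_k(n) - α'_k(ℓ) = 2` is the budget. For even `k` it allows `4 n` edges: `2 n`
inner and `2 n` border edges. For odd `k` it allows `6 n`: `3 n + 2` inner edges, `2 n` border
edges, and `n` for the additive terms of the subtrees, the remaining `2` being the one in the claim.
-/
theorem succeeds_of_lt {c K k : ℕ} {T : Forest (V × Bool)} (hk : 2 ≤ k) (hT : T.verts.Nodup)
    (hT' : T.IsReduced) (hn : k + 2 ≤ (requireds T).length)
    (hc : ∀ j n, j + 2 ≤ n → alphaCost j n ≤ c * n) (hK : c + 100 ≤ K)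
    (ih : 4 ≤ k → ∀ T' : Forest (V × Bool), T'.verts.Nodup → T'.IsReduced →
      Succeeds K (k - 2) T')
    (ih' : ∀ T' : Forest (V × Bool), T'.verts.Nodup → T'.IsReduced →
      (requireds T').length < (requireds T).length → Succeeds K k T') :
    Succeeds K k T := by
  obtain ⟨j, rfl⟩ := Nat.exists_eq_add_of_le' hk
  obtain ⟨n, hn'⟩ : ∃ n, n = (requireds T).length := ⟨_, rfl⟩
  obtain ⟨ℓ, hℓ⟩ : ∃ ℓ, ℓ = alphaPrime j n := ⟨_, rfl⟩
  have hℓlt : ℓ < n := hℓ ▸ alphaPrime_lt j n (by omega)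
  have hrec : alphaPrime (j + 2) n = 2 + alphaPrime (j + 2) ℓ := by
    rw [hℓ]; exact alphaPrime_rec j n (by omega)
  obtain ⟨dα, hα⟩ := run_computeAlpha j n
  obtain ⟨E', s', ⟨d', hrun'⟩, hres'⟩ := exists_innerEdges hk hT hT' hn ih (ℓ := ℓ) (by
    rw [hℓ, hn']; rfl)
  have hreq : ∀ t : Component V, (requireds (pruned t.tree)).length = (requireds t.tree).length :=
    fun t => (requireds_pruned _).length_eq
  have hle : ∀ t ∈ components ℓ T, (requireds t.tree).length ≤ ℓ :=
    length_requireds_component_le ℓ (.below none) T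
  -- Stated for all `t`, with dummy values outside the list, so that `choose` yields total
  -- functions.
  have hcomp : ∀ t : Component V, ∃ E s d, t ∈ components ℓ T →
      (∀ d' ≥ d, ∀ acc x, (tree1Spanner d' (pruned t.tree) (requireds t.tree).length
        (j + 2) acc).run x = some (E ++ acc, x + s)) ∧ IsResult K (j + 2) (pruned t.tree) E s := by
    intro t
    by_cases ht : t ∈ components ℓ T
    · obtain ⟨E, s, ⟨d, h⟩, h'⟩ := ih' (pruned t.tree)
        ((verts_pruned_sublist _).nodup (nodup_component hT ht)) (pruned_isReduced _) (by
          have := hle t ht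
          rw [hreq]
          omega)
      rw [hreq] at h
      exact ⟨E, s, d, fun _ => ⟨h, h'⟩⟩
    · exact ⟨[], 0, 0, fun h => (ht h).elim⟩
  choose E s d hcomp using hcomp
  have hmono : ∀ t ∈ components ℓ T,
      alphaPrime (j + 2) (requireds t.tree).length ≤ alphaPrime (j + 2) ℓ :=
    fun t ht => alphaPrime_mono _ (hle t ht)
  have c1 := sum_border_components_le ℓ T
  have c2 := sum_length_requireds_components_le ℓ T
  have c3 := sum_size_components_le ℓ T
  have c4 := length_components_le ℓ T
  have c5 := hT'.size_add_roots_le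
  rw [← hn'] at c1 c2 c5
  refine ⟨(components ℓ T).reverse.flatMap E ++ (borderPairs (components ℓ T) ++ E'),
    1 + alphaCost j n + (2 * T.size + 1) + s' + (2 * T.size + 1) + borderCost (components ℓ T) +
      (((components ℓ T).map fun x => s x + 4 * x.tree.size + (requireds x.tree).length + 4).sum
        + 1),
    ⟨max dα d' + ((components ℓ T).map d).sum + 1, fun e he acc t => ?_⟩, ?_⟩
  · obtain ⟨e, rfl⟩ : ∃ f, e = f + 1 := ⟨e - 1, by omega⟩
    rw [← hn', tree1Spanner_of_lt _ _ _ (by omega), run_tick_bind, Nat.add_sub_cancel,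
      run_bind_of_eq (hα e (by omega) _), ← hℓ, run_bind_of_eq (run_decomp _ _ _),
      run_bind_of_eq (hrun' e (by omega) _ _), run_bind_of_eq (run_split _ _ _ _ _),
      run_bind_of_eq (run_borderEdges _ _ _)]
    simp only [List.append_nil]
    refine (run_spanComponents E s (components ℓ T) (fun x hx acc t => ?_) _ _).trans ?_
    · refine (hcomp x hx).1 e ?_ acc t
      -- The sum of the depth bounds of the subtrees serves as a common bound.
      have := List.single_le_sum (l := (components ℓ T).map d) (fun _ _ => Nat.zero_le _) _
        (List.mem_map_of_mem hx)
      omega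
    · rw [size_decomposed]
      simp only [List.append_assoc]
      congr 2
      simp only [components]
      omega
  · have hlenB : (borderPairs (components ℓ T)).length ≤ 2 * n := by
      rw [length_borderPairs]; exact c1
    have hlenE : ((components ℓ T).reverse.flatMap E).length =
        ((components ℓ T).map fun t => (E t).length).sum := by
      rw [List.length_flatMap, List.map_reverse, List.sum_reverse]
    refine ⟨?_, ?_, fun h => ?_, fun h => ?_, fun h => by omega, ?_⟩
    · refine EdgesIn.append ?_ ((edgesIn_borderPairs hT ℓ).append hres'.edgesIn)
      intro e he
      obtain ⟨t, ht, he⟩ := List.mem_flatMap.1 he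
      rw [List.mem_reverse] at ht
      exact (hcomp t ht).2.edgesIn.of_subset (fun x hx =>
        mem_verts_of_component ht ((verts_pruned_sublist _).subset hx)) e he
    · refine HasShortcuts.combine hT (ℓ := ℓ) (E' := E') ?_ hres'.shortcuts ?_ ?_
      · exact fun e he => by simp [he]
      · exact fun e he => by simp [he]
      · intro t ht
        refine ⟨E t, fun e he => ?_, (hcomp t ht).2.shortcuts.of_pruned (nodup_component hT ht)⟩
        exact List.mem_append_left _ (List.mem_flatMap.2 ⟨t, by simpa using ht, he⟩)
    · have h1 := hres'.length_even h
      have h2 : ((components ℓ T).map fun t => (E t).length).sum ≤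
          2 * alphaPrime (j + 2) ℓ * ((components ℓ T).map fun t => (requireds t.tree).length).sum :=
        sum_map_le_mul _ fun t ht => by
          have h3 := (hcomp t ht).2.length_even h
          rw [hreq] at h3
          have h4 := Nat.mul_le_mul_left (2 * (requireds t.tree).length) (hmono t ht)
          nlinarith
      have h3 := Nat.mul_le_mul_left (2 * alphaPrime (j + 2) ℓ) c2
      rw [← hn'] at h1 ⊢
      rw [List.length_append, List.length_append, hlenE, hrec]
      nlinarith
    · have h1 := hres'.length_odd h
      -- The `+ 1` per required vertex absorbs the additive `2` of a subtree with at least two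
      -- required vertices; the other subtrees have no edges.
      have h2 : ((components ℓ T).map fun t => (E t).length).sum ≤ (3 * alphaPrime (j + 2) ℓ + 1) *
          ((components ℓ T).map fun t => (requireds t.tree).length).sum :=
        sum_map_le_mul _ fun t ht => by
          have h3 := (hcomp t ht).2.length_odd h
          have h5 := (hcomp t ht).2.length_small
          rw [hreq] at h3 h5
          have h4 := Nat.mul_le_mul_left (3 * (requireds t.tree).length) (hmono t ht)
          rcases Nat.lt_or_ge 1 (requireds t.tree).length with h6 | h6
          · nlinarith
          · rw [h5 h6]
            exact Nat.zero_le _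
      have h3 := Nat.mul_le_mul_left (3 * alphaPrime (j + 2) ℓ + 1) c2
      rw [← hn'] at h1 ⊢
      rw [List.length_append, List.length_append, hlenE, hrec]
      nlinarith
    · have h1 := hres'.steps_le
      have h2 : ((components ℓ T).map fun t => s t).sum ≤
          (K * alphaPrime (j + 2) ℓ + K) *
            ((components ℓ T).map fun t => (requireds t.tree).length).sum +
            2 * (components ℓ T).length := by
        have : ((components ℓ T).map fun t => s t).sum ≤ ((components ℓ T).map fun t =>
            (K * alphaPrime (j + 2) ℓ + K) * (requireds t.tree).length + 2).sum := by
          refine List.sum_le_sum fun t ht => ?_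
          have h3 := (hcomp t ht).2.steps_le
          rw [hreq] at h3
          have h4 := Nat.mul_le_mul_left (K * (requireds t.tree).length) (hmono t ht)
          nlinarith
        refine this.trans ?_
        rw [List.sum_map_add, List.sum_map_mul_left, List.map_const', List.sum_replicate,
          smul_eq_mul, mul_comm 2]
      have h3 := Nat.mul_le_mul_left (K * alphaPrime (j + 2) ℓ + K) c2
      have h4 := hc j n (by omega)
      have h5 : ((components ℓ T).map fun x => s x + 4 * x.tree.size + (requireds x.tree).length
          + 4).sum = ((components ℓ T).map fun t => s t).sum +
          4 * ((components ℓ T).map fun t => t.tree.size).sum +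
          ((components ℓ T).map fun t => (requireds t.tree).length).sum +
          4 * (components ℓ T).length := by
        rw [List.sum_map_add, List.sum_map_add, List.sum_map_add, List.sum_map_mul_left,
          List.map_const', List.sum_replicate, smul_eq_mul, mul_comm 4 (components ℓ T).length]
      rw [← hn'] at h1 ⊢
      rw [h5, borderCost_eq, hrec]
      -- The budget exceeds the bound for the subtrees by `2 * K * n`. One `K * n` goes to the inner
      -- call; the other pays `c * n` for computing `ℓ`, and `100 * n` covers all linear passes, as
      -- the tree has at most `2 * n` vertices.
      have h6 : (c + 100) * n ≤ K * n := Nat.mul_le_mul_right _ hK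
      have h7 : K * n * (2 + alphaPrime (j + 2) ℓ) =
          2 * (K * n) + K * alphaPrime (j + 2) ℓ * n := by ring
      have h8 : (K * alphaPrime (j + 2) ℓ + K) * n = K * alphaPrime (j + 2) ℓ * n + K * n := by ring
      have h9 : (c + 100) * n = c * n + 100 * n := by ring
      omega

/-- The algorithm is correct on reduced forests. -/
theorem succeeds {c K : ℕ} (hc : ∀ j n, j + 2 ≤ n → alphaCost j n ≤ c * n) (hK : c + 100 ≤ K)
    (k : ℕ) (hk : 2 ≤ k) (T : Forest (V × Bool)) (hT : T.verts.Nodup) (hT' : T.IsReduced) :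
    Succeeds K k T := by
  induction k using Nat.strong_induction_on generalizing T with
  | _ k ihk =>
    obtain ⟨n, hn⟩ : ∃ n, n = (requireds T).length := ⟨_, rfl⟩
    induction n using Nat.strong_induction_on generalizing T with
    | _ n ihn =>
      by_cases h : (requireds T).length ≤ k + 1
      · exact succeeds_of_le hk hT hT' h (by omega)
      · exact succeeds_of_lt hk hT hT' (by omega) hc hK
          (fun h4 T' h₁ h₂ => ihk (k - 2) (by omega) (by omega) T' h₁ h₂)
          (fun T' h₁ h₂ h₃ => ihn _ (by omega) T' h₁ h₂ rfl)

end TreeSpanner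

namespace TreeSpanner

variable {V : Type}

open Forest

open scoped ENNReal NNReal

/-! ### Pruned trees are reduced -/

/-- Suppose a Steiner vertex `x` has at most one child. Required descendants of `x` differ from `x`,
so any two of them lie below that one child, which is then a common ancestor; were `x` their LCA,
the child would be an ancestor of `x`. The statement is about subforests `S` closed under children,
because the LCA condition refers to the whole tree and the induction descends. -/
theorem isReduced_of_closed {T S : Forest (V × Bool)} (hT : T.verts.Nodup) (h : T.IsPruned)
    (hS : S.verts.Nodup) (hlab : ∀ a ∈ S.labels, a ∈ T.labels)
    (hcl : ∀ x ∈ S.verts, ∀ y, T.IsChild x y → S.IsChild x y) : S.IsReduced := by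
  induction S with
  | nil => trivial
  | node a c s hc hs =>
    have hS' := nodup_node.1 hS
    have hclc : ∀ x ∈ c.verts, ∀ y, T.IsChild x y → c.IsChild x y := by
      intro x hx y hxy
      rcases hcl x (by simp [hx]) y hxy with ⟨rfl, -⟩ | h | h
      · exact (hS'.1 hx).elim
      · exact h
      · exact (hS'.2.2.2.2 x hx h.mem.1).elim
    have hcls : ∀ x ∈ s.verts, ∀ y, T.IsChild x y → s.IsChild x y := by
      intro x hx y hxy
      rcases hcl x (by simp [hx]) y hxy with ⟨rfl, -⟩ | h | h
      · exact (hS'.2.1 hx).elim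
      · exact (hS'.2.2.2.2 x h.mem.1 hx).elim
      · exact h
    refine ⟨?_, hc hS'.2.2.1 (fun b hb => hlab b (by simp [labels, hb])) hclc,
      hs hS'.2.2.2.1 (fun b hb => hlab b (by simp [labels, hb])) hcls⟩
    by_contra hcon
    obtain ⟨x, b⟩ := a
    simp only [not_or, Bool.not_eq_true, not_le] at hcon
    obtain ⟨rfl, hlen⟩ := hcon
    have hx : (x, false) ∈ T.labels := hlab _ (by simp [labels])
    obtain ⟨u, hu, v, hv, hxu, hxv, hmin⟩ := h x hx
    have key : ∀ u ∈ T.required, T.IsAncestor x u →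
        ∃ y ∈ c.roots.map Prod.fst, T.IsChild x y ∧ T.IsAncestor y u := by
      intro u hu hxu
      rcases Relation.ReflTransGen.cases_head hxu with rfl | ⟨y, hxy, hyu⟩
      · exact absurd (label_unique hT hx hu) (by simp)
      · refine ⟨y, ?_, hxy, hyu⟩
        rcases hcl x (by simp) y hxy with ⟨-, h⟩ | h | h
        · exact h
        · exact (hS'.1 h.mem.1).elim
        · exact (hS'.2.1 h.mem.1).elim
    obtain ⟨y, hy, hxy, hyu⟩ := key u hu hxu
    obtain ⟨z, hz, -, hzv⟩ := key v hv hxv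
    have hyz : y = z := by
      obtain ⟨r, hr⟩ : ∃ r, c.roots.map Prod.fst = [r] := by
        rw [← List.length_eq_one_iff, List.length_map]
        have : c.roots.length ≠ 0 := by
          intro h0
          rw [List.length_eq_zero_iff.1 h0] at hy
          simp at hy
        omega
      rw [hr, List.mem_singleton] at hy hz
      rw [hy, hz]
    subst hyz
    have hyx : T.IsAncestor y x := hmin y hyu hzv
    have hstay : ∀ w, T.IsAncestor y w → w ∈ c.verts := by
      intro w hw
      induction hw with
      | refl => exact mem_verts_of_mem_roots hy
      | tail _ hbc ih => exact (hclc _ ih _ hbc).mem.2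
    exact hS'.1 (hstay x hyx)

theorem isReduced_of_isPruned {T : Forest (V × Bool)} (hT : T.verts.Nodup) (h : T.IsPruned) :
    T.IsReduced :=
  isReduced_of_closed hT h hT (fun _ h => h) (fun _ _ _ h => h)

theorem ncard_required {T : Forest (V × Bool)} (hT : T.verts.Nodup) :
    T.required.ncard = (requireds T).length := by
  classical
  have : T.required = ((requireds T).toFinset : Set V) := by
    ext x
    simp [required, mem_requireds]
  rw [this, Set.ncard_coe_finset, List.toFinset_card_of_nodup (requireds_nodup hT)]

/-! ### Walks and lists of vertices -/

theorem graph_adj {T : Forest (V × Bool)} (hT : T.verts.Nodup) {x y : V} :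
    T.graph.Adj x y ↔ T.Linked x y := by
  rw [graph, SimpleGraph.fromRel_adj]
  exact ⟨fun h => h.2, fun h => ⟨h.elim (fun h => h.ne hT) (fun h => (h.ne hT).symm), h⟩⟩

theorem graphOf_adj {T : Forest (V × Bool)} {E : List (V × V)} (hE : EdgesIn T E) {x y : V}
    (h : Joined E x y) : (graphOf E).Adj x y := by
  rw [graphOf, SimpleGraph.fromEdgeSet_adj]
  rcases h with h | h
  · exact ⟨⟨_, h, rfl⟩, (hE _ h).2.2⟩
  · exact ⟨⟨_, h, Sym2.eq_swap⟩, (hE _ h).2.2.symm⟩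

theorem exists_walk_of_isChain {G : SimpleGraph V} (q : List V) {u v : V} (hu : q.head? = some u)
    (hv : q.getLast? = some v) (hq : q.IsChain G.Adj) : ∃ w : G.Walk u v, w.support = q := by
  induction q generalizing u with
  | nil => simp at hu
  | cons a q ih =>
    obtain rfl : a = u := by simpa using hu
    cases q with
    | nil =>
      obtain rfl : a = v := by simpa using hv
      exact ⟨.nil, rfl⟩
    | cons b q =>
      rw [List.isChain_cons_cons] at hq
      obtain ⟨w, hw⟩ := ih (u := b) rfl (by simpa [List.getLast?_cons_cons] using hv) hq.2
      exact ⟨.cons hq.1 w, by rw [SimpleGraph.Walk.support_cons, hw]⟩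

theorem isPathList_support {T : Forest (V × Bool)} (hT : T.verts.Nodup) {u v : V}
    (hu : u ∈ T.verts) {p : T.graph.Walk u v} (hp : p.IsPath) : T.IsPathList p.support := by
  have h := p.isChain_adj_support
  rw [← p.cons_tail_support] at h
  have := isChain_of_closed (S := T.Linked) (P := fun x => x ∈ T.verts) (Q := fun _ => True)
    (fun x y hxy _ _ => ⟨((graph_adj hT).1 hxy).mem.2, (graph_adj hT).1 hxy⟩) _ _ h (by simp) hu
  rw [p.cons_tail_support] at this
  exact ⟨hp.support_nodup, this.1, this.2⟩

/-- Short monotone paths exist along every path of the tree. -/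
theorem exists_monotone_walk {T : Forest (V × Bool)} (hT : T.verts.Nodup) {E : List (V × V)}
    (hE : EdgesIn T E) {k : ℕ} (h : HasShortcuts T (requireds T) E k) {u v : V}
    (hu : u ∈ T.required) (hv : v ∈ T.required) {p : T.graph.Walk u v} (hp : p.IsPath) :
    ∃ q : (graphOf E).Walk u v, q.support.Sublist p.support ∧ q.length ≤ k := by
  have hu' : u ∈ requireds T := mem_requireds.2 hu
  have h₁ : p.support.head? = some u := by rw [← p.cons_tail_support]; rfl
  have h₂ : p.support.getLast? = some v := by
    rw [List.getLast?_eq_some_getLast p.support_ne_nil, p.getLast_support]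
  obtain ⟨q, hq, hq', hq''⟩ := h p.support
    (isPathList_support hT (mem_verts_of_mem_requireds hu') hp) u hu' v (mem_requireds.2 hv) h₁ h₂
  obtain ⟨w, rfl⟩ := exists_walk_of_isChain (G := graphOf E) q (hq.head.trans h₁)
    (hq.last.trans h₂) (hq'.imp fun _ _ h => graphOf_adj hE h)
  refine ⟨w, hq.sublist, ?_⟩
  rw [SimpleGraph.Walk.length_support] at hq''
  omega

theorem exists_root {T : Forest (V × Bool)} (hT : T.verts.Nodup) {x : V} (hx : x ∈ T.verts) :
    ∃ r ∈ T.roots.map Prod.fst, Relation.ReflTransGen T.IsChild r x := by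
  induction T with
  | nil => simp at hx
  | node a c s hc hs =>
    have hT' := nodup_node.1 hT
    simp only [verts_node, List.mem_cons, List.mem_append] at hx
    simp only [roots, List.map_cons, List.mem_cons]
    rcases hx with rfl | hx | hx
    · exact ⟨a.1, Or.inl rfl, .refl⟩
    · obtain ⟨r, hr, h⟩ := hc hT'.2.2.1 hx
      exact ⟨a.1, Or.inl rfl, .head (Or.inl ⟨rfl, hr⟩)
        (Relation.ReflTransGen.mono (fun _ _ h => Or.inr (Or.inl h)) _ _ h)⟩
    · obtain ⟨r, hr, h⟩ := hs hT'.2.2.2.1 hx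
      exact ⟨r, Or.inr hr, Relation.ReflTransGen.mono (fun _ _ h => Or.inr (Or.inr h)) _ _ h⟩

theorem reachable_of_isSteinerTree {T : Forest (V × Bool)} (hT : T.IsSteinerTree) {x y : V}
    (hx : x ∈ T.verts) (hy : y ∈ T.verts) : T.graph.Reachable x y := by
  have key : ∀ r x, Relation.ReflTransGen T.IsChild r x → T.graph.Reachable r x := by
    intro r x h
    induction h with
    | refl => exact SimpleGraph.Reachable.refl _
    | tail _ hbc ih => exact ih.trans ((graph_adj hT.1).2 (Or.inl hbc)).reachable
  obtain ⟨r, hr, h⟩ := exists_root hT.1 hx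
  obtain ⟨r', hr', h'⟩ := exists_root hT.1 hy
  obtain rfl : r = r' := by
    have h2 := hT.2
    match hroots : T.roots with
    | [] => rw [hroots] at hr; simp at hr
    | [a] =>
      rw [hroots] at hr hr'
      simp at hr hr'
      rw [hr, hr']
    | a :: b :: l => rw [hroots] at h2; simp at h2
  exact (key _ _ h).symm.trans (key _ _ h')

theorem monotoneDiam_le {T : Forest (V × Bool)} (hT : T.IsSteinerTree) {E : List (V × V)}
    (hE : EdgesIn T E) {k : ℕ} (h : HasShortcuts T (requireds T) E k) :
    monotoneDiam T.graph (graphOf E) T.required ≤ (k : ℕ∞) := by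
  refine iSup₂_le fun u hu => iSup₂_le fun v hv => ?_
  obtain ⟨p, hp⟩ := (reachable_of_isSteinerTree hT
    (mem_verts_of_mem_requireds (mem_requireds.2 hu))
    (mem_verts_of_mem_requireds (mem_requireds.2 hv))).exists_isPath
  obtain ⟨q, hq, hq'⟩ := exists_monotone_walk hT.1 hE h hu hv hp
  exact (iInf₂_le q ⟨p, hp, hq⟩).trans (by exact_mod_cast hq')

/-! ### Distances -/

theorem weightedDist_self (G : SimpleGraph V) (w : V → V → ℝ≥0∞) (u : V) :
    weightedDist G w u u = 0 :=
  le_antisymm ((iInf_le _ SimpleGraph.Walk.nil).trans (by simp)) (zero_le)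

theorem weightedDist_triangle (G : SimpleGraph V) (w : V → V → ℝ≥0∞) (u x v : V) :
    weightedDist G w u v ≤ weightedDist G w u x + weightedDist G w x v := by
  unfold weightedDist
  rw [ENNReal.iInf_add]
  refine le_iInf fun p => ?_
  rw [ENNReal.add_iInf]
  refine le_iInf fun q => (iInf_le _ (p.append q)).trans ?_
  simp

theorem weightedDist_le_of_adj {G : SimpleGraph V} (w : V → V → ℝ≥0∞) {u v : V} (h : G.Adj u v) :
    weightedDist G w u v ≤ w u v :=
  (iInf_le _ (SimpleGraph.Walk.cons h .nil)).trans (by simp)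

/-- The sum of the weights of consecutive pairs. -/
noncomputable def listWeight (w : V → V → ℝ≥0∞) : List V → ℝ≥0∞
  | [] => 0
  | [_] => 0
  | a :: b :: l => w a b + listWeight w (b :: l)

theorem sum_darts_eq_listWeight {G : SimpleGraph V} (w : V → V → ℝ≥0∞) {u v : V}
    (p : G.Walk u v) : (p.darts.map fun d => w d.fst d.snd).sum = listWeight w p.support := by
  induction p with
  | nil => simp [listWeight]
  | cons h p ih =>
    rw [SimpleGraph.Walk.darts_cons, SimpleGraph.Walk.support_cons, List.map_cons, List.sum_cons, ih,
      ← p.cons_tail_support]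
    rfl

/-- Here `a` is the last vertex that was kept and `b` the current position in the full sequence; the
distance from `a` to `b` collects the skipped steps by the triangle inequality. -/
theorem listWeight_le_of_sublist {G : SimpleGraph V} (w : V → V → ℝ≥0∞) {r l : List V}
    (h : r.Sublist l) (a b : V) (hl : (b :: l).IsChain G.Adj) :
    listWeight (weightedDist G w) (a :: r) ≤ weightedDist G w a b + listWeight w (b :: l) := by
  induction h generalizing a b with
  | slnil => simp [listWeight]
  | @cons r l c h ih =>
    rw [List.isChain_cons_cons] at hl
    refine (ih a c hl.2).trans ?_
    rw [listWeight, ← add_assoc]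
    gcongr
    exact (weightedDist_triangle G w a b c).trans (by gcongr; exact weightedDist_le_of_adj w hl.1)
  | @cons_cons r l c h ih =>
    rw [List.isChain_cons_cons] at hl
    have := ih c c hl.2
    rw [weightedDist_self, zero_add] at this
    rw [listWeight, listWeight, ← add_assoc]
    gcongr
    exact (weightedDist_triangle G w a b c).trans (by gcongr; exact weightedDist_le_of_adj w hl.1)

theorem sum_darts_le_of_sublist {G H : SimpleGraph V} (w : V → V → ℝ≥0∞) {u v : V}
    (p : G.Walk u v) (q : H.Walk u v) (h : q.support.Sublist p.support) :
    (q.darts.map fun d => weightedDist G w d.fst d.snd).sum ≤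
      (p.darts.map fun d => w d.fst d.snd).sum := by
  rw [sum_darts_eq_listWeight, sum_darts_eq_listWeight]
  rw [← p.cons_tail_support, ← q.cons_tail_support] at h ⊢
  have := listWeight_le_of_sublist (G := G) w h.of_cons_cons u u
    (by rw [p.cons_tail_support]; exact p.isChain_adj_support)
  rwa [weightedDist_self, zero_add] at this

theorem le_weightedDist {G H : SimpleGraph V} (w : V → V → ℝ≥0∞) (u v : V) :
    weightedDist G w u v ≤ weightedDist H (weightedDist G w) u v := by
  refine le_iInf fun q => ?_
  induction q with
  | nil => rw [weightedDist_self]; exact zero_le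
  | @cons u x v h q ih =>
    rw [SimpleGraph.Walk.darts_cons, List.map_cons, List.sum_cons]
    exact (weightedDist_triangle G w u x v).trans (by gcongr)

/-- No walk in the spanner beats the metric, by the triangle inequality. Conversely, every walk in
the tree contains a path, and a monotone walk along this path is no longer than the path. -/
theorem isOneSpanner_of_hasShortcuts {T : Forest (V × Bool)} (hT : T.verts.Nodup)
    {E : List (V × V)} (hE : EdgesIn T E) {k : ℕ} (h : HasShortcuts T (requireds T) E k) :
    IsOneSpanner T.graph (graphOf E) T.required := by
  classical
  intro w u hu v hv
  refine le_antisymm (le_iInf fun p => ?_) (le_weightedDist _ u v)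
  obtain ⟨q, hq, -⟩ := exists_monotone_walk hT hE h hu hv p.bypass_isPath
  refine (iInf_le _ q).trans ((sum_darts_le_of_sublist _ p.bypass q hq).trans ?_)
  exact (p.darts_bypass_sublist_darts.map _).sum_le_sum (fun _ _ => zero_le)

/-! ### Edge counts, the final constant, and the theorem -/

theorem ncard_edgeSet_graphOf_le (E : List (V × V)) : (graphOf E).edgeSet.ncard ≤ E.length := by
  classical
  have h : (graphOf E).edgeSet ⊆ ((E.map fun p => s(p.1, p.2)).toFinset : Set (Sym2 V)) := by
    intro e he
    rw [graphOf, SimpleGraph.edgeSet_fromEdgeSet] at he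
    obtain ⟨p, hp, rfl⟩ := he.1
    simp only [List.coe_toFinset, List.mem_map, Set.mem_ofPred_eq]
    exact ⟨p, hp, rfl⟩
  refine (Set.ncard_le_ncard h (Finset.finite_toSet _)).trans ?_
  rw [Set.ncard_coe_finset]
  exact (List.toFinset_card_le _).trans (by simp)

/-- The linear term is absorbed because `α_k(n)` vanishes only for `n ≤ 2`, whence `n ≤ n α_k(n) +
2`; the factor `40` is generous. -/
theorem mul_alphaPrime_le (K j n : ℕ) :
    K * n * alphaPrime (j + 2) n + K * n + 2 ≤ (40 * K + 2) * (n * alpha (j + 2) n + 1) := by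
  have h1 := Nat.mul_le_mul_left (K * n) (alphaPrime_le_two_mul_alpha j n)
  have h2 : n ≤ n * alpha (j + 2) n + 2 := by
    rcases Nat.lt_or_ge n 3 with h | h
    · omega
    · have := Nat.mul_le_mul_left n (alpha_pos_of_two_lt j n h)
      omega
  have h3 := Nat.mul_le_mul_left K h2
  nlinarith [Nat.zero_le (K * (n * alpha (j + 2) n)), Nat.zero_le (n * alpha (j + 2) n)]

end TreeSpanner

theorem mainTheorem1 :
    ∃ C : ℕ, ∀ (V : Type) (T : TreeSpanner.Forest (V × Bool)) (k n : ℕ),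
      2 ≤ k → T.IsSteinerTree → T.IsPruned → T.required.ncard = n →
      ∃ (E : List (V × V)) (steps : ℕ),
        (∃ d₀, ∀ d ≥ d₀,
          (TreeSpanner.tree1Spanner d T n k []).run 0 = some (E, steps)) ∧
        (∀ e ∈ E, e.1 ∈ T.verts ∧ e.2 ∈ T.verts ∧ e.1 ≠ e.2) ∧
        TreeSpanner.IsOneSpanner T.graph (TreeSpanner.graphOf E) T.required ∧
        TreeSpanner.monotoneDiam T.graph (TreeSpanner.graphOf E) T.required ≤ (k : ℕ∞) ∧
        (Even k →
          (TreeSpanner.graphOf E).edgeSet.ncard ≤ 2 * n * TreeSpanner.alphaPrime k n) ∧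
        (Odd k →
          (TreeSpanner.graphOf E).edgeSet.ncard ≤ 3 * n * TreeSpanner.alphaPrime k n + 2) ∧
        (TreeSpanner.graphOf E).edgeSet.ncard ≤ C * (n * TreeSpanner.alpha k n + 1) ∧
        steps ≤ C * (n * TreeSpanner.alpha k n + 1) := by
  obtain ⟨c, hc⟩ := TreeSpanner.exists_alphaCost_le
  refine ⟨40 * (c + 100) + 2, fun V T k n hk hT hp hn => ?_⟩
  rw [TreeSpanner.ncard_required hT.1] at hn
  obtain ⟨E, steps, ⟨d₀, hrun⟩, hres⟩ := TreeSpanner.succeeds hc le_rfl k hk T hT.1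
    (TreeSpanner.isReduced_of_isPruned hT.1 hp)
  have heven := hres.length_even
  have hodd := hres.length_odd
  have hsteps := hres.steps_le
  rw [hn] at hrun heven hodd hsteps
  have hE := TreeSpanner.ncard_edgeSet_graphOf_le E
  obtain ⟨j, rfl⟩ := Nat.exists_eq_add_of_le' hk
  have hbound := TreeSpanner.mul_alphaPrime_le (c + 100) j n
  refine ⟨E, steps, ⟨d₀, fun d hd => ?_⟩, hres.edgesIn,
    TreeSpanner.isOneSpanner_of_hasShortcuts hT.1 hres.edgesIn hres.shortcuts,
    TreeSpanner.monotoneDiam_le hT hres.edgesIn hres.shortcuts,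
    fun h => hE.trans (heven (Nat.even_iff.1 h)), fun h => hE.trans (hodd (Nat.odd_iff.1 h)),
    ?_, hsteps.trans hbound⟩
  · rw [hrun d hd, List.append_nil, Nat.zero_add]
  · refine hE.trans (le_trans ?_ hbound)
    have h1 : 3 * (n * TreeSpanner.alphaPrime (j + 2) n) ≤
        (c + 100) * (n * TreeSpanner.alphaPrime (j + 2) n) := Nat.mul_le_mul_right _ (by omega)
    rcases Nat.mod_two_eq_zero_or_one (j + 2) with h | h
    · have := heven h
      nlinarith
    · have := hodd h
      nlinarith
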